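/- Let $X=\{x_1,\dots,x_n\}$ be a finite alphabet. A directed graph with edges labelled by $X$ is *folded* if no two different edges with the same label have the same initial vertex or the same terminal vertex. An *elementary folding* of such a graph is the quotient map that identifies two different edges which have the same label and the same initial vertex, or the same label and the same terminal vertex; their endpoints are identified accordingly, and nothing else is identified. For words $J_1,\dots,J_m$ in $X^{\pm1}$ let $\Gamma_0$ be the bouquet of $m$ loops at a base vertex $v_0$ with labels $J_1,\dots,J_m$ (a letter $x$ is an edge labelled $x$ in the reading direction, a letter $x^{-1}$ an edge labelled $x$ in the opposite direction), and let $N=\sum_i|J_i|$. Let $\log^*(N)$ be the least $k\ge 0$ such that the $k$-fold iterate of the binary logarithm takes $N$ to a number $\le 1$. Running time is counted on machines that have finitely many variables and finitely many unary functions (fields, pointers) on objects named by natural numbers. Assigning a variable (a constant, another variable, or the successor of a variable), evaluating a field at one object, changing the value of a field at one object, and comparing two variables (a conditional jump) cost one unit each; there is no other arithmetic. **Theorem.** For every $n$ there are a program and a constant $C$, both depending only on $n$, such that on every input $J_1,\dots,J_m$ (words in $X^{\pm1}$, not necessarily reduced) the program halts and has then computed a sequence of elementary foldings $\Gamma_0\to\Gamma_1\to\dots\to\Gamma_M=\Gamma$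 such that $\Gamma$ is folded: it outputs the list of the $M$ pairs of edges that are successively identified, each edge named by an edge of $\Gamma_0$, together with the folded graph $\Gamma=\Gamma(J_1,\dots,J_m)$ and the image of $v_0$ in it. If the words $J_i$ are non-empty and $N\ge 2$, it does so in at most $C\cdot N\cdot\log^*(N)$ steps; that is, the running time is $O(N\cdot\log^*(N))$. -/

import Mathlib

namespace Stallings

/-! ### Directed labelled graphs and foldings -/

/-- A directed graph (loops and multiple edges allowed) with edges labelled by `X`. -/
structure LGraph (X : Type) where
  V : Type
  E : Type
  src : E → V
  tgt : E → V
  label : E → X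

namespace LGraph

variable {X : Type}

/-- Morphisms of directed labelled graphs. -/
structure Hom (Γ Δ : LGraph X) where
  onV : Γ.V → Δ.V
  onE : Γ.E → Δ.E
  src_onE : ∀ e, Δ.src (onE e) = onV (Γ.src e)
  tgt_onE : ∀ e, Δ.tgt (onE e) = onV (Γ.tgt e)
  label_onE : ∀ e, Δ.label (onE e) = Γ.label e

/-- The identity morphism. -/
def Hom.id (Γ : LGraph X) : Hom Γ Γ where
  onV := fun v => v
  onE := fun e => e
  src_onE := fun _ => rfl
  tgt_onE := fun _ => rfl
  label_onE := fun _ => rfl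

/-- Composition: first `π`, then `ρ`. -/
def Hom.comp {Γ Δ Θ : LGraph X} (ρ : Hom Δ Θ) (π : Hom Γ Δ) : Hom Γ Θ where
  onV := fun v => ρ.onV (π.onV v)
  onE := fun e => ρ.onE (π.onE e)
  src_onE := fun e => by rw [ρ.src_onE, π.src_onE]
  tgt_onE := fun e => by rw [ρ.tgt_onE, π.tgt_onE]
  label_onE := fun e => by rw [ρ.label_onE, π.label_onE]

/-- `Γ` is folded: at each vertex there is at most one outgoing and at most one incoming edge
with a given label. -/
def Folded (Γ : LGraph X) : Prop :=
  ∀ e e' : Γ.E, Γ.label e = Γ.label e' → (Γ.src e = Γ.src e' ∨ Γ.tgt e = Γ.tgt e') → e = e'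

/-- `π : Γ → Δ` is the elementary folding that identifies `e₁` with `e₂`: these are two
different edges with the same label which both start or both end at some vertex; `π` is a
quotient map that identifies them and their endpoints, and identifies nothing else. -/
structure IsElementaryFolding {Γ Δ : LGraph X} (π : Hom Γ Δ) (e₁ e₂ : Γ.E) : Prop where
  ne : e₁ ≠ e₂
  label_eq : Γ.label e₁ = Γ.label e₂
  incidence : Γ.src e₁ = Γ.src e₂ ∨ Γ.tgt e₁ = Γ.tgt e₂
  onV_surjective : Function.Surjective π.onV
  onE_surjective : Function.Surjective π.onE
  onV_eq_iff : ∀ u w : Γ.V, π.onV u = π.onV w ↔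
    u = w ∨
    (u = Γ.src e₁ ∧ w = Γ.src e₂) ∨ (u = Γ.src e₂ ∧ w = Γ.src e₁) ∨
    (u = Γ.tgt e₁ ∧ w = Γ.tgt e₂) ∨ (u = Γ.tgt e₂ ∧ w = Γ.tgt e₁)
  onE_eq_iff : ∀ e e' : Γ.E, π.onE e = π.onE e' ↔
    e = e' ∨ (e = e₁ ∧ e' = e₂) ∨ (e = e₂ ∧ e' = e₁)

/-- `FoldingSequence π L`: the morphism `π : Γ₀ → Γ_M` is the composition of a sequence
`Γ₀ → Γ₁ → ⋯ → Γ_M` of elementary foldings, where `L` is a list of `M` pairs of edges of `Γ₀`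
and the `k`-th folding identifies the images in its domain of the two edges of the `k`-th
pair. -/
inductive FoldingSequence {Γ₀ : LGraph X} :
    {Γ : LGraph X} → Hom Γ₀ Γ → List (Γ₀.E × Γ₀.E) → Prop
  | nil : FoldingSequence (Hom.id Γ₀) []
  | snoc {Γ Δ : LGraph X} {π : Hom Γ₀ Γ} {L : List (Γ₀.E × Γ₀.E)} (ρ : Hom Γ Δ)
      (e₁ e₂ : Γ₀.E) (hL : FoldingSequence π L)
      (hρ : IsElementaryFolding ρ (π.onE e₁) (π.onE e₂)) :
      FoldingSequence (ρ.comp π) (L ++ [(e₁, e₂)])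

end LGraph

/-! ### Words and bouquets -/

/-- Words in `X^{±1}` for `X = {x_0, …, x_{n-1}}`; the letter `(x, true)` is `x` and
`(x, false)` is `x⁻¹`, as for `FreeGroup`. -/
abbrev Word (n : ℕ) : Type := List (Fin n × Bool)

/-- The total length of a list of words. -/
def totalLength {n : ℕ} (J : List (Word n)) : ℕ := (J.map List.length).sum

/-- The edges of the bouquet: one for each letter occurrence. -/
abbrev BouquetEdge {n : ℕ} (J : List (Word n)) : Type :=
  (i : Fin J.length) × Fin (J.get i).length

/-- The vertices of the bouquet: the base vertex `none`, and the `ℓ - 1` inner vertices of each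
loop of length `ℓ`. -/
abbrev BouquetVertex {n : ℕ} (J : List (Word n)) : Type :=
  Option ((i : Fin J.length) × Fin ((J.get i).length - 1))

/-- The vertex reached on the `i`-th loop after reading `p` letters from the base vertex. -/
def loopVertex {n : ℕ} (J : List (Word n)) (i : Fin J.length) (p : ℕ) : BouquetVertex J :=
  if h : 0 < p ∧ p < (J.get i).length then some ⟨i, ⟨p - 1, by omega⟩⟩ else none

/-- The bouquet of loops labelled by the words of `J`, all attached at the base vertex `none`:
a letter `x` is an edge labelled `x` in the reading direction, a letter `x⁻¹` an edge labelled
`x` against it. -/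
def bouquet {n : ℕ} (J : List (Word n)) : LGraph (Fin n) where
  V := BouquetVertex J
  E := BouquetEdge J
  src := fun e =>
    if ((J.get e.1).get e.2).2 then loopVertex J e.1 e.2 else loopVertex J e.1 (e.2 + 1)
  tgt := fun e =>
    if ((J.get e.1).get e.2).2 then loopVertex J e.1 (e.2 + 1) else loopVertex J e.1 e.2
  label := fun e => ((J.get e.1).get e.2).1

/-- The base vertex of the bouquet. -/
def bouquetBase {n : ℕ} (J : List (Word n)) : (bouquet J).V := (none : BouquetVertex J)

/-! ### Machines

The storage of a machine consists of registers (variables) and of unary functions `ℕ → ℕ`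
(fields, pointers) on objects that are named by natural numbers. Assigning a variable, evaluating
a field at one object, changing the value of a field at one object, taking a successor, and
comparing two variables cost one time unit each. There is no other arithmetic. A program is
finite, so it uses finitely many registers and fields. -/

inductive Instr where
  /-- `reg r := k` for a constant `k` -/
  | const (r k : ℕ)
  /-- `reg r := reg s` -/
  | copy (r s : ℕ)
  /-- `reg r := reg s + 1` -/
  | succ (r s : ℕ)
  /-- `reg r := field f (reg a)` -/
  | load (r f a : ℕ)
  /-- `field f (reg a) := reg r` -/
  | store (f a r : ℕ)
  /-- go to line `l` if `reg r = reg s` -/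
  | jumpEq (r s l : ℕ)
  /-- go to line `l` if `reg r < reg s` -/
  | jumpLt (r s l : ℕ)

abbrev Program : Type := List Instr

structure Config where
  pc : ℕ
  reg : ℕ → ℕ
  field : ℕ → ℕ → ℕ

/-- The effect of one instruction. -/
def Instr.exec (c : Config) : Instr → Config
  | .const r k => { c with pc := c.pc + 1, reg := Function.update c.reg r k }
  | .copy r s => { c with pc := c.pc + 1, reg := Function.update c.reg r (c.reg s) }
  | .succ r s => { c with pc := c.pc + 1, reg := Function.update c.reg r (c.reg s + 1) }
  | .load r f a =>
      { c with pc := c.pc + 1, reg := Function.update c.reg r (c.field f (c.reg a)) }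
  | .store f a r =>
      { c with
        pc := c.pc + 1
        field := Function.update c.field f (Function.update (c.field f) (c.reg a) (c.reg r)) }
  | .jumpEq r s l => { c with pc := if c.reg r = c.reg s then l else c.pc + 1 }
  | .jumpLt r s l => { c with pc := if c.reg r < c.reg s then l else c.pc + 1 }

/-- One step of the program `P`; nothing happens once the program counter has left `P`. -/
def Program.step (P : Program) (c : Config) : Config :=
  match P[c.pc]? with
  | some i => i.exec c
  | none => c

/-- Started in `c₀`, the program halts after at most `t` steps, in the configuration `c`. -/
def Program.HaltsWithin (P : Program) (c₀ : Config) (t : ℕ) (c : Config) : Prop :=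
  (P.step)^[t] c₀ = c ∧ P.length ≤ c.pc

/-! ### Input and output -/

/-- The code of a letter. -/
def letterCode {n : ℕ} (a : Fin n × Bool) : ℕ := 2 * (a.1 : ℕ) + (if a.2 then 2 else 3)

/-- The input as a string: the letter codes of each word, followed by the end mark `1`. -/
def inputString {n : ℕ} (J : List (Word n)) : List ℕ :=
  J.flatMap fun w => w.map letterCode ++ [1]

/-- The initial configuration: field `0` holds the input string, at the places `0, 1, 2, …`;
everything else is `0`. -/
def initialConfig {n : ℕ} (J : List (Word n)) : Config where
  pc := 0
  reg := fun _ => 0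
  field := fun f a => if f = 0 then (inputString J).getD a 0 else 0

/-- The name of an edge of the bouquet: the place of its letter in the input string. -/
def edgeName {n : ℕ} (J : List (Word n)) (e : BouquetEdge J) : ℕ :=
  (inputString (J.take e.1)).length + e.2

/-- Register `0` holds the length of the list `L` of pairs of edges of the bouquet, and fields
`1` and `2` hold the names of the edges of the `k`-th pair at the place `k`. -/
def StoresFoldings {n : ℕ} (J : List (Word n)) (c : Config)
    (L : List (BouquetEdge J × BouquetEdge J)) : Prop :=
  c.reg 0 = L.length ∧
  ∀ k : Fin L.length,
    c.field 1 k = edgeName J (L.get k).1 ∧ c.field 2 k = edgeName J (L.get k).2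

/-- The graph `Γ` with base vertex `v₀` is stored, with its vertices and its edges numbered
consecutively from `0`: registers `1` and `2` hold the numbers of vertices and of edges,
register `3` the base vertex, and fields `3`, `4`, `5` the initial vertex, the label and the
terminal vertex of each edge. -/
def StoresGraph {n : ℕ} (c : Config) (Γ : LGraph (Fin n)) (v₀ : Γ.V) : Prop :=
  ∃ (numV : Γ.V ≃ Fin (c.reg 1)) (numE : Γ.E ≃ Fin (c.reg 2)),
    c.reg 3 = numV v₀ ∧
    ∀ e : Γ.E,
      c.field 3 (numE e) = numV (Γ.src e) ∧
      c.field 4 (numE e) = Γ.label e ∧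
      c.field 5 (numE e) = numV (Γ.tgt e)

/-- The storage contains the result of the folding process for `J`: a sequence of elementary
foldings from the bouquet to a folded graph, and that folded graph. -/
def StoresFoldingProcess {n : ℕ} (J : List (Word n)) (c : Config) : Prop :=
  ∃ (Γ : LGraph (Fin n)) (π : LGraph.Hom (bouquet J) Γ)
    (L : List (BouquetEdge J × BouquetEdge J)),
    LGraph.FoldingSequence (Γ₀ := bouquet J) π L ∧ Γ.Folded ∧
    StoresFoldings J c L ∧ StoresGraph c Γ (π.onV (bouquetBase J))

/-! ### The iterated logarithm -/

/-- `log* N`: the least `k` such that the `k`-fold iterate of the binary logarithm takes `N` to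
a number `≤ 1`. -/
noncomputable def logStar (N : ℕ) : ℕ :=
  sInf {k : ℕ | (fun x : ℝ => Real.logb 2 x)^[k] (N : ℝ) ≤ 1}

end Stallings

/-!
The vertices of the current graph are the classes of a disjoint-set forest on the vertices of the
bouquet. Each class has a slot for every label and direction. The edges in the slots form a folded
graph; the other edges wait in a queue. An edge taken from the queue is put into its two slots,
unless one of them is occupied: then it is folded with the edge found there. If the folding merges
two classes, the at most `2 * n` edges in the slots of one of them return to the queue. A class
disappears with each merging, so only `O(N)` edges are ever taken from the queue, with a bounded
number of searches for roots each.

Linking by rank and path halving make the total cost of `O(N)` searches `O(N * log* N)`: the ranks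
`r` are divided into `log* N` grades according to the least tower of twos above `r`. A step of a
search either enters a vertex of higher grade, which happens at most `log* N` times, or is paid for
by the growth of the rank of the parent of a vertex, which can be charged until the parent has left
the grade of that vertex.
-/

namespace Stallings

/-! ### A structured language and its compilation -/

/-- The storage of a machine together with a clock that counts the steps made so far. -/
structure Store where
  reg : ℕ → ℕ
  field : ℕ → ℕ → ℕ
  clk : ℕ

namespace Store

/-- The configuration with storage `s` and program counter `pc`. -/
def cfg (s : Store) (pc : ℕ) : Config := ⟨pc, s.reg, s.field⟩

/-- The storage after an instruction that changes nothing but the program counter. -/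
def tick (s : Store) : Store := { s with clk := s.clk + 1 }

/-- The storage after the assignment of `v` to register `r`. -/
def set (s : Store) (r v : ℕ) : Store :=
  { s with reg := Function.update s.reg r v, clk := s.clk + 1 }

/-- The storage after the value of the field `f` at `a` has been changed to `v`. -/
def put (s : Store) (f a v : ℕ) : Store :=
  { s with
    field := Function.update s.field f (Function.update (s.field f) a v)
    clk := s.clk + 1 }

variable (s : Store)

@[simp] theorem reg_tick : s.tick.reg = s.reg := rfl
@[simp] theorem field_tick : s.tick.field = s.field := rfl
@[simp] theorem clk_tick : s.tick.clk = s.clk + 1 := rfl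
@[simp] theorem field_set (r v : ℕ) : (s.set r v).field = s.field := rfl
@[simp] theorem clk_set (r v : ℕ) : (s.set r v).clk = s.clk + 1 := rfl
@[simp] theorem reg_put (f a v : ℕ) : (s.put f a v).reg = s.reg := rfl
@[simp] theorem clk_put (f a v : ℕ) : (s.put f a v).clk = s.clk + 1 := rfl

@[simp] theorem reg_set (r v q : ℕ) : (s.set r v).reg q = if q = r then v else s.reg q := by
  simp [set, Function.update_apply]

@[simp] theorem field_put_self (f a v : ℕ) :
    (s.put f a v).field f = Function.update (s.field f) a v := by
  simp [put]

@[simp] theorem field_put_of_ne {f g : ℕ} (a v : ℕ) (h : g ≠ f) :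
    (s.put f a v).field g = s.field g := by
  simp [put, Function.update_of_ne h]

theorem field_put_apply (f a v g b : ℕ) :
    (s.put f a v).field g b = if g = f ∧ b = a then v else s.field g b := by
  rcases eq_or_ne g f with rfl | h <;> simp [Function.update_apply, *]

end Store

/-- Conditions under which a program can branch. -/
inductive Test where
  | eq (r q : ℕ)
  | lt (r q : ℕ)

namespace Test

/-- The truth of a condition in a storage. -/
@[simp] def Holds : Test → Store → Prop
  | eq r q, s => s.reg r = s.reg q
  | lt r q, s => s.reg r < s.reg q

/-- The instruction that goes to line `l` if the condition holds. -/
def jump : Test → ℕ → Instr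
  | eq r q, l => .jumpEq r q l
  | lt r q, l => .jumpLt r q l

theorem exec_jump_of_holds {t : Test} {s : Store} (h : t.Holds s) (o l : ℕ) :
    (t.jump l).exec (s.cfg o) = s.tick.cfg l := by
  cases t <;> simp_all [jump, Instr.exec, Store.cfg]

theorem exec_jump_of_not_holds {t : Test} {s : Store} (h : ¬ t.Holds s) (o l : ℕ) :
    (t.jump l).exec (s.cfg o) = s.tick.cfg (o + 1) := by
  cases t <;> simp_all [jump, Instr.exec, Store.cfg, not_lt_of_ge]

end Test

/-- Structured commands, in terms of which the folding program is written. -/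
inductive Cmd where
  | skip
  | const (r k : ℕ)
  | copy (r q : ℕ)
  | succ (r q : ℕ)
  | load (r f a : ℕ)
  | store (f a r : ℕ)
  | seq (c d : Cmd)
  | ite (t : Test) (c d : Cmd)
  | loopUntil (t : Test) (c : Cmd)

infixr:60 ";;" => Cmd.seq

namespace Cmd

/-- Big-step semantics: started in the storage `s`, the command halts in the storage `s'`. The
clock counts the instructions of the compiled command, hence the ticks for the jumps at the end of
an alternative and of the body of a loop. -/
inductive Runs : Cmd → Store → Store → Prop
  | skip {s} : Runs skip s s
  | const {r k s} : Runs (const r k) s (s.set r k)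
  | copy {r q s} : Runs (copy r q) s (s.set r (s.reg q))
  | succ {r q s} : Runs (succ r q) s (s.set r (s.reg q + 1))
  | load {r f a s} : Runs (load r f a) s (s.set r (s.field f (s.reg a)))
  | store {f a r s} : Runs (store f a r) s (s.put f (s.reg a) (s.reg r))
  | seq {c d s s₁ s₂} (hc : Runs c s s₁) (hd : Runs d s₁ s₂) : Runs (c ;; d) s s₂
  | ite_pos {t c d s s₁} (ht : t.Holds s) (hc : Runs c s.tick s₁) : Runs (ite t c d) s s₁
  | ite_neg {t c d s s₁} (ht : ¬ t.Holds s) (hd : Runs d s.tick s₁) : Runs (ite t c d) s s₁.tick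
  | loopUntil_done {t c s} (ht : t.Holds s) : Runs (loopUntil t c) s s.tick
  | loopUntil_step {t c s s₁ s₂} (ht : ¬ t.Holds s) (hc : Runs c s.tick s₁)
      (hl : Runs (loopUntil t c) s₁.tick s₂) : Runs (loopUntil t c) s s₂

/-! #### Compilation -/

/-- The number of instructions of the compiled command. -/
def size : Cmd → ℕ
  | skip => 0
  | const _ _ => 1
  | copy _ _ => 1
  | succ _ _ => 1
  | load _ _ _ => 1
  | store _ _ _ => 1
  | seq c d => c.size + d.size
  | ite _ c d => c.size + d.size + 2
  | loopUntil _ c => c.size + 2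

/-- The compiled command, to be placed at line `o` of a program; `jumpEq 0 0` serves as the
unconditional jump. -/
def code : Cmd → ℕ → List Instr
  | skip, _ => []
  | const r k, _ => [.const r k]
  | copy r q, _ => [.copy r q]
  | succ r q, _ => [.succ r q]
  | load r f a, _ => [.load r f a]
  | store f a r, _ => [.store f a r]
  | seq c d, o => c.code o ++ d.code (o + c.size)
  | ite t c d, o =>
      t.jump (o + 1 + d.size + 1) ::
        (d.code (o + 1) ++
          .jumpEq 0 0 (o + (c.size + d.size + 2)) :: c.code (o + 1 + d.size + 1))
  | loopUntil t c, o => t.jump (o + (c.size + 2)) :: (c.code (o + 1) ++ [.jumpEq 0 0 o])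

theorem length_code (c : Cmd) (o : ℕ) : (c.code o).length = c.size := by
  induction c generalizing o <;> grind [code, size]

end Cmd

namespace Program

/-- The list `l` of instructions stands in `P` from line `o` on. -/
def At (P : Program) (o : ℕ) (l : List Instr) : Prop :=
  ∃ p q, P = p ++ (l ++ q) ∧ p.length = o

namespace At

variable {P : Program} {o : ℕ} {i : Instr} {l m : List Instr}

theorem left (h : P.At o (l ++ m)) : P.At o l := by
  obtain ⟨p, q, rfl, rfl⟩ := h
  exact ⟨p, m ++ q, by simp, rfl⟩

theorem right (h : P.At o (l ++ m)) : P.At (o + l.length) m := by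
  obtain ⟨p, q, rfl, rfl⟩ := h
  exact ⟨p ++ l, q, by simp, by simp⟩

theorem tail (h : P.At o (i :: l)) : P.At (o + 1) l := by
  obtain ⟨p, q, rfl, rfl⟩ := h
  exact ⟨p ++ [i], q, by simp, by simp⟩

theorem step_eq {c : Config} (h : P.At c.pc (i :: l)) : P.step c = i.exec c := by
  obtain ⟨p, q, rfl, hp⟩ := h
  simp [Program.step, ← hp]

end At

/-- The program leads from line `o` with the storage `s` to line `o'` with the storage `s'`, in
the time shown by the clocks. -/
def Reaches (P : Program) (o : ℕ) (s : Store) (o' : ℕ) (s' : Store) : Prop :=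
  ∃ k, s'.clk = s.clk + k ∧ P.step^[k] (s.cfg o) = s'.cfg o'

namespace Reaches

variable {P : Program} {o o' o'' : ℕ} {s s' s'' : Store} {l : List Instr}

theorem refl (P : Program) (o : ℕ) (s : Store) : P.Reaches o s o s := ⟨0, rfl, rfl⟩

theorem trans (h : P.Reaches o s o' s') (h' : P.Reaches o' s' o'' s'') :
    P.Reaches o s o'' s'' := by
  obtain ⟨k, hk, e⟩ := h
  obtain ⟨k', hk', e'⟩ := h'
  exact ⟨k' + k, by omega, by rw [Function.iterate_add_apply, e, e']⟩

theorem of_exec {i : Instr} (h : P.At o (i :: l)) (hclk : s'.clk = s.clk + 1)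
    (hi : i.exec (s.cfg o) = s'.cfg o') : P.Reaches o s o' s' :=
  ⟨1, hclk, (At.step_eq (c := s.cfg o) h).trans hi⟩

theorem jump_pos {t : Test} (h : P.At o (t.jump o' :: l)) (ht : t.Holds s) :
    P.Reaches o s o' s.tick :=
  of_exec h rfl (Test.exec_jump_of_holds ht o o')

theorem jump_neg {t : Test} (h : P.At o (t.jump o' :: l)) (ht : ¬ t.Holds s) :
    P.Reaches o s (o + 1) s.tick :=
  of_exec h rfl (Test.exec_jump_of_not_holds ht o o')

theorem goto (h : P.At o (.jumpEq 0 0 o' :: l)) : P.Reaches o s o' s.tick :=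
  jump_pos (t := .eq 0 0) h rfl

end Reaches

end Program

namespace Cmd

variable {c d : Cmd} {s s' : Store}

open Program in
theorem Runs.reaches (h : Runs c s s') {P : Program} {o : ℕ} (hP : P.At o (c.code o)) :
    P.Reaches o s (o + c.size) s' := by
  induction h generalizing o with
  | skip => exact .refl P o _
  | @seq c d _ _ _ _ _ ihc ihd =>
    have hd := hP.right
    rw [length_code] at hd
    exact add_assoc o c.size d.size ▸ (ihc hP.left).trans (ihd hd)
  | @ite_pos t c d _ _ ht _ ihc =>
    have hc := hP.tail.right.tail
    rw [length_code] at hc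
    convert (Reaches.jump_pos hP ht).trans (ihc hc) using 1
    simp only [size]
    omega
  | @ite_neg t c d _ _ ht _ ihd =>
    have hend := hP.tail.right
    rw [length_code] at hend
    exact ((Reaches.jump_neg hP ht).trans (ihd hP.tail.left)).trans (.goto hend)
  | loopUntil_done ht => exact .jump_pos hP ht
  | @loopUntil_step t c _ _ _ ht _ _ ihc ihl =>
    have hend := hP.tail.right
    rw [length_code] at hend
    exact (((Reaches.jump_neg hP ht).trans (ihc hP.tail.left)).trans (.goto hend)).trans (ihl hP)
  | _ => exact .of_exec hP rfl rfl

theorem Runs.haltsWithin {c₀ : Config} (h₀ : c₀.pc = 0) (h : Runs c ⟨c₀.reg, c₀.field, 0⟩ s) :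
    Program.HaltsWithin (c.code 0) c₀ s.clk (s.cfg c.size) := by
  obtain ⟨k, hk, e⟩ := h.reaches (P := c.code 0) (o := 0) ⟨[], [], by simp, rfl⟩
  obtain ⟨pc, r, f⟩ := c₀
  obtain rfl : pc = 0 := h₀
  rw [zero_add] at hk e
  exact ⟨hk ▸ e, (length_code c 0).le⟩

/-! #### Verification conditions -/

/-- The registers that occur as targets of assignments. -/
@[simp] def WritesReg : Cmd → ℕ → Prop
  | const r _, q => q = r
  | copy r _, q => q = r
  | succ r _, q => q = r
  | load r _ _, q => q = r
  | seq c d, q => c.WritesReg q ∨ d.WritesReg q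
  | ite _ c d, q => c.WritesReg q ∨ d.WritesReg q
  | loopUntil _ c, q => c.WritesReg q
  | _, _ => False

/-- The fields that occur as targets of assignments. -/
@[simp] def WritesField : Cmd → ℕ → Prop
  | store f _ _, g => g = f
  | seq c d, g => c.WritesField g ∨ d.WritesField g
  | ite _ c d, g => c.WritesField g ∨ d.WritesField g
  | loopUntil _ c, g => c.WritesField g
  | _, _ => False

/-- What every run of the command from `s` to `s'` leaves unchanged, for syntactic reasons. -/
structure Frame (c : Cmd) (s s' : Store) : Prop where
  reg : ∀ q, ¬ c.WritesReg q → s'.reg q = s.reg q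
  field : ∀ f, ¬ c.WritesField f → s'.field f = s.field f
  clk_le : s.clk ≤ s'.clk

theorem Runs.frame (h : Runs c s s') : c.Frame s s' := by
  constructor
  · intro q hq
    induction h <;> simp_all
  · intro f hf
    induction h <;> simp_all
  · induction h <;> grind [Store.clk_tick, Store.clk_set, Store.clk_put]

/-- Started in `s`, the command halts in a storage with property `Q`. -/
def wp (c : Cmd) (Q : Store → Prop) (s : Store) : Prop :=
  ∃ s', Runs c s s' ∧ Q s'

variable {Q R : Store → Prop} {r q k f a : ℕ} {t : Test}

theorem wp.call (h : c.wp Q s) (hQ : ∀ s', Q s' → c.Frame s s' → R s') : c.wp R s :=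
  let ⟨s', hs, hs'⟩ := h
  ⟨s', hs, hQ s' hs' hs.frame⟩

theorem wp.mono (h : c.wp Q s) (hQ : ∀ s', Q s' → R s') : c.wp R s :=
  h.call fun s' hs' _ => hQ s' hs'

@[simp] theorem wp_skip : skip.wp Q s ↔ Q s :=
  ⟨fun ⟨_, .skip, h⟩ => h, fun h => ⟨_, .skip, h⟩⟩

@[simp] theorem wp_const : (const r k).wp Q s ↔ Q (s.set r k) :=
  ⟨fun ⟨_, .const, h⟩ => h, fun h => ⟨_, .const, h⟩⟩

@[simp] theorem wp_copy : (copy r q).wp Q s ↔ Q (s.set r (s.reg q)) :=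
  ⟨fun ⟨_, .copy, h⟩ => h, fun h => ⟨_, .copy, h⟩⟩

@[simp] theorem wp_succ : (succ r q).wp Q s ↔ Q (s.set r (s.reg q + 1)) :=
  ⟨fun ⟨_, .succ, h⟩ => h, fun h => ⟨_, .succ, h⟩⟩

@[simp] theorem wp_load : (load r f a).wp Q s ↔ Q (s.set r (s.field f (s.reg a))) :=
  ⟨fun ⟨_, .load, h⟩ => h, fun h => ⟨_, .load, h⟩⟩

@[simp] theorem wp_store : (store f a r).wp Q s ↔ Q (s.put f (s.reg a) (s.reg r)) :=
  ⟨fun ⟨_, .store, h⟩ => h, fun h => ⟨_, .store, h⟩⟩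

@[simp] theorem wp_seq : (c ;; d).wp Q s ↔ c.wp (d.wp Q) s :=
  ⟨fun ⟨_, .seq hc hd, hQ⟩ => ⟨_, hc, _, hd, hQ⟩, fun ⟨_, hc, _, hd, hQ⟩ => ⟨_, .seq hc hd, hQ⟩⟩

@[simp] theorem wp_ite : (ite t c d).wp Q s ↔
    (t.Holds s → c.wp Q s.tick) ∧ (¬ t.Holds s → d.wp (fun s' => Q s'.tick) s.tick) := by
  constructor
  · rintro ⟨_, h, hQ⟩
    cases h with
    | ite_pos ht hc => exact ⟨fun _ => ⟨_, hc, hQ⟩, fun h => absurd ht h⟩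
    | ite_neg ht hd => exact ⟨fun h => absurd h ht, fun _ => ⟨_, hd, hQ⟩⟩
  · rintro ⟨hc, hd⟩
    by_cases ht : t.Holds s
    · exact let ⟨_, h, hQ⟩ := hc ht; ⟨_, .ite_pos ht h, hQ⟩
    · exact let ⟨_, h, hQ⟩ := hd ht; ⟨_, .ite_neg ht h, hQ⟩

/-- A bound for the clock takes the place of a variant: every passage through the loop takes
time. -/
theorem wp_loopUntil (I : Store → Prop) (B : ℕ) (hs : I s) (hB : ∀ s', I s' → s'.clk ≤ B)
    (hQ : ∀ s', I s' → t.Holds s' → Q s'.tick)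
    (hI : ∀ s', I s' → ¬ t.Holds s' → c.wp (fun s'' => I s''.tick) s'.tick) :
    (loopUntil t c).wp Q s := by
  induction hm : B - s.clk using Nat.strong_induction_on generalizing s with
  | _ m ih =>
  by_cases ht : t.Holds s
  · exact ⟨_, .loopUntil_done ht, hQ s hs ht⟩
  · obtain ⟨s₁, hc, hs₁⟩ := hI s hs ht
    have hclk := hc.frame.clk_le
    have hB₁ := hB _ hs₁
    simp only [Store.clk_tick] at hclk hB₁
    obtain ⟨s₂, hl, hs₂⟩ := ih _ (by simp only [Store.clk_tick]; omega) hs₁ rfl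
    exact ⟨s₂, .loopUntil_step ht hc hl, hs₂⟩

end Cmd

/-! ### Towers and the iterated logarithm -/

/-- Iterated powers of two, the inverse of the iterated logarithm. -/
def tower : ℕ → ℕ
  | 0 => 1
  | k + 1 => 2 ^ tower k

theorem lt_tower (k : ℕ) : k < tower k := by
  induction k with
  | zero => exact zero_lt_one
  | succ k ih => exact lt_of_le_of_lt ih Nat.lt_two_pow_self

theorem tower_mono : Monotone tower :=
  monotone_nat_of_le_succ fun _ => Nat.lt_two_pow_self.le

theorem exists_le_tower (r : ℕ) : ∃ k, r ≤ tower k := ⟨r, (lt_tower r).le⟩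

/-- The least `k` with `r ≤ tower k`; it partitions the ranks into levels for the amortized analysis
of disjoint sets. -/
def grade (r : ℕ) : ℕ := Nat.find (exists_le_tower r)

theorem le_tower_grade (r : ℕ) : r ≤ tower (grade r) := Nat.find_spec (exists_le_tower r)

theorem grade_le_iff {r k : ℕ} : grade r ≤ k ↔ r ≤ tower k :=
  ⟨fun h => (le_tower_grade r).trans (tower_mono h), fun h => Nat.find_min' (exists_le_tower r) h⟩

theorem lt_grade_iff {r k : ℕ} : k < grade r ↔ tower k < r := by
  simpa only [not_le] using grade_le_iff.not

theorem grade_mono : Monotone grade := fun _ r h => grade_le_iff.2 (h.trans (le_tower_grade r))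

theorem grade_zero : grade 0 = 0 := Nat.le_zero.1 (grade_le_iff.2 (Nat.zero_le _))

theorem grade_succ_eq_or (r : ℕ) :
    grade (r + 1) = grade r ∨ grade (r + 1) = grade r + 1 ∧ tower (grade r + 1) = 2 ^ r := by
  rcases (le_tower_grade r).lt_or_eq with h | h
  · exact .inl (le_antisymm (grade_le_iff.2 h) (grade_mono r.le_succ))
  · have hpow : tower (grade r + 1) = 2 ^ r := by rw [tower, ← h]
    refine .inr ⟨le_antisymm (grade_le_iff.2 ?_) (lt_grade_iff.2 (by omega)), hpow⟩
    exact hpow ▸ Nat.lt_two_pow_self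

theorem logb_two_le_tower_iff {x : ℝ} (hx : 0 < x) {k : ℕ} :
    Real.logb 2 x ≤ tower k ↔ x ≤ tower (k + 1) := by
  rw [Real.logb_le_iff_le_rpow one_lt_two hx, Real.rpow_natCast, tower, Nat.cast_pow,
    Nat.cast_ofNat]

theorem exists_iterate_logb_le_one {x : ℝ} {k : ℕ} (h : x ≤ tower k) :
    ∃ j, (fun x : ℝ => Real.logb 2 x)^[j] x ≤ 1 := by
  induction k generalizing x with
  | zero => exact ⟨0, by simpa [tower] using h⟩
  | succ k ih =>
    rcases le_or_gt x 1 with hx | hx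
    · exact ⟨0, hx⟩
    · obtain ⟨j, hj⟩ := ih ((logb_two_le_tower_iff (one_pos.trans hx)).2 h)
      exact ⟨j + 1, hj⟩

theorem le_tower_of_iterate_logb_le_one {x : ℝ} {k : ℕ}
    (h : (fun x : ℝ => Real.logb 2 x)^[k] x ≤ 1)
    (hk : ∀ j < k, ¬ (fun x : ℝ => Real.logb 2 x)^[j] x ≤ 1) : x ≤ tower k := by
  induction k generalizing x with
  | zero => simpa [tower] using h
  | succ k ih =>
    have hx : 1 < x := not_le.1 (hk 0 k.succ_pos)
    exact (logb_two_le_tower_iff (one_pos.trans hx)).1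
      (ih h fun j hj => hk (j + 1) (Nat.succ_lt_succ hj))

theorem le_tower_logStar (N : ℕ) : N ≤ tower (logStar N) := by
  have hne : {k : ℕ | (fun x : ℝ => Real.logb 2 x)^[k] (N : ℝ) ≤ 1}.Nonempty :=
    exists_iterate_logb_le_one (mod_cast (lt_tower N).le)
  exact_mod_cast le_tower_of_iterate_logb_le_one (x := N) (Nat.sInf_mem hne)
    fun j hj => Nat.notMem_of_lt_sInf hj

theorem logStar_pos {N : ℕ} (h : 2 ≤ N) : 0 < logStar N := by
  by_contra h₀
  have hN := le_tower_logStar N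
  rw [Nat.eq_zero_of_not_pos h₀, tower] at hN
  omega

/-! ### Disjoint sets with linking by rank and path halving -/

section DisjointSets

variable {α : Type*} [DecidableEq α]

/-- The pointers `par` form a forest on `V` in which `root x` is the root of the tree of `x`, and
`rank` is a rank function on it. Each tree has more elements than the rank of its root; of this
only the sum over all roots is recorded. -/
structure Forest (V : Finset α) (root par : α → α) (rank : α → ℕ) : Prop where
  par_mem : ∀ x ∈ V, par x ∈ V
  root_mem : ∀ x ∈ V, root x ∈ V
  root_par : ∀ x ∈ V, root (par x) = root x
  par_root : ∀ x ∈ V, par (root x) = root x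
  root_eq_self : ∀ x ∈ V, par x = x → root x = x
  rank_lt : ∀ x ∈ V, par x ≠ x → rank x < rank (par x)
  rank_le : ∀ x ∈ V, rank x ≤ V.card
  sum_rank_le : ∑ x ∈ V, (if par x = x then rank x + 1 else 0) ≤ V.card

/-- The contribution of a root of rank `r` to the potential. The term `(G - grade r) * 2 ^ r` pays
for the growth of `tower (grade r)` at later increments of the rank. -/
def rootPotential (G W r : ℕ) : ℕ := W + ((G - grade r) * 2 ^ r + tower (grade r))

/-- The potential of a forest: `G` bounds the grades of the ranks, `W` is an additional weight of
each root, and a vertex `x` that is not a root can be charged until its parent has left the grade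
of `x`. -/
def potential (G W : ℕ) (V : Finset α) (par : α → α) (rank : α → ℕ) : ℕ :=
  ∑ x ∈ V, if par x = x then rootPotential G W (rank x)
    else tower (grade (rank x)) - rank (par x)

/-- The ranks after the root `l` has been linked to the root `r`. -/
def linkRank (rank : α → ℕ) (l r : α) : α → ℕ :=
  if rank l = rank r then Function.update rank r (rank r + 1) else rank

theorem rootPotential_succ_add_le {G W r : ℕ} (h : grade (r + 1) ≤ G) :
    rootPotential G W (r + 1) + (tower (grade r) - (r + 1)) + W ≤ 2 * rootPotential G W r := by
  unfold rootPotential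
  rcases grade_succ_eq_or r with e | ⟨e, htower⟩
  · rw [e, pow_succ]
    have : (G - grade r) * (2 ^ r * 2) = 2 * ((G - grade r) * 2 ^ r) := by ring
    omega
  · obtain ⟨d, rfl⟩ := Nat.exists_eq_add_of_le (e ▸ h)
    have e₁ : grade r + 1 + d - (grade r + 1) = d := by omega
    have e₂ : grade r + 1 + d - grade r = d + 1 := by omega
    rw [e, e₁, e₂, htower, pow_succ]
    have : d * (2 ^ r * 2) + 2 * 2 ^ r = 2 * ((d + 1) * 2 ^ r) := by ring
    omega

theorem linkRank_of_ne {rank : α → ℕ} {l r x : α} (hx : x ≠ r) :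
    linkRank rank l r x = rank x := by
  unfold linkRank
  split_ifs <;> simp [hx]

theorem le_linkRank (rank : α → ℕ) (l r x : α) : rank x ≤ linkRank rank l r x := by
  unfold linkRank
  split_ifs <;> grind [Function.update_apply]

theorem lt_linkRank {rank : α → ℕ} {l r : α} (h : rank l ≤ rank r) :
    rank l < linkRank rank l r r := by
  unfold linkRank
  split_ifs <;> grind [Function.update_apply]

theorem linkRank_right_le {rank : α → ℕ} {l r : α} :
    linkRank rank l r r ≤ rank l + rank r + 1 := by
  unfold linkRank
  split_ifs <;> grind [Function.update_apply]

theorem rootPotential_linkRank_le {G W : ℕ} {rank : α → ℕ} {l r : α}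
    (hG : linkRank rank l r r ≤ tower G) :
    (tower (grade (rank l)) - linkRank rank l r r) + rootPotential G W (linkRank rank l r r) + W ≤
      rootPotential G W (rank l) + rootPotential G W (rank r) := by
  by_cases e : rank l = rank r
  · have e' : linkRank rank l r r = rank r + 1 := by simp [linkRank, e]
    rw [e'] at hG
    have := rootPotential_succ_add_le (W := W) (grade_le_iff.2 hG)
    rw [e', e]
    omega
  · have e' : linkRank rank l r r = rank r := by simp [linkRank, e]
    rw [e', rootPotential, rootPotential]
    omega

theorem sum_eq_add_add_sum_erase {M : Type*} [AddCommMonoid M] {V : Finset α} {l r : α}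
    (hl : l ∈ V) (hr : r ∈ V) (hlr : l ≠ r) (f : α → M) :
    ∑ x ∈ V, f x = f l + (f r + ∑ x ∈ (V.erase l).erase r, f x) := by
  rw [← Finset.add_sum_erase V f hl,
    ← Finset.add_sum_erase _ f (Finset.mem_erase.2 ⟨hlr.symm, hr⟩)]

namespace Forest

variable {V : Finset α} {root par : α → α} {rank : α → ℕ} {G W : ℕ} {x l r : α}

theorem root_root (h : Forest V root par rank) (hx : x ∈ V) : root (root x) = root x :=
  h.root_eq_self _ (h.root_mem x hx) (h.par_root x hx)

theorem grade_rank_le (h : Forest V root par rank) (hG : V.card ≤ tower G) (hx : x ∈ V) :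
    grade (rank x) ≤ G :=
  grade_le_iff.2 ((h.rank_le x hx).trans hG)

theorem rank_lt_rank_par_par (h : Forest V root par rank) (hx : x ∈ V) (hp : par x ≠ x) :
    rank x < rank (par (par x)) := by
  have hlt := h.rank_lt x hx hp
  by_cases hq : par (par x) = par x
  · rwa [hq]
  · exact hlt.trans (h.rank_lt _ (h.par_mem x hx) hq)

theorem par_par_ne (h : Forest V root par rank) (hx : x ∈ V) (hp : par x ≠ x) :
    par (par x) ≠ x := fun e =>
  (h.rank_lt_rank_par_par hx hp).ne (by rw [e])

theorem halve (h : Forest V root par rank) (hx : x ∈ V) (hp : par x ≠ x) :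
    Forest V root (Function.update par x (par (par x))) rank := by
  have hlt := h.rank_lt_rank_par_par hx hp
  have hroot : ∀ y, Function.update par x (par (par x)) y = y ↔ par y = y := by
    grind [Function.update_apply, h.par_par_ne hx hp]
  have hpp := h.par_mem _ (h.par_mem x hx)
  have hrpp : root (par (par x)) = root x := by
    rw [h.root_par _ (h.par_mem x hx), h.root_par x hx]
  constructor
  · grind [Function.update_apply, h.par_mem]
  · exact h.root_mem
  · grind [Function.update_apply, h.root_par]
  · simpa only [hroot] using h.par_root
  · simpa only [hroot] using h.root_eq_self
  · intro y hy hy'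
    rw [ne_eq, hroot] at hy'
    rcases eq_or_ne y x with rfl | hyx
    · rwa [Function.update_self]
    · rw [Function.update_of_ne hyx]
      exact h.rank_lt y hy hy'
  · exact h.rank_le
  · simpa only [hroot] using h.sum_rank_le

/-- One step of path halving either decreases the potential of `x` or takes the search to a
vertex of a higher grade. -/
theorem potential_halve_lt (h : Forest V root par rank) (hG : V.card ≤ tower G) (hx : x ∈ V)
    (hp : par x ≠ x) (hq : par (par x) ≠ par x) :
    potential G W V (Function.update par x (par (par x))) rank + (G - grade (rank (par (par x)))) <
      potential G W V par rank + (G - grade (rank x)) := by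
  have hrank := h.rank_lt_rank_par_par hx hp
  have hrank' := h.rank_lt _ (h.par_mem x hx) hq
  have hgrade := h.grade_rank_le hG (h.par_mem _ (h.par_mem x hx))
  have hmono : grade (rank x) ≤ grade (rank (par (par x))) := grade_mono hrank.le
  have hother : ∀ y ∈ V.erase x, (if Function.update par x (par (par x)) y = y
      then rootPotential G W (rank y)
      else tower (grade (rank y)) - rank (Function.update par x (par (par x)) y)) =
      if par y = y then rootPotential G W (rank y) else tower (grade (rank y)) - rank (par y) :=
    fun y hy => by rw [Function.update_of_ne (Finset.ne_of_mem_erase hy)]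
  unfold potential
  rw [← Finset.add_sum_erase V _ hx, Finset.sum_congr rfl hother,
    ← Finset.add_sum_erase V (fun y => if par y = y then _ else _) hx]
  simp only [Function.update_self, h.par_par_ne hx hp, hp, if_false]
  rcases lt_or_ge (rank (par x)) (tower (grade (rank x))) with hT | hT
  · omega
  · have : grade (rank x) < grade (rank (par (par x))) := lt_grade_iff.2 (hT.trans_lt hrank')
    omega

section Link

variable (h : Forest V root par rank) (hl : l ∈ V) (hr : r ∈ V) (hlr : l ≠ r) (hpl : par l = l)
  (hpr : par r = r)

include h hl hr hlr hpl hpr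

theorem linkRank_right_le_card : linkRank rank l r r ≤ V.card := by
  have hsum := h.sum_rank_le
  rw [sum_eq_add_add_sum_erase hl hr hlr, if_pos hpl, if_pos hpr] at hsum
  have := linkRank_right_le (rank := rank) (l := l) (r := r)
  omega

theorem sum_linkRank_le :
    ∑ x ∈ V, (if Function.update par l r x = x then linkRank rank l r x + 1 else 0) ≤ V.card := by
  refine le_trans ?_ h.sum_rank_le
  have hother : ∀ x ∈ (V.erase l).erase r,
      (if Function.update par l r x = x then linkRank rank l r x + 1 else 0) =
        if par x = x then rank x + 1 else 0 := by
    intro x hx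
    simp only [Finset.mem_erase] at hx
    rw [Function.update_of_ne hx.2.1, linkRank_of_ne hx.1]
  rw [sum_eq_add_add_sum_erase hl hr hlr, sum_eq_add_add_sum_erase hl hr hlr,
    Finset.sum_congr rfl hother]
  simp only [Function.update_self, Function.update_of_ne hlr.symm, hpl, hpr, hlr.symm, if_true,
    if_false]
  have := linkRank_right_le (rank := rank) (l := l) (r := r)
  omega

theorem link (hle : rank l ≤ rank r) :
    Forest V (fun x => if root x = l then r else root x) (Function.update par l r)
      (linkRank rank l r) := by
  have hrl := h.root_eq_self l hl hpl
  have hrr := h.root_eq_self r hr hpr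
  have hcard := h.linkRank_right_le_card hl hr hlr hpl hpr
  constructor
  · grind [Function.update_apply, h.par_mem]
  · grind [h.root_mem]
  · grind [Function.update_apply, h.root_par]
  · grind [Function.update_apply, h.par_root]
  · grind [Function.update_apply, h.root_eq_self]
  · intro x hx hp
    rcases eq_or_ne x l with rfl | hxl
    · rw [Function.update_self, linkRank_of_ne hlr]
      exact lt_linkRank hle
    · rw [Function.update_of_ne hxl] at hp ⊢
      have hxr : x ≠ r := fun e => hp (e ▸ hpr)
      rw [linkRank_of_ne hxr]
      exact (h.rank_lt x hx hp).trans_le (le_linkRank _ _ _ _)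
  · intro x hx
    rcases eq_or_ne x r with rfl | hxr
    · exact hcard
    · exact (linkRank_of_ne hxr).trans_le (h.rank_le x hx)
  · exact h.sum_linkRank_le hl hr hlr hpl hpr

theorem potential_link_add_le (hG : V.card ≤ tower G) :
    potential G W V (Function.update par l r) (linkRank rank l r) + W ≤
      potential G W V par rank := by
  have hother : ∀ x ∈ (V.erase l).erase r,
      (if Function.update par l r x = x then rootPotential G W (linkRank rank l r x)
        else tower (grade (linkRank rank l r x)) -
          linkRank rank l r (Function.update par l r x)) ≤
      if par x = x then rootPotential G W (rank x) else tower (grade (rank x)) - rank (par x) := by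
    intro x hx
    simp only [Finset.mem_erase] at hx
    rw [Function.update_of_ne hx.2.1, linkRank_of_ne hx.1]
    split_ifs
    · exact le_rfl
    · exact Nat.sub_le_sub_left (le_linkRank _ _ _ _) _
  have hroots := rootPotential_linkRank_le (W := W)
    ((h.linkRank_right_le_card hl hr hlr hpl hpr).trans hG)
  have hsum := Finset.sum_le_sum hother
  unfold potential
  rw [sum_eq_add_add_sum_erase hl hr hlr, sum_eq_add_add_sum_erase hl hr hlr]
  simp only [Function.update_self, Function.update_of_ne hlr.symm, hpl, hpr, hlr.symm, if_true,
    if_false, linkRank_of_ne hlr]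
  omega

end Link

theorem of_par_eq_self (hp : ∀ x ∈ V, par x = x) (hr : ∀ x ∈ V, rank x = 0) :
    Forest V id par rank where
  par_mem x hx := by rwa [hp x hx]
  root_mem _ hx := hx
  root_par x hx := hp x hx
  par_root x hx := hp x hx
  root_eq_self _ _ _ := rfl
  rank_lt x hx h := absurd (hp x hx) h
  rank_le x hx := (hr x hx).trans_le (Nat.zero_le _)
  sum_rank_le := by
    rw [Finset.card_eq_sum_ones]
    exact Finset.sum_le_sum fun x hx => by rw [if_pos (hp x hx), hr x hx]

end Forest

theorem potential_of_par_eq_self (G W : ℕ) {V : Finset α} {par : α → α} {rank : α → ℕ}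
    (hp : ∀ x ∈ V, par x = x) (hr : ∀ x ∈ V, rank x = 0) :
    potential G W V par rank = V.card * (W + G + 1) := by
  refine Finset.sum_const_nat fun x hx => ?_
  rw [if_pos (hp x hx), hr x hx, rootPotential, grade_zero, pow_zero, tower]
  omega

end DisjointSets

/-! ### Foldings -/

/-- The classes of equal value of `f'` arise from those of `f` by uniting the class of `a` with
the class of `b`. -/
def Merges {α β : Type*} (f f' : α → β) (a b : α) : Prop :=
  ∀ u w, f' u = f' w ↔ f u = f w ∨ (f u = f a ∧ f w = f b) ∨ (f u = f b ∧ f w = f a)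

namespace Merges

variable {α β γ : Type*} {f f' f'' : α → β} {a b c d : α}

theorem symm (h : Merges f f' a b) : Merges f f' b a := fun u w => by
  rw [h u w, or_comm (a := f u = f a ∧ _)]

theorem comp {g : γ → α} {a b : γ} (h : Merges f f' (g a) (g b)) :
    Merges (f ∘ g) (f' ∘ g) a b := fun u w => h (g u) (g w)

theorem refl (h : f a = f b) : Merges f f a b := fun u w => by grind

theorem of_eq (h : Merges f f' a b) (hab : f a = f b) (u w : α) : f' u = f' w ↔ f u = f w := by
  grind [h u w]

theorem of_ite [DecidableEq β] (f : α → β) (a b : α) :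
    Merges f (fun x => if f x = f a then f b else f x) a b := fun u w => by grind

theorem trans (h : Merges f f' a b) (h' : Merges f' f'' c d) (he : f a = f b ∨ f c = f d)
    (u w : α) : f'' u = f'' w ↔ f u = f w ∨ (f u = f a ∧ f w = f b) ∨ (f u = f b ∧ f w = f a) ∨
      (f u = f c ∧ f w = f d) ∨ (f u = f d ∧ f w = f c) := by
  rcases he with he | he
  · simp only [h' u w, h.of_eq he]
    grind
  · rw [h'.of_eq ((h c d).2 (.inl he)), h u w]
    grind

end Merges

namespace LGraph

variable {X : Type}

section Fold

variable (Γ : LGraph X) {e₁ e₂ : Γ.E}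

/-- The identifications of vertices made by a folding. They do not form chains, since two of the
four endpoints coincide. -/
def vertexSetoid (hinc : Γ.src e₁ = Γ.src e₂ ∨ Γ.tgt e₁ = Γ.tgt e₂) : Setoid Γ.V where
  r u w := u = w ∨
    (u = Γ.src e₁ ∧ w = Γ.src e₂) ∨ (u = Γ.src e₂ ∧ w = Γ.src e₁) ∨
    (u = Γ.tgt e₁ ∧ w = Γ.tgt e₂) ∨ (u = Γ.tgt e₂ ∧ w = Γ.tgt e₁)
  iseqv := ⟨fun _ => .inl rfl, fun h => by tauto, fun h h' => by grind⟩

variable (e₁ e₂) in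
/-- The identification of two edges. -/
def edgeSetoid : Setoid Γ.E where
  r e e' := e = e' ∨ (e = e₁ ∧ e' = e₂) ∨ (e = e₂ ∧ e' = e₁)
  iseqv := ⟨fun _ => .inl rfl, fun h => by tauto, fun h h' => by grind⟩

variable (hlab : Γ.label e₁ = Γ.label e₂)
  (hinc : Γ.src e₁ = Γ.src e₂ ∨ Γ.tgt e₁ = Γ.tgt e₂)

/-- The graph that arises from `Γ` by an elementary folding. -/
def foldQuotient : LGraph X where
  V := Quotient (Γ.vertexSetoid hinc)
  E := Quotient (Γ.edgeSetoid e₁ e₂)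
  src := Quotient.map Γ.src (by
    rintro _ _ (rfl | ⟨rfl, rfl⟩ | ⟨rfl, rfl⟩)
    exacts [.inl rfl, .inr (.inl ⟨rfl, rfl⟩), .inr (.inr (.inl ⟨rfl, rfl⟩))])
  tgt := Quotient.map Γ.tgt (by
    rintro _ _ (rfl | ⟨rfl, rfl⟩ | ⟨rfl, rfl⟩)
    exacts [.inl rfl, .inr (.inr (.inr (.inl ⟨rfl, rfl⟩))), .inr (.inr (.inr (.inr ⟨rfl, rfl⟩)))])
  label := Quotient.lift Γ.label (by
    rintro _ _ (rfl | ⟨rfl, rfl⟩ | ⟨rfl, rfl⟩)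
    exacts [rfl, hlab, hlab.symm])

/-- The quotient map onto the folded graph. -/
def foldHom : Hom Γ (Γ.foldQuotient hlab hinc) where
  onV := Quotient.mk _
  onE := Quotient.mk _
  src_onE _ := rfl
  tgt_onE _ := rfl
  label_onE _ := rfl

theorem isElementaryFolding_foldHom (hne : e₁ ≠ e₂) :
    IsElementaryFolding (Γ.foldHom hlab hinc) e₁ e₂ where
  ne := hne
  label_eq := hlab
  incidence := hinc
  onV_surjective := Quotient.mk_surjective
  onE_surjective := Quotient.mk_surjective
  onV_eq_iff _ _ := Quotient.eq (r := Γ.vertexSetoid hinc)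
  onE_eq_iff _ _ := Quotient.eq (r := Γ.edgeSetoid e₁ e₂)

end Fold

variable {Γ₀ Γ Δ : LGraph X} {cl cl₁ cl₂ : Γ₀.V → ℕ} {A : Set Γ₀.E} {L : List (Γ₀.E × Γ₀.E)}

/-- The quotient map `π` is encoded by `cl` and `A`: the vertices of `Γ` are the classes of
vertices of `Γ₀` with the same value of `cl`, and each edge of `Γ` is the image of just one edge
in `A`. -/
structure Hom.IsEncodedBy (π : Hom Γ₀ Γ) (cl : Γ₀.V → ℕ) (A : Set Γ₀.E) : Prop where
  onV_surjective : Function.Surjective π.onV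
  onV_eq_iff : ∀ u w, π.onV u = π.onV w ↔ cl u = cl w
  exists_mem : ∀ e, ∃ e' ∈ A, π.onE e' = e
  injOn : Set.InjOn π.onE A

/-- The list `L` describes a sequence of elementary foldings of `Γ₀`, the composition of which is
encoded by `cl` and `A`. -/
def FoldsTo (Γ₀ : LGraph X) (cl : Γ₀.V → ℕ) (A : Set Γ₀.E) (L : List (Γ₀.E × Γ₀.E)) : Prop :=
  ∃ (Γ : LGraph X) (π : Hom Γ₀ Γ), FoldingSequence π L ∧ π.IsEncodedBy cl A

theorem foldsTo_nil (hcl : Function.Injective cl) : FoldsTo Γ₀ cl Set.univ [] :=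
  ⟨Γ₀, Hom.id Γ₀, .nil, fun v => ⟨v, rfl⟩, fun _ _ => hcl.eq_iff.symm, fun e => ⟨e, trivial, rfl⟩,
    fun _ _ _ _ h => h⟩

theorem Hom.IsEncodedBy.comp {π : Hom Γ₀ Γ} {ρ : Hom Γ Δ} {e f : Γ₀.E}
    (hπ : π.IsEncodedBy cl A) (hρ : IsElementaryFolding ρ (π.onE e) (π.onE f)) (he : e ∈ A)
    (hf : f ∈ A) (hinc : cl (Γ₀.src e) = cl (Γ₀.src f) ∨ cl (Γ₀.tgt e) = cl (Γ₀.tgt f))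
    (hsrc : Merges cl cl₁ (Γ₀.src e) (Γ₀.src f)) (htgt : Merges cl₁ cl₂ (Γ₀.tgt e) (Γ₀.tgt f)) :
    (ρ.comp π).IsEncodedBy cl₂ (A \ {e}) where
  onV_surjective := hρ.onV_surjective.comp hπ.onV_surjective
  onV_eq_iff u w := by
    refine (hρ.onV_eq_iff _ _).trans ?_
    simp only [π.src_onE, π.tgt_onE, hπ.onV_eq_iff, hsrc.trans htgt hinc u w]
  exists_mem g := by
    obtain ⟨g, rfl⟩ := hρ.onE_surjective g
    obtain ⟨g, hg, rfl⟩ := hπ.exists_mem g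
    rcases eq_or_ne g e with rfl | hge
    · exact ⟨f, ⟨hf, fun h => hρ.ne (congrArg π.onE h.symm)⟩,
        (hρ.onE_eq_iff _ _).2 (.inr (.inr ⟨rfl, rfl⟩))⟩
    · exact ⟨g, ⟨hg, hge⟩, rfl⟩
  injOn g hg g' hg' h := by
    rcases (hρ.onE_eq_iff _ _).1 h with h | ⟨h, -⟩ | ⟨-, h⟩
    · exact hπ.injOn hg.1 hg'.1 h
    · exact absurd (hπ.injOn hg.1 he h) hg.2
    · exact absurd (hπ.injOn hg'.1 he h) hg'.2

theorem FoldsTo.fold (h : FoldsTo Γ₀ cl A L) {e f : Γ₀.E} (he : e ∈ A) (hf : f ∈ A) (hef : e ≠ f)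
    (hlab : Γ₀.label e = Γ₀.label f)
    (hinc : cl (Γ₀.src e) = cl (Γ₀.src f) ∨ cl (Γ₀.tgt e) = cl (Γ₀.tgt f))
    (hsrc : Merges cl cl₁ (Γ₀.src e) (Γ₀.src f)) (htgt : Merges cl₁ cl₂ (Γ₀.tgt e) (Γ₀.tgt f)) :
    FoldsTo Γ₀ cl₂ (A \ {e}) (L ++ [(e, f)]) := by
  obtain ⟨Γ, π, hL, hπ⟩ := h
  have hlab' : Γ.label (π.onE e) = Γ.label (π.onE f) := by simpa only [π.label_onE] using hlab
  have hinc' : Γ.src (π.onE e) = Γ.src (π.onE f) ∨ Γ.tgt (π.onE e) = Γ.tgt (π.onE f) := by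
    simpa only [π.src_onE, π.tgt_onE, hπ.onV_eq_iff] using hinc
  have hρ := Γ.isElementaryFolding_foldHom hlab' hinc' fun h => hef (hπ.injOn he hf h)
  exact ⟨_, _, .snoc _ e f hL hρ, hπ.comp hρ he hf hinc hsrc htgt⟩

theorem Hom.IsEncodedBy.folded {π : Hom Γ₀ Γ} (hπ : π.IsEncodedBy cl A)
    (h : ∀ e ∈ A, ∀ e' ∈ A, Γ₀.label e = Γ₀.label e' →
      (cl (Γ₀.src e) = cl (Γ₀.src e') ∨ cl (Γ₀.tgt e) = cl (Γ₀.tgt e')) → e = e') :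
    Γ.Folded := by
  intro e e' hlab hinc
  obtain ⟨e, he, rfl⟩ := hπ.exists_mem e
  obtain ⟨e', he', rfl⟩ := hπ.exists_mem e'
  rw [π.label_onE, π.label_onE] at hlab
  simp only [π.src_onE, π.tgt_onE, hπ.onV_eq_iff] at hinc
  rw [h e he e' he' hlab hinc]

end LGraph

theorem exists_equiv_fin {α β : Type*} {p : α → β} {f : α → ℕ} {N : ℕ}
    (hp : Function.Surjective p) (hf : ∀ a b, p a = p b ↔ f a = f b)
    (hN : Set.range f = Set.Iio N) : ∃ φ : β ≃ Fin N, ∀ a, (φ (p a) : ℕ) = f a := by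
  have hlt (a : α) : f a < N := hN.subset ⟨a, rfl⟩
  let g (b : β) : Fin N := ⟨f (Function.surjInv hp b), hlt _⟩
  have hg (a : α) : (g (p a) : ℕ) = f a := (hf _ _).1 (Function.surjInv_eq hp (p a))
  refine ⟨.ofBijective g ⟨fun b b' h => ?_, fun k => ?_⟩, hg⟩
  · simpa only [Function.surjInv_eq] using (hf _ _).2 (Fin.mk.inj_iff.1 h)
  · obtain ⟨a, ha⟩ := hN.superset k.2
    exact ⟨p a, Fin.ext ((hg a).trans ha)⟩

open LGraph in
theorem storesGraph_of_isEncodedBy {n : ℕ} {Γ₀ Γ : LGraph (Fin n)} {π : Hom Γ₀ Γ}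
    {cl : Γ₀.V → ℕ} {A : Set Γ₀.E} {c : Config} {v₀ : Γ₀.V} {num : ℕ → ℕ} {idx : Γ₀.E → ℕ}
    (hπ : π.IsEncodedBy cl A) (hnum : Set.BijOn num (Set.range cl) (Set.Iio (c.reg 1)))
    (hbase : c.reg 3 = num (cl v₀)) (hidx : Set.BijOn idx A (Set.Iio (c.reg 2)))
    (hst : ∀ e ∈ A, c.field 3 (idx e) = num (cl (Γ₀.src e)) ∧ c.field 4 (idx e) = Γ₀.label e ∧
      c.field 5 (idx e) = num (cl (Γ₀.tgt e))) : StoresGraph c Γ (π.onV v₀) := by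
  obtain ⟨numV, hnumV⟩ := exists_equiv_fin (f := num ∘ cl) hπ.onV_surjective
    (fun u w => (hπ.onV_eq_iff u w).trans (hnum.injOn.eq_iff ⟨u, rfl⟩ ⟨w, rfl⟩).symm)
    (by rw [Set.range_comp, hnum.image_eq])
  obtain ⟨numE, hnumE⟩ := exists_equiv_fin (p := fun e : A => π.onE e) (f := fun e : A => idx e)
    (fun e => let ⟨e', h, he⟩ := hπ.exists_mem e; ⟨⟨e', h⟩, he⟩)
    (fun e e' => (hπ.injOn.eq_iff e.2 e'.2).trans (hidx.injOn.eq_iff e.2 e'.2).symm)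
    (by rw [← hidx.image_eq, Set.image_eq_range])
  refine ⟨numV, numE, by rw [hbase, hnumV, Function.comp_apply], fun e => ?_⟩
  obtain ⟨e, he, rfl⟩ := hπ.exists_mem e
  rw [hnumE ⟨e, he⟩, π.src_onE, π.tgt_onE, π.label_onE, hnumV, hnumV]
  exact hst e he

/-! ### The memory layout -/

-- Registers `0` to `3` and fields `0` to `5` hold the output, see `StoresFoldingProcess`.
notation "fPar" => (6 : ℕ)
notation "fRank" => (7 : ℕ)
notation "fSrc" => (8 : ℕ)
notation "fTgt" => (9 : ℕ)
notation "fLab" => (10 : ℕ)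
notation "fName" => (11 : ℕ)
notation "fAlive" => (12 : ℕ)
notation "fQueue" => (13 : ℕ)
notation "fNum" => (14 : ℕ)
notation "fOut" => (20 : ℕ)
notation "fInn" => (21 : ℕ)

notation "rZero" => (4 : ℕ)
notation "rOne" => (5 : ℕ)
notation "rPos" => (6 : ℕ)
notation "rHead" => (7 : ℕ)
notation "rTail" => (8 : ℕ)
notation "rEnd" => (9 : ℕ)
notation "rX" => (10 : ℕ)
notation "rXp" => (11 : ℕ)
notation "rXpp" => (12 : ℕ)
notation "rTmp" => (13 : ℕ)
notation "rCode" => (14 : ℕ)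
notation "rCur" => (15 : ℕ)
notation "rNext" => (16 : ℕ)
notation "rId" => (17 : ℕ)
notation "rAhead" => (18 : ℕ)
notation "rLab" => (19 : ℕ)
notation "rSrc" => (20 : ℕ)
notation "rTgt" => (21 : ℕ)
notation "rE" => (22 : ℕ)
notation "rF" => (25 : ℕ)
notation "rName" => (26 : ℕ)
notation "rA" => (27 : ℕ)
notation "rB" => (28 : ℕ)
notation "rRankA" => (29 : ℕ)
notation "rRankB" => (30 : ℕ)
notation "rSwap" => (31 : ℕ)
notation "rI" => (32 : ℕ)
notation "rN" => (33 : ℕ)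
notation "rG" => (34 : ℕ)

namespace Cmd

variable {n b r x a : ℕ} {s : Store}

/-- Load the value at the register `a` of the field `2 * reg x + b`, where `reg x < n`. -/
def loadAt : ℕ → ℕ → ℕ → ℕ → ℕ → Cmd
  | 0, _, _, _, _ => skip
  | n + 1, b, r, x, a =>
      const rTmp n ;; ite (.eq x rTmp) (load r (2 * n + b) a) (loadAt n b r x a)

/-- Store the register `r` at the register `a` of the field `2 * reg x + b`, where `reg x < n`. -/
def storeAt : ℕ → ℕ → ℕ → ℕ → ℕ → Cmd
  | 0, _, _, _, _ => skip
  | n + 1, b, x, a, r =>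
      const rTmp n ;; ite (.eq x rTmp) (store (2 * n + b) a r) (storeAt n b x a r)

theorem eq_of_writesReg_loadAt {q : ℕ} (h : (loadAt n b r x a).WritesReg q) :
    q = rTmp ∨ q = r := by
  induction n with
  | zero => exact h.elim
  | succ n ih => grind [loadAt, WritesReg]

theorem not_writesField_loadAt {f : ℕ} : ¬ (loadAt n b r x a).WritesField f := by
  induction n with
  | zero => exact id
  | succ n ih => simpa [loadAt] using ih

theorem eq_of_writesReg_storeAt {q : ℕ} (h : (storeAt n b x a r).WritesReg q) : q = rTmp := by
  induction n with
  | zero => exact h.elim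
  | succ n ih => grind [storeAt, WritesReg]

theorem le_of_writesField_storeAt {f : ℕ} (h : (storeAt n b x a r).WritesField f) : b ≤ f := by
  induction n with
  | zero => exact h.elim
  | succ n ih => grind [storeAt, WritesField]

theorem wp_loadAt (hx : s.reg x < n) (hxt : x ≠ rTmp) (hat : a ≠ rTmp) :
    (loadAt n b r x a).wp (fun s' => s'.reg r = s.field (2 * s.reg x + b) (s.reg a) ∧
      s'.clk ≤ s.clk + 3 * n) s := by
  induction n generalizing s with
  | zero => omega
  | succ n ih =>
    simp only [loadAt, wp_seq, wp_const, wp_ite, wp_load, Test.Holds, Store.reg_set, hxt, if_true,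
      if_false]
    refine ⟨fun hk => ⟨by simp [hat, hk], by simp only [Store.clk_set, Store.clk_tick]; omega⟩,
      fun hk => (ih (by simp [hxt]; omega)).mono fun s' ⟨hr, hclk⟩ => ⟨?_, ?_⟩⟩
    · simpa [hat, hxt] using hr
    · simp only [Store.clk_set, Store.clk_tick] at hclk ⊢
      omega

theorem wp_storeAt (hx : s.reg x < n) (hxt : x ≠ rTmp) (hat : a ≠ rTmp) (hrt : r ≠ rTmp) :
    (storeAt n b x a r).wp (fun s' =>
      s'.field = (s.put (2 * s.reg x + b) (s.reg a) (s.reg r)).field ∧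
      s'.clk ≤ s.clk + 3 * n) s := by
  induction n generalizing s with
  | zero => omega
  | succ n ih =>
    simp only [storeAt, wp_seq, wp_const, wp_ite, wp_store, Test.Holds, Store.reg_set, hxt,
      if_true, if_false]
    refine ⟨fun hk => ⟨by simp [hat, hrt, hk, Store.put, Store.tick, Store.set], by
        simp only [Store.clk_put, Store.clk_set, Store.clk_tick]; omega⟩,
      fun hk => (ih (by simp [hxt]; omega)).mono fun s' ⟨hf, hclk⟩ => ⟨?_, ?_⟩⟩
    · simpa [hat, hxt, hrt, Store.put, Store.tick, Store.set] using hf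
    · simp only [Store.clk_set, Store.clk_tick] at hclk ⊢
      omega

end Cmd

/-! ### The root of a vertex -/

section Find

variable {V : Finset ℕ} {root : ℕ → ℕ} {G W v B : ℕ} {par : ℕ → ℕ} {s : Store}

/-- The loop invariant of the search for the root of `v`: the search is at the ancestor `reg rX`
of `v`, whose parent is `reg rXp`. The time bound `B` leaves six steps for each grade that the
search can still climb. -/
structure Searching (V : Finset ℕ) (root par : ℕ → ℕ) (G W v B : ℕ) (s : Store) : Prop where
  mem : s.reg rX ∈ V
  root_eq : root (s.reg rX) = root v
  parent : s.reg rXp = s.field fPar (s.reg rX)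
  outside : ∀ x ∉ V, s.field fPar x = par x
  forest : Forest V root (s.field fPar) (s.field fRank)
  clk_le : s.clk + 6 * (potential G W V (s.field fPar) (s.field fRank) +
    (G - grade (s.field fRank (s.reg rX))) + (if s.reg rX = s.reg rXp then 0 else 1)) ≤ B

namespace Cmd

/-- The body of the search loop, which halves the path. -/
def halve : Cmd :=
  load rXpp fPar rXp ;; store fPar rX rXpp ;; copy rX rXpp ;; load rXp fPar rX

/-- Replace the vertex in `rX` by its root. -/
def find : Cmd :=
  load rXp fPar rX ;; loopUntil (.eq rX rXp) halve

theorem wp_halve (h : Searching V root par G W v B s) (hG : V.card ≤ tower G)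
    (hne : s.reg rX ≠ s.reg rXp) :
    halve.wp (fun s' => Searching V root par G W v B s'.tick) s.tick := by
  obtain ⟨hV, hroot, hparent, hout, hF, hclk⟩ := h
  have hp : s.field fPar (s.reg rX) ≠ s.reg rX := fun e => hne (by rw [hparent, e])
  have hrank := hF.rank_lt_rank_par_par hV hp
  have hpV := hF.par_mem _ hV
  have hlt := hF.potential_halve_lt (W := W) hG hV hp
  rw [if_neg hne] at hclk
  simp only [halve, wp_seq, wp_load, wp_store, wp_copy, Store.reg_set, Store.reg_tick,
    Store.field_tick, Store.field_set, Store.reg_put, Nat.reduceEqDiff, if_true, if_false, hparent]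
  constructor
  · simpa using hF.par_mem _ hpV
  · simpa using (hF.root_par _ hpV).trans ((hF.root_par _ hV).trans hroot)
  · simp
  · intro x hx
    have hxX : x ≠ s.reg rX := fun e => hx (e ▸ hV)
    simpa [hxX] using hout x hx
  · simpa using hF.halve hV hp
  · have hmono := grade_mono hrank.le
    simp only [Store.field_tick, Store.field_set, Store.field_put_self, Store.reg_tick,
      Store.reg_set, Store.reg_put, Store.clk_tick, Store.clk_set, Store.clk_put, ne_eq,
      Nat.reduceEqDiff, not_false_eq_true, Store.field_put_of_ne, if_true, if_false]
    by_cases hq : s.field fPar (s.field fPar (s.reg rX)) = s.field fPar (s.reg rX)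
    · simp only [hq, Function.update_eq_self, if_true] at hmono ⊢
      omega
    · have := hlt hq
      split_ifs <;> omega

theorem wp_find (hF : Forest V root (s.field fPar) (s.field fRank)) (hG : V.card ≤ tower G)
    (hx : s.reg rX ∈ V) :
    find.wp (fun s' => s'.reg rX = root (s.reg rX) ∧
      (∀ v ∉ V, s'.field fPar v = s.field fPar v) ∧
      Forest V root (s'.field fPar) (s'.field fRank) ∧
      s'.clk + 6 * potential G W V (s'.field fPar) (s'.field fRank) ≤
        s.clk + 6 * potential G W V (s.field fPar) (s.field fRank) + (6 * G + 8)) s := by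
  simp only [find, wp_seq, wp_load]
  refine wp_loopUntil (Searching V root (s.field fPar) G W (s.reg rX)
    (s.clk + 6 * potential G W V (s.field fPar) (s.field fRank) + (6 * G + 7))) _ ?_
    (fun s' h => (Nat.le_add_right _ _).trans h.clk_le) (fun s' h heq => ?_)
    (fun s' h hne => wp_halve h hG hne)
  · refine ⟨by simpa, by simp, by simp, fun x _ => rfl, hF, ?_⟩
    simp only [Store.clk_set, Store.field_set]
    split_ifs <;> omega
  · refine ⟨?_, h.outside, h.forest, ?_⟩
    · exact (h.forest.root_eq_self _ h.mem (h.parent ▸ heq.symm)).symm.trans h.root_eq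
    · have hclk := h.clk_le
      simp only [Store.clk_tick, Store.field_tick]
      omega

end Cmd

end Find

/-! ### Installed and pending edges -/

/-- The installed edges `I` form a folded graph with labels below `n` on the vertices `root v`:
`slot d x v` is the installed edge with label `x` whose end `d` is at `v`, and `0` if there is
none. Here the end `true` of an edge is its initial, the end `false` its terminal vertex. -/
structure Slots (n : ℕ) (ends : Bool → ℕ → ℕ) (lab root : ℕ → ℕ) (I : Set ℕ)
    (slot : Bool → ℕ → ℕ → ℕ) : Prop where
  mem : ∀ d x v, x < n → slot d x v ≠ 0 →
    slot d x v ∈ I ∧ lab (slot d x v) = x ∧ root (ends d (slot d x v)) = v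
  eq_of_mem : ∀ e ∈ I, ∀ d, slot d (lab e) (root (ends d e)) = e

namespace Slots

variable {n e l r : ℕ} {ends : Bool → ℕ → ℕ} {lab root : ℕ → ℕ} {I : Set ℕ}
  {slot slot' : Bool → ℕ → ℕ → ℕ}

theorem install (h : Slots n ends lab root I slot) (h0 : 0 ∉ I)
    (hfree : ∀ d, slot d (lab e) (root (ends d e)) = 0)
    (hslot : ∀ d x v, slot' d x v = if x = lab e ∧ v = root (ends d e) then e else slot d x v) :
    Slots n ends lab root (insert e I) slot' where
  mem d x v hx hv := by
    have := h.mem d x v hx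
    grind
  eq_of_mem f hf d := by
    have := h.eq_of_mem f
    grind

theorem detach (h : Slots n ends lab root I slot) (he : e ∈ I)
    (hslot : ∀ d x v, slot' d x v = if x = lab e ∧ v = root (ends d e) then 0 else slot d x v) :
    Slots n ends lab root (I \ {e}) slot' where
  mem d x v hx hv := by
    have := h.mem d x v hx
    grind
  eq_of_mem f hf d := by
    have := h.eq_of_mem e he d
    have := h.eq_of_mem f hf.1 d
    grind

theorem union (h : Slots n ends lab root I slot) (hI : ∀ e ∈ I, e ≠ 0 ∧ lab e < n)
    (hl : ∀ d, ∀ x < n, slot d x l = 0) :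
    Slots n ends lab (fun v => if root v = l then r else root v) I slot where
  mem d x v hx hv := by
    have := h.mem d x v hx hv
    grind
  eq_of_mem f hf d := by
    have := h.eq_of_mem f hf d
    grind

end Slots

/-- The places `i` with `a ≤ i < b` of the field `q` contain the elements of `pend`, without
repetitions. -/
structure Queue (q : ℕ → ℕ) (a b : ℕ) (pend : Set ℕ) : Prop where
  le : a ≤ b
  bijOn : Set.BijOn q (Set.Ico a b) pend

namespace Queue

variable {q : ℕ → ℕ} {a b : ℕ} {pend : Set ℕ}

theorem head_mem (h : Queue q a b pend) (hab : a ≠ b) : q a ∈ pend :=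
  h.bijOn.mapsTo ⟨le_rfl, lt_of_le_of_ne h.le hab⟩

theorem pop (h : Queue q a b pend) (hab : a ≠ b) : Queue q (a + 1) b (pend \ {q a}) := by
  have hlt : a < b := lt_of_le_of_ne h.le hab
  refine ⟨hlt, ?_⟩
  have := h.bijOn.sdiff_singleton (a := a) ⟨le_rfl, hlt⟩
  convert this using 1
  ext i
  simp only [Set.mem_Ico, Set.mem_sdiff, Set.mem_singleton_iff]
  omega

theorem push (h : Queue q a b pend) {e : ℕ} (he : e ∉ pend) :
    Queue (Function.update q b e) a (b + 1) (insert e pend) := by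
  have hb : b ∉ Set.Ico a b := by simp
  refine ⟨h.le.trans b.le_succ, ?_⟩
  have heq : Set.EqOn q (Function.update q b e) (Set.Ico a b) := fun i hi =>
    (Function.update_of_ne (ne_of_mem_of_not_mem hi hb) _ _).symm
  have := (h.bijOn.congr heq).insert (a := b) (by simpa using he)
  convert this using 1
  · ext i
    have := h.le
    simp only [Set.mem_Ico, Set.mem_insert_iff]
    omega
  · simp

end Queue

/-- The field that contains the ends `d` of the edges. -/
def fEnd (d : Bool) : ℕ := cond d fSrc fTgt

/-- The first field of the family of the slots for the ends `d`; the slot for the label `x` is in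
the field `2 * x + fSlot d`. -/
def fSlot (d : Bool) : ℕ := cond d fOut fInn

theorem fEnd_mem_Icc (d : Bool) : fEnd d ∈ Set.Icc fSrc fTgt := by
  cases d <;> simp [fEnd]

theorem fOut_le_fSlot (d : Bool) : fOut ≤ fSlot d := by
  cases d <;> simp [fSlot]

theorem two_mul_add_fSlot_inj {d d' : Bool} {x x' : ℕ} :
    2 * x + fSlot d = 2 * x' + fSlot d' ↔ x = x' ∧ d = d' := by
  cases d <;> cases d' <;> simp [fSlot] <;> omega

/-- The state of the folding algorithm on the edges `A`, of which those in `pend` wait in the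
queue while the others are installed. -/
structure Work (n : ℕ) (V : Finset ℕ) (root : ℕ → ℕ) (A pend : Set ℕ) (s : Store) : Prop where
  forest : Forest V root (s.field fPar) (s.field fRank)
  slots : Slots n (fun d => s.field (fEnd d)) (s.field fLab) root (A \ pend)
    (fun d x => s.field (2 * x + fSlot d))
  edge : ∀ e ∈ A, e ≠ 0 ∧ (∀ d, s.field (fEnd d) e ∈ V) ∧ s.field fLab e < n
  pend_subset : pend ⊆ A
  queue : Queue (s.field fQueue) (s.reg rHead) (s.reg rTail) pend
  outside : ∀ v ∉ V, s.field fPar v ≠ v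
  zero : s.reg rZero = 0

namespace Work

variable {n : ℕ} {V : Finset ℕ} {root : ℕ → ℕ} {A pend : Set ℕ} {s s' : Store}

theorem congr (h : Work n V root A pend s) (hHead : s'.reg rHead = s.reg rHead)
    (hTail : s'.reg rTail = s.reg rTail) (hZero : s'.reg rZero = s.reg rZero)
    (hf : ∀ f, fPar ≤ f → f ≠ fAlive → s'.field f = s.field f) : Work n V root A pend s' := by
  have hend (d) : s'.field (fEnd d) = s.field (fEnd d) :=
    hf _ (by have := (fEnd_mem_Icc d).1; omega) (by have := (fEnd_mem_Icc d).2; omega)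
  have hslot (x d) : s'.field (2 * x + fSlot d) = s.field (2 * x + fSlot d) := by
    have := fOut_le_fSlot d
    exact hf _ (by omega) (by omega)
  obtain ⟨h₁, h₂, h₃, h₄, h₅, h₆, h₇⟩ := h
  constructor <;> simpa only [hend, hslot, hHead, hTail, hZero, hf fPar (by simp) (by simp),
    hf fRank (by simp) (by simp), hf fLab (by simp) (by simp), hf fQueue (by simp) (by simp)]

theorem set (h : Work n V root A pend s) {r v : ℕ} (hHead : r ≠ rHead) (hTail : r ≠ rTail)
    (hZero : r ≠ rZero) : Work n V root A pend (s.set r v) :=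
  h.congr (by simp [hHead.symm]) (by simp [hTail.symm]) (by simp [hZero.symm]) fun _ _ _ => rfl

theorem tick (h : Work n V root A pend s) : Work n V root A pend s.tick :=
  h.congr rfl rfl rfl fun _ _ _ => rfl

theorem uninstall {e : ℕ} (h : Work n V root A pend s) (he : e ∈ A \ pend)
    (hHead : s'.reg rHead = s.reg rHead) (hTail : s'.reg rTail = s.reg rTail + 1)
    (hZero : s'.reg rZero = s.reg rZero)
    (hQueue : s'.field fQueue = Function.update (s.field fQueue) (s.reg rTail) e)
    (hSlot : ∀ d x v, s'.field (2 * x + fSlot d) v =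
      if x = s.field fLab e ∧ v = root (s.field (fEnd d) e) then 0
      else s.field (2 * x + fSlot d) v)
    (hf : ∀ f, f < fQueue → s'.field f = s.field f) : Work n V root A (insert e pend) s' := by
  have hend (d) : s'.field (fEnd d) = s.field (fEnd d) :=
    hf _ (by have := (fEnd_mem_Icc d).2; omega)
  constructor
  · simpa only [hf fPar (by simp), hf fRank (by simp)] using h.forest
  · rw [← Set.union_singleton, ← Set.sdiff_sdiff]
    simpa only [hend, hf fLab (by simp)] using h.slots.detach he hSlot
  · simpa only [hend, hf fLab (by simp)] using h.edge
  · exact Set.insert_subset he.1 h.pend_subset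
  · rw [hHead, hTail, hQueue]
    exact h.queue.push he.2
  · simpa only [hf fPar (by simp)] using h.outside
  · rw [hZero, h.zero]

theorem pop (h : Work n V root A pend s) (hne : s.reg rHead ≠ s.reg rTail)
    (hHead : s'.reg rHead = s.reg rHead + 1) (hTail : s'.reg rTail = s.reg rTail)
    (hZero : s'.reg rZero = s.reg rZero) (hf : s'.field = s.field) :
    Work n V root (A \ {s.field fQueue (s.reg rHead)})
      (pend \ {s.field fQueue (s.reg rHead)}) s' := by
  have hmem := h.queue.head_mem hne
  constructor
  · rw [hf]
    exact h.forest
  · rw [hf, Set.sdiff_sdiff, Set.singleton_union, Set.insert_sdiff_singleton,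
      Set.insert_eq_self.2 hmem]
    exact h.slots
  · rw [hf]
    exact fun e he => h.edge e he.1
  · exact Set.sdiff_subset_sdiff_left h.pend_subset
  · rw [hHead, hTail, hf]
    exact h.queue.pop hne
  · rw [hf]
    exact h.outside
  · rw [hZero, h.zero]

theorem install {e : ℕ} (h : Work n V root A pend s) (heA : e ∉ A) (he : e ≠ 0)
    (hend : ∀ d, s.field (fEnd d) e ∈ V) (hlab : s.field fLab e < n)
    (hfree : ∀ d, s.field (2 * s.field fLab e + fSlot d) (root (s.field (fEnd d) e)) = 0)
    (hHead : s'.reg rHead = s.reg rHead) (hTail : s'.reg rTail = s.reg rTail)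
    (hZero : s'.reg rZero = s.reg rZero)
    (hSlot : ∀ d x v, s'.field (2 * x + fSlot d) v =
      if x = s.field fLab e ∧ v = root (s.field (fEnd d) e) then e
      else s.field (2 * x + fSlot d) v)
    (hf : ∀ f, f < fOut → s'.field f = s.field f) : Work n V root (insert e A) pend s' := by
  have hend' (d) : s'.field (fEnd d) = s.field (fEnd d) :=
    hf _ (by have := (fEnd_mem_Icc d).2; omega)
  constructor
  · simpa only [hf fPar (by simp), hf fRank (by simp)] using h.forest
  · rw [Set.insert_sdiff_of_notMem _ fun hp => heA (h.pend_subset hp)]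
    simpa only [hend', hf fLab (by simp)] using
      h.slots.install (fun h0 => (h.edge 0 h0.1).1 rfl) hfree hSlot
  · simp only [hend', hf fLab (by simp)]
    rintro f (rfl | hfA)
    exacts [⟨he, hend, hlab⟩, h.edge f hfA]
  · exact h.pend_subset.trans (Set.subset_insert e A)
  · simpa only [hf fQueue (by simp), hHead, hTail] using h.queue
  · simpa only [hf fPar (by simp)] using h.outside
  · rw [hZero, h.zero]

end Work

/-! ### Detaching the edges at a vertex -/

/-- The time that has passed, together with the potential of the forest and of the queue: of each
place of the queue `a` steps are charged in advance, when it is filled. -/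
def charge (G W : ℕ) (V : Finset ℕ) (a : ℕ) (s : Store) : ℕ :=
  s.clk + 6 * potential G W V (s.field fPar) (s.field fRank) + a * s.reg rTail

section Charge

variable {G W : ℕ} {V : Finset ℕ} {a : ℕ} {s : Store}

theorem clk_le_charge : s.clk ≤ charge G W V a s := by
  unfold charge
  omega

@[simp] theorem charge_tick : charge G W V a s.tick = charge G W V a s + 1 := by
  simp only [charge, Store.clk_tick, Store.field_tick, Store.reg_tick]
  omega

theorem charge_set {r v : ℕ} (hr : r ≠ rTail) :
    charge G W V a (s.set r v) = charge G W V a s + 1 := by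
  simp only [charge, Store.clk_set, Store.field_set, Store.reg_set, hr.symm, if_false]
  omega

theorem charge_put {f b v : ℕ} (hPar : f ≠ fPar) (hRank : f ≠ fRank) :
    charge G W V a (s.put f b v) = charge G W V a s + 1 := by
  simp only [charge, Store.clk_put, Store.reg_put, Store.field_put_of_ne _ _ _ hPar.symm,
    Store.field_put_of_ne _ _ _ hRank.symm]
  omega

end Charge

namespace Cmd

variable {n : ℕ} {V : Finset ℕ} {root : ℕ → ℕ} {A pend : Set ℕ} {G : ℕ} (W a : ℕ)
  {s : Store} {d : Bool}

theorem wp_find_work (hw : Work n V root A pend s) (hG : V.card ≤ tower G) (hx : s.reg rX ∈ V) :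
    find.wp (fun s' => Work n V root A pend s' ∧ s'.reg rX = root (s.reg rX) ∧
      charge G W V a s' ≤ charge G W V a s + (6 * G + 8)) s := by
  refine (wp_find (W := W) hw.forest hG hx).call ?_
  rintro s' ⟨hX, hout, hF, hclk⟩ fr
  have hreg (q) (h₁ : q ≠ rX) (h₂ : q ≠ rXp) (h₃ : q ≠ rXpp) : s'.reg q = s.reg q :=
    fr.reg q (by simp [find, halve, *])
  have hfld (f) (hf : f ≠ fPar) : s'.field f = s.field f := fr.field f (by simp [find, halve, hf])
  have hend (d) : s'.field (fEnd d) = s.field (fEnd d) :=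
    hfld _ (by have := (fEnd_mem_Icc d).1; omega)
  have hslot (x d) : s'.field (2 * x + fSlot d) = s.field (2 * x + fSlot d) :=
    hfld _ (by have := fOut_le_fSlot d; omega)
  refine ⟨⟨hF, ?_, ?_, hw.pend_subset, ?_, fun v hv => hout v hv ▸ hw.outside v hv, ?_⟩, hX, ?_⟩
  · simpa only [hend, hslot, hfld fLab (by simp)] using hw.slots
  · simpa only [hend, hfld fLab (by simp)] using hw.edge
  · simpa only [hfld fQueue (by simp), hreg rHead (by simp) (by simp) (by simp),
      hreg rTail (by simp) (by simp) (by simp)] using hw.queue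
  · rw [hreg rZero (by simp) (by simp) (by simp), hw.zero]
  · rw [charge, charge, hreg rTail (by simp) (by simp) (by simp)]
    omega

/-- Store the register `r` in the slots for the label `reg x` and the ends `d` at the vertices
`reg (p d)`. -/
def storeSlots (n x : ℕ) (p : Bool → ℕ) (r : ℕ) : Cmd :=
  storeAt n (fSlot true) x (p true) r ;; storeAt n (fSlot false) x (p false) r

/-- Remove the edge in `rG` with label `rI` and the ends `d` at the vertices `reg (p d)` from its
slots and append it to the queue. -/
def enqueue (n : ℕ) (p : Bool → ℕ) : Cmd :=
  storeSlots n rI p rZero ;; store fQueue rTail rG ;; succ rTail rTail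

/-- Uninstall the edge in `rG` with label `rI`, whose end `d` is at `rA`. -/
def uninstall (n : ℕ) (d : Bool) : Cmd :=
  load rX (fEnd !d) rG ;; find ;; enqueue n (fun d' => if d' = d then rA else rX)

/-- Uninstall the edge with label `rI` and end `d` at `rA`, if there is one. -/
def detachSlot (n : ℕ) (d : Bool) : Cmd :=
  loadAt n (fSlot d) rG rI rA ;; ite (.eq rG rZero) skip (uninstall n d)

/-- Uninstall all edges at the vertex `rA`. -/
def detach (n : ℕ) : Cmd :=
  const rI 0 ;; const rN n ;;
  loopUntil (.eq rI rN) (detachSlot n true ;; detachSlot n false ;; succ rI rI)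

theorem eq_of_writesReg_storeSlots {n x r q : ℕ} {p : Bool → ℕ}
    (h : (storeSlots n x p r).WritesReg q) : q = rTmp :=
  h.elim eq_of_writesReg_storeAt eq_of_writesReg_storeAt

theorem le_of_writesField_storeSlots {n x r f : ℕ} {p : Bool → ℕ}
    (h : (storeSlots n x p r).WritesField f) : fOut ≤ f :=
  h.elim (fun h => (fOut_le_fSlot _).trans (le_of_writesField_storeAt h))
    fun h => (fOut_le_fSlot _).trans (le_of_writesField_storeAt h)

theorem wp_storeSlots {x r : ℕ} {p : Bool → ℕ} (hx : s.reg x < n) (hxt : x ≠ rTmp)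
    (hpt : ∀ d, p d ≠ rTmp) (hrt : r ≠ rTmp) :
    (storeSlots n x p r).wp (fun s' => (∀ d y v, s'.field (2 * y + fSlot d) v =
        if y = s.reg x ∧ v = s.reg (p d) then s.reg r else s.field (2 * y + fSlot d) v) ∧
      s'.clk ≤ s.clk + 6 * n) s := by
  simp only [storeSlots, wp_seq]
  refine (wp_storeAt hx hxt (hpt _) hrt).call ?_
  rintro s₁ ⟨hf₁, hc₁⟩ fr₁
  have hreg (q) (h : q ≠ rTmp) : s₁.reg q = s.reg q :=
    fr₁.reg q fun hq => h (eq_of_writesReg_storeAt hq)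
  refine (wp_storeAt (by rwa [hreg x hxt]) hxt (hpt _) hrt).mono ?_
  rintro s₂ ⟨hf₂, hc₂⟩
  refine ⟨?_, ?_⟩
  · intro d y v
    simp only [hf₂, Store.field_put_apply, hf₁, hreg x hxt, hreg _ (hpt false), hreg r hrt,
      two_mul_add_fSlot_inj]
    cases d <;> simp
  · omega

variable (G) in
theorem wp_enqueue {p : Bool → ℕ} (hpt : ∀ d, p d ≠ rTmp) (hw : Work n V root A pend s)
    (he : s.reg rG ∈ A \ pend) (hlab : s.field fLab (s.reg rG) = s.reg rI)
    (hp : ∀ d, s.reg (p d) = root (s.field (fEnd d) (s.reg rG))) :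
    (enqueue n p).wp (fun s' => Work n V root A (insert (s.reg rG) pend) s' ∧
      (∀ d, s'.field (2 * s.reg rI + fSlot d) (s.reg (p d)) = 0) ∧
      (∀ d x v, s.field (2 * x + fSlot d) v = 0 → s'.field (2 * x + fSlot d) v = 0) ∧
      charge G W V a s' ≤ charge G W V a s + (6 * n + 2 + a)) s := by
  have hI := (hw.edge _ he.1).2.2
  rw [hlab] at hI
  simp only [enqueue, wp_seq]
  refine (wp_storeSlots hI (by simp) hpt (by simp)).call ?_
  rintro s₁ ⟨hSlot, hclk⟩ fr
  simp only [wp_seq, wp_store, wp_succ]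
  have hreg (q) (h : q ≠ rTmp) : s₁.reg q = s.reg q :=
    fr.reg q fun hq => h (eq_of_writesReg_storeSlots hq)
  have hfld (f) (h : f < fOut) : s₁.field f = s.field f :=
    fr.field f fun hf => h.not_ge (le_of_writesField_storeSlots hf)
  have hput (i v) (f) (h : f ≠ fQueue) : (s₁.put fQueue i v).field f = s₁.field f :=
    Store.field_put_of_ne _ _ _ h
  simp only [hreg, ne_eq, Nat.reduceEqDiff, not_false_eq_true, Store.reg_put]
  refine ⟨hw.uninstall he (by simp [hreg]) (by simp) (by simp [hreg])
    (by simp [hfld]) (fun d x v => ?_) (fun f hf => ?_), fun d => ?_, fun d x v hv => ?_, ?_⟩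
  · have := fOut_le_fSlot d
    rw [Store.field_set, hput _ _ _ (by omega), hSlot, hw.zero, hlab, hp]
  · rw [Store.field_set, hput _ _ _ hf.ne, hfld f (by omega)]
  · have := fOut_le_fSlot d
    rw [Store.field_set, hput _ _ _ (by omega), hSlot, hw.zero, if_pos ⟨rfl, rfl⟩]
  · have := fOut_le_fSlot d
    rw [Store.field_set, hput _ _ _ (by omega), hSlot, hw.zero, hv, ite_self]
  · simp only [charge, Store.clk_set, Store.clk_put, Store.field_set, Store.reg_set, if_true,
      hput, hfld, ne_eq, Nat.reduceEqDiff, not_false_eq_true, Nat.reduceLT, Nat.mul_add]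
    omega

theorem wp_uninstall (hw : Work n V root A pend s) (hG : V.card ≤ tower G)
    (he : s.reg rG ∈ A \ pend) (hlab : s.field fLab (s.reg rG) = s.reg rI)
    (hend : root (s.field (fEnd d) (s.reg rG)) = s.reg rA) :
    (uninstall n d).wp (fun s' => (∃ pend', Work n V root A pend' s') ∧
      s'.field (2 * s.reg rI + fSlot d) (s.reg rA) = 0 ∧
      (∀ d x v, s.field (2 * x + fSlot d) v = 0 → s'.field (2 * x + fSlot d) v = 0) ∧
      charge G W V a s' ≤ charge G W V a s + (6 * G + 6 * n + 11 + a)) s := by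
  simp only [uninstall, wp_seq, wp_load]
  refine (wp_find_work W a (hw.set (by simp) (by simp) (by simp)) hG
    (by simpa using (hw.edge _ he.1).2.1 !d)).call ?_
  rintro s₁ ⟨hw₁, hX, hc₁⟩ fr₁
  have hreg (q) (h : q ≠ rX ∧ q ≠ rXp ∧ q ≠ rXpp) : s₁.reg q = s.reg q := by
    rw [fr₁.reg q (by simp [find, halve, h]), Store.reg_set, if_neg h.1]
  have hfld (f) (h : f ≠ fPar) : s₁.field f = s.field f :=
    fr₁.field f (by simp [find, halve, h])
  have hrG := hreg rG (by simp)
  have hvert (d') : s₁.reg (if d' = d then rA else rX) =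
      root (s₁.field (fEnd d') (s₁.reg rG)) := by
    rw [hfld _ (by have := (fEnd_mem_Icc d').1; omega), hrG]
    rcases Bool.eq_or_eq_not d' d with rfl | rfl
    · rw [if_pos rfl, hreg rA (by simp), hend]
    · simpa using hX
  refine (wp_enqueue G W a (fun d' => by split_ifs <;> simp) hw₁ (hrG ▸ he)
    (by rw [hrG, hfld fLab (by simp), hlab, hreg rI (by simp)]) hvert).mono ?_
  rintro s₂ ⟨hw₂, hSlot, hzero, hc₂⟩
  refine ⟨⟨_, hw₂⟩, ?_, fun d x v hv => hzero d x v ?_, ?_⟩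
  · simpa [hreg] using hSlot d
  · rwa [hfld _ (by have := fOut_le_fSlot d; omega)]
  · simp only [charge, Store.clk_set, Store.field_set, Store.reg_set, Nat.reduceEqDiff, if_false]
      at hc₁ hc₂ ⊢
    omega

theorem mem_of_writesReg_detachSlot {q : ℕ} (h : (detachSlot n d).WritesReg q) :
    q ∈ [rX, rXp, rXpp, rTmp, rTail, rG] := by
  have := @eq_of_writesReg_loadAt n (fSlot d) rG rI rA q
  have := fun p => @eq_of_writesReg_storeSlots n rI rZero q p
  simp only [detachSlot, uninstall, enqueue, find, halve, WritesReg] at h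
  simp only [List.mem_cons, List.not_mem_nil]
  grind

theorem mem_of_writesField_detachSlot {f : ℕ} (h : (detachSlot n d).WritesField f) :
    f ∈ [fPar, fQueue] ∨ fOut ≤ f := by
  have := @not_writesField_loadAt n (fSlot d) rG rI rA f
  have := fun p => @le_of_writesField_storeSlots n rI rZero f p
  simp only [detachSlot, uninstall, enqueue, find, halve, WritesField] at h
  simp only [List.mem_cons, List.not_mem_nil]
  grind

theorem wp_detachSlot (hw : Work n V root A pend s) (hG : V.card ≤ tower G)
    (hI : s.reg rI < n) :
    (detachSlot n d).wp (fun s' => (∃ pend', Work n V root A pend' s') ∧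
      s'.field (2 * s.reg rI + fSlot d) (s.reg rA) = 0 ∧
      (∀ d x v, s.field (2 * x + fSlot d) v = 0 → s'.field (2 * x + fSlot d) v = 0) ∧
      charge G W V a s' ≤ charge G W V a s + (6 * G + 9 * n + 14 + a)) s := by
  simp only [detachSlot, wp_seq]
  refine (wp_loadAt hI (by simp) (by simp)).call ?_
  rintro s₁ ⟨hrG, hclk⟩ fr
  have hreg (q) (h : q ≠ rTmp ∧ q ≠ rG) : s₁.reg q = s.reg q :=
    fr.reg q fun hq => (eq_of_writesReg_loadAt hq).elim h.1 h.2
  have hfld : s₁.field = s.field := funext fun f => fr.field f not_writesField_loadAt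
  have hw₁ : Work n V root A pend s₁ :=
    hw.congr (hreg _ (by simp)) (hreg _ (by simp)) (hreg _ (by simp)) fun f _ _ => by rw [hfld]
  have hc₁ : charge G W V a s₁ ≤ charge G W V a s + 3 * n := by
    simp only [charge, hfld, hreg rTail (by simp)]
    omega
  simp only [wp_ite, wp_skip, Test.Holds, hw₁.zero, charge_tick]
  refine ⟨fun h0 => ⟨⟨pend, hw₁.tick⟩, ?_, fun d x v h => ?_, by omega⟩, fun h0 => ?_⟩
  · simpa [hfld, ← hrG] using h0
  · simpa [hfld] using h
  · obtain ⟨hmem, hlab, hend⟩ := hw.slots.mem d _ _ hI (hrG ▸ h0)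
    rw [← hrG, ← hfld] at hlab
    rw [← hrG, ← hfld, ← hreg rA (by simp)] at hend
    refine (wp_uninstall W a hw₁.tick hG (by simpa [hrG] using hmem)
      (by simpa [hreg rI (by simp)] using hlab) hend).mono ?_
    rintro s₂ ⟨⟨pend', hw₂⟩, hSlot, hzero, hc₂⟩
    rw [charge_tick] at hc₂
    refine ⟨⟨pend', hw₂.tick⟩, ?_, fun d x v h => hzero d x v ?_, by omega⟩
    · simpa [hreg] using hSlot
    · simpa [hfld] using h

/-- The loop invariant of `detach`: the slots at the vertex `v` for the labels below `rI` are
empty. The time bound `B` leaves `D` steps for each slot still to be emptied. -/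
structure Detaching (n : ℕ) (V : Finset ℕ) (root : ℕ → ℕ) (A : Set ℕ) (G W a v D B : ℕ)
    (s : Store) : Prop where
  work : ∃ pend, Work n V root A pend s
  le : s.reg rI ≤ n
  rN_eq : s.reg rN = n
  rA_eq : s.reg rA = v
  empty : ∀ d, ∀ x < s.reg rI, s.field (2 * x + fSlot d) v = 0
  charge_le : charge G W V a s + (n - s.reg rI) * (2 * D + 3) ≤ B

theorem wp_detach_step {v D B : ℕ} (h : Detaching n V root A G W a v D B s)
    (hG : V.card ≤ tower G) (hD : 6 * G + 9 * n + 14 + a ≤ D) (hne : s.reg rI ≠ s.reg rN) :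
    (detachSlot n true ;; detachSlot n false ;; succ rI rI).wp
      (fun s' => Detaching n V root A G W a v D B s'.tick) s.tick := by
  obtain ⟨⟨pend, hw⟩, hle, hN, hA, hempty, hcharge⟩ := h
  have hlt : s.reg rI < n := by omega
  simp only [wp_seq]
  refine (wp_detachSlot W a hw.tick hG hlt).call ?_
  rintro s₁ ⟨⟨pend₁, hw₁⟩, hSlot₁, hzero₁, hc₁⟩ fr₁
  have hreg₁ (q) (h : q ∉ [rX, rXp, rXpp, rTmp, rTail, rG]) : s₁.reg q = s.reg q :=
    fr₁.reg q fun hq => h (mem_of_writesReg_detachSlot hq)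
  rw [wp_seq]
  refine (wp_detachSlot W a hw₁ hG (by rwa [hreg₁ rI (by simp)])).call ?_
  rintro s₂ ⟨⟨pend₂, hw₂⟩, hSlot₂, hzero₂, hc₂⟩ fr₂
  have hreg₂ (q) (h : q ∉ [rX, rXp, rXpp, rTmp, rTail, rG]) : s₂.reg q = s.reg q :=
    (fr₂.reg q fun hq => h (mem_of_writesReg_detachSlot hq)).trans (hreg₁ q h)
  simp only [hreg₁ rI (by simp), hreg₁ rA (by simp), Store.reg_tick, hA] at hSlot₁ hSlot₂
  rw [wp_succ]
  refine ⟨⟨pend₂, (hw₂.set (by simp) (by simp) (by simp)).tick⟩, ?_, ?_, ?_, fun d x hx => ?_, ?_⟩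
  · simpa [hreg₂] using hlt
  · simpa [hreg₂] using hN
  · simpa [hreg₂] using hA
  · simp only [Store.reg_tick, Store.reg_set, if_true, hreg₂ rI (by simp)] at hx
    rcases Nat.lt_succ_iff_lt_or_eq.1 hx with hx | rfl
    · exact hzero₂ d x v (hzero₁ d x v (hempty d x hx))
    · cases d
      exacts [hSlot₂, hzero₂ _ _ _ hSlot₁]
  · obtain ⟨k, hk⟩ := Nat.exists_eq_add_of_lt hlt
    rw [show n - s.reg rI = k + 1 by omega, Nat.add_mul] at hcharge
    simp only [charge_tick, charge_set (s := s₂) (r := rI) (by simp), Store.reg_tick,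
      Store.reg_set, if_true, hreg₂ rI (by simp)] at hc₁ ⊢
    rw [show n - (s.reg rI + 1) = k by omega]
    omega

theorem wp_detach (hw : Work n V root A pend s) (hG : V.card ≤ tower G) :
    (detach n).wp (fun s' => (∃ pend', Work n V root A pend' s') ∧
      (∀ d, ∀ x < n, s'.field (2 * x + fSlot d) (s.reg rA) = 0) ∧
      charge G W V a s' ≤
        charge G W V a s + (n * (2 * (6 * G + 9 * n + 14 + a) + 3) + 3)) s := by
  set D := 6 * G + 9 * n + 14 + a with hD
  simp only [detach, wp_seq, wp_const]
  refine wp_loopUntil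
    (Detaching n V root A G W a (s.reg rA) D (charge G W V a s + (n * (2 * D + 3) + 2)))
    (charge G W V a s + (n * (2 * D + 3) + 2)) ?_ ?_ ?_ ?_
  · have hw' := (hw.set (r := rI) (v := 0) (by simp) (by simp) (by simp)).set (r := rN) (v := n)
      (by simp) (by simp) (by simp)
    refine ⟨⟨pend, hw'⟩, by simp, by simp, by simp, by simp, ?_⟩
    simp only [charge_set, ne_eq, Nat.reduceEqDiff, not_false_eq_true, Store.reg_set, if_true,
      if_false, Nat.sub_zero]
    omega
  · exact fun s' h => clk_le_charge.trans (le_of_add_le_left h.charge_le)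
  · rintro s' ⟨⟨pend', hw'⟩, -, hN, -, hempty, hc⟩ heq
    rw [Test.Holds, hN] at heq
    refine ⟨⟨pend', hw'.tick⟩, fun d x hx => hempty d x (heq ▸ hx), ?_⟩
    rw [charge_tick]
    omega
  · exact fun s' h hne => wp_detach_step W a h hG hD.ge hne

theorem mem_of_writesReg_detach {q : ℕ} (h : (detach n).WritesReg q) :
    q ∈ [rX, rXp, rXpp, rTmp, rTail, rG, rI, rN] := by
  have := fun d => @mem_of_writesReg_detachSlot n d q
  simp only [detach, WritesReg] at h
  grind

theorem mem_of_writesField_detach {f : ℕ} (h : (detach n).WritesField f) :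
    f ∈ [fPar, fQueue] ∨ fOut ≤ f := by
  have := fun d => @mem_of_writesField_detachSlot n d f
  simp only [detach, WritesField] at h
  grind

end Cmd

/-! ### Merging two vertices -/

section Merge

variable {n : ℕ} {V : Finset ℕ} {root : ℕ → ℕ} {A pend : Set ℕ} {G W a : ℕ} {s s' : Store}

theorem Work.link {l r : ℕ} (h : Work n V root A pend s) (hl : l ∈ V) (hr : r ∈ V) (hlr : l ≠ r)
    (hpl : s.field fPar l = l) (hpr : s.field fPar r = r)
    (hle : s.field fRank l ≤ s.field fRank r)
    (hempty : ∀ d, ∀ x < n, s.field (2 * x + fSlot d) l = 0)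
    (hreg : ∀ q < rX, s'.reg q = s.reg q)
    (hPar : s'.field fPar = Function.update (s.field fPar) l r)
    (hRank : s'.field fRank = linkRank (s.field fRank) l r)
    (hf : ∀ f, fRank < f → s'.field f = s.field f) :
    Work n V (fun x => if root x = l then r else root x) A pend s' := by
  have hend (d) : s'.field (fEnd d) = s.field (fEnd d) :=
    hf _ (by have := (fEnd_mem_Icc d).1; omega)
  have hslot (x d) : s'.field (2 * x + fSlot d) = s.field (2 * x + fSlot d) :=
    hf _ (by have := fOut_le_fSlot d; omega)
  constructor
  · rw [hPar, hRank]
    exact h.forest.link hl hr hlr hpl hpr hle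
  · simp only [hend, hslot, hf fLab (by simp)]
    exact h.slots.union
      (fun e he => ⟨(h.edge e he.1).1, (h.edge e he.1).2.2⟩) hempty
  · simpa only [hend, hf fLab (by simp)] using h.edge
  · exact h.pend_subset
  · simpa only [hf fQueue (by simp), hreg rHead (by simp), hreg rTail (by simp)] using h.queue
  · intro v hv
    rw [hPar, Function.update_of_ne (ne_of_mem_of_not_mem hl hv).symm]
    exact h.outside v hv
  · rw [hreg rZero (by simp), h.zero]

namespace Cmd

/-- Make the root `rA`, whose rank is at most that of the root `rB`, a child of `rB`. -/
def attach : Cmd :=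
  load rRankA fRank rA ;; load rRankB fRank rB ;;
  ite (.eq rRankA rRankB) (succ rRankB rRankB ;; store fRank rB rRankB) skip ;;
  store fPar rA rB

/-- Make the root `rA` a child of the root `rB`, after removing the edges at `rA`. -/
def link (n : ℕ) : Cmd :=
  detach n ;; attach

/-- Replace the vertices in `rA` and `rB` by their roots. -/
def findBoth : Cmd :=
  copy rX rA ;; find ;; copy rA rX ;; copy rX rB ;; find ;; copy rB rX

/-- Exchange `rA` and `rB` if the rank of `rA` is larger. -/
def orderByRank : Cmd :=
  load rRankA fRank rA ;; load rRankB fRank rB ;;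
  ite (.lt rRankB rRankA) (copy rSwap rA ;; copy rA rB ;; copy rB rSwap) skip

/-- Merge the classes of the vertices `rA` and `rB`. -/
def merge (n : ℕ) : Cmd :=
  findBoth ;; ite (.eq rA rB) skip (orderByRank ;; link n)

theorem wp_attach :
    attach.wp (fun s' =>
      s'.field fPar = Function.update (s.field fPar) (s.reg rA) (s.reg rB) ∧
      s'.field fRank = linkRank (s.field fRank) (s.reg rA) (s.reg rB) ∧
      s'.clk ≤ s.clk + 7) s := by
  simp only [attach, wp_seq, wp_load, wp_ite, wp_succ, wp_store, wp_skip, Test.Holds]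
  refine ⟨fun heq => ?_, fun hne => ?_⟩
  · have heq' : s.field fRank (s.reg rA) = s.field fRank (s.reg rB) := by simpa using heq
    refine ⟨?_, ?_, ?_⟩ <;> simp [linkRank, heq', Store.field_put_of_ne]
  · have hne' : s.field fRank (s.reg rA) ≠ s.field fRank (s.reg rB) := by simpa using hne
    refine ⟨?_, ?_, ?_⟩ <;> simp [linkRank, hne', Store.field_put_of_ne]

theorem wp_link (hw : Work n V root A pend s) (hG : V.card ≤ tower G)
    (hW : n * (2 * (6 * G + 9 * n + 14 + a) + 3) + 20 ≤ 6 * W)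
    (hA : s.reg rA ∈ V) (hB : s.reg rB ∈ V) (hrA : root (s.reg rA) = s.reg rA)
    (hrB : root (s.reg rB) = s.reg rB) (hne : s.reg rA ≠ s.reg rB)
    (hle : s.field fRank (s.reg rA) ≤ s.field fRank (s.reg rB)) :
    (link n).wp (fun s' => (∃ pend', Work n V
        (fun x => if root x = s.reg rA then s.reg rB else root x) A pend' s') ∧
      charge G W V a s' ≤ charge G W V a s) s := by
  simp only [link, wp_seq]
  refine (wp_detach W a hw hG).call ?_
  rintro s₁ ⟨⟨pend₁, hw₁⟩, hempty, hc₁⟩ fr₁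
  have hreg (q) (h : q ∉ [rX, rXp, rXpp, rTmp, rTail, rG, rI, rN]) : s₁.reg q = s.reg q :=
    fr₁.reg q fun hq => h (mem_of_writesReg_detach hq)
  have hRank : s₁.field fRank = s.field fRank :=
    fr₁.field fRank fun hf => (mem_of_writesField_detach hf).elim (by simp) (by simp)
  have hA₁ := hreg rA (by simp)
  have hB₁ := hreg rB (by simp)
  have hpA := hw₁.forest.par_root _ hA
  have hpB := hw₁.forest.par_root _ hB
  rw [hrA] at hpA
  rw [hrB] at hpB
  refine wp_attach.call ?_
  rintro s₂ ⟨hPar₂, hRank₂, hclk⟩ fr₂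
  rw [hA₁, hB₁] at hPar₂ hRank₂
  have hreg₂ (q) (h : q ∉ [rRankA, rRankB]) : s₂.reg q = s₁.reg q :=
    fr₂.reg q (by simpa [attach] using h)
  refine ⟨⟨pend₁, hw₁.link hA hB hne hpA hpB (hRank ▸ hle) hempty (fun q hq => hreg₂ q ?_)
    hPar₂ hRank₂ fun f hf => fr₂.field f ?_⟩, ?_⟩
  · simp only [List.mem_cons, List.not_mem_nil, or_false]
    omega
  · simp only [attach, WritesField, false_or, or_false]
    omega
  · have := hw₁.forest.potential_link_add_le (W := W) hA hB hne hpA hpB hG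
    rw [charge, hPar₂, hRank₂, hreg₂ rTail (by simp)]
    unfold charge at hc₁ ⊢
    omega

theorem wp_findBoth (W a : ℕ) (hw : Work n V root A pend s) (hG : V.card ≤ tower G)
    (hA : s.reg rA ∈ V) (hB : s.reg rB ∈ V) :
    findBoth.wp (fun s' => Work n V root A pend s' ∧ s'.reg rA = root (s.reg rA) ∧
      s'.reg rB = root (s.reg rB) ∧ charge G W V a s' ≤ charge G W V a s + (12 * G + 20)) s := by
  simp only [findBoth, wp_seq, wp_copy]
  refine (wp_find_work W a (hw.set (by simp) (by simp) (by simp)) hG (by simpa using hA)).call ?_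
  rintro s₁ ⟨hw₁, hX₁, hc₁⟩ fr₁
  have hB₁ : s₁.reg rB = s.reg rB := by
    rw [fr₁.reg rB (by simp [find, halve])]
    simp
  simp only [wp_seq, wp_copy]
  refine (wp_find_work W a ((hw₁.set (by simp) (by simp) (by simp)).set (by simp) (by simp)
    (by simp)) hG (by simpa [hB₁] using hB)).call ?_
  rintro s₂ ⟨hw₂, hX₂, hc₂⟩ fr₂
  have hA₂ : s₂.reg rA = s₁.reg rX := by
    rw [fr₂.reg rA (by simp [find, halve])]
    simp
  rw [wp_copy]
  refine ⟨hw₂.set (by simp) (by simp) (by simp), ?_, ?_, ?_⟩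
  · simpa [hA₂] using hX₁
  · simpa [hB₁] using hX₂
  · simp only [charge_set, ne_eq, Nat.reduceEqDiff, not_false_eq_true] at hc₁ hc₂ ⊢
    omega

theorem wp_orderByRank :
    orderByRank.wp (fun s' => s'.field = s.field ∧
      (s'.reg rA = s.reg rA ∧ s'.reg rB = s.reg rB ∨
        s'.reg rA = s.reg rB ∧ s'.reg rB = s.reg rA) ∧
      s.field fRank (s'.reg rA) ≤ s.field fRank (s'.reg rB) ∧ s'.clk ≤ s.clk + 7) s := by
  simp only [orderByRank, wp_seq, wp_load, wp_ite, wp_copy, wp_skip, Test.Holds]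
  refine ⟨fun hlt => ⟨?_, .inr ?_, ?_, ?_⟩, fun hge => ⟨?_, .inl ?_, ?_, ?_⟩⟩
  case refine_3 => simpa using (show _ < _ by simpa using hlt).le
  case refine_7 => simpa using hge
  all_goals simp

theorem wp_merge (hw : Work n V root A pend s) (hG : V.card ≤ tower G)
    (hW : n * (2 * (6 * G + 9 * n + 14 + a) + 3) + 20 ≤ 6 * W)
    (hA : s.reg rA ∈ V) (hB : s.reg rB ∈ V) :
    (merge n).wp (fun s' => (∃ root' pend', Work n V root' A pend' s' ∧
        Merges root root' (s.reg rA) (s.reg rB)) ∧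
      charge G W V a s' ≤ charge G W V a s + (12 * G + 40)) s := by
  simp only [merge, wp_seq]
  refine (wp_findBoth W a hw hG hA hB).mono ?_
  rintro s₁ ⟨hw₁, hA₁, hB₁, hc₁⟩
  simp only [wp_ite, wp_skip, wp_seq, Test.Holds, hA₁, hB₁]
  refine ⟨fun heq => ⟨⟨root, pend, hw₁.tick, .refl heq⟩, ?_⟩, fun hne => ?_⟩
  · rw [charge_tick]
    omega
  refine wp_orderByRank.call ?_
  rintro s₂ ⟨hfld, hAB, hle, hclk⟩ fr₂
  have hreg (q) (h : q < rX) : s₂.reg q = s₁.reg q :=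
    fr₂.reg q (by simp only [orderByRank, WritesReg, or_false]; omega)
  have hc₂ : charge G W V a s₂ ≤ charge G W V a s₁ + 8 := by
    rw [charge, hfld, hreg rTail (by simp), Store.field_tick]
    unfold charge
    simp only [Store.clk_tick] at hclk
    omega
  have hw₂ : Work n V root A pend s₂ := hw₁.congr (hreg _ (by simp)) (hreg _ (by simp))
    (hreg _ (by simp)) fun f _ _ => by rw [hfld, Store.field_tick]
  have hFA := hw.forest.root_mem _ hA
  have hFB := hw.forest.root_mem _ hB
  have hRA := hw.forest.root_root hA
  have hRB := hw.forest.root_root hB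
  simp only [Store.reg_tick, hA₁, hB₁] at hAB
  refine (wp_link (W := W) (a := a) hw₂ hG hW ?_ ?_ ?_ ?_ ?_ (hfld ▸ hle)).mono ?_
  · rcases hAB with ⟨h, -⟩ | ⟨h, -⟩ <;> rwa [h]
  · rcases hAB with ⟨-, h⟩ | ⟨-, h⟩ <;> rwa [h]
  · rcases hAB with ⟨h, -⟩ | ⟨h, -⟩ <;> rwa [h]
  · rcases hAB with ⟨-, h⟩ | ⟨-, h⟩ <;> rwa [h]
  · rcases hAB with ⟨h, h'⟩ | ⟨h, h'⟩ <;> rw [h, h']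
    exacts [hne, Ne.symm hne]
  · rintro s₃ ⟨⟨pend₃, hw₃⟩, hc₃⟩
    refine ⟨⟨_, pend₃, hw₃.tick, ?_⟩, ?_⟩
    · rcases hAB with ⟨h, h'⟩ | ⟨h, h'⟩ <;> rw [h, h']
      exacts [Merges.of_ite root _ _, (Merges.of_ite root _ _).symm]
    · rw [charge_tick]
      omega

theorem mem_of_writesReg_merge {q : ℕ} (h : (merge n).WritesReg q) :
    q ∈ [rX, rXp, rXpp, rTmp, rTail, rG, rI, rN, rRankA, rRankB, rA, rB, rSwap] := by
  have := @mem_of_writesReg_detach n q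
  simp only [merge, findBoth, orderByRank, link, attach, find, halve, WritesReg] at h
  simp only [List.mem_cons] at this ⊢
  grind

theorem mem_of_writesField_merge {f : ℕ} (h : (merge n).WritesField f) :
    f ∈ [fPar, fRank, fQueue] ∨ fOut ≤ f := by
  have := @mem_of_writesField_detach n f
  simp only [merge, findBoth, orderByRank, link, attach, find, halve, WritesField] at h
  simp only [List.mem_cons] at this ⊢
  grind

end Cmd

end Merge

/-! ### The main loop -/

/-- The storage contains a description of the graph `Γ₀`, whose vertices and edges have the numbers
`vid` and `eid`, and of a list `L` of pairs of its edges, named by `name`. The edges in `A` are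
marked in the field `fAlive`. -/
structure Record {n : ℕ} (Γ₀ : LGraph (Fin n)) (vid : Γ₀.V → ℕ) (eid name : Γ₀.E → ℕ)
    (A : Set Γ₀.E) (L : List (Γ₀.E × Γ₀.E)) (s : Store) : Prop where
  ends : ∀ d e, s.field (fEnd d) (eid e) = vid (cond d (Γ₀.src e) (Γ₀.tgt e))
  lab : ∀ e, s.field fLab (eid e) = Γ₀.label e
  name_eq : ∀ e, s.field fName (eid e) = name e
  alive : ∀ g, s.field fAlive g = 1 ↔ g ∈ eid '' A
  length_eq : s.reg 0 = L.length
  pairs : ∀ k (hk : k < L.length), s.field 1 k = name L[k].1 ∧ s.field 2 k = name L[k].2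

/-- The state of the folding algorithm after the foldings in `L`, when the edges in `A` represent
those of the present graph and the values of `root` its vertices. -/
structure Folding {n : ℕ} (Γ₀ : LGraph (Fin n)) (V : Finset ℕ) (vid : Γ₀.V → ℕ)
    (eid name : Γ₀.E → ℕ) (root : ℕ → ℕ) (A : Set Γ₀.E) (pend : Set ℕ)
    (L : List (Γ₀.E × Γ₀.E)) (s : Store) : Prop where
  work : Work n V root (eid '' A) pend s
  record : Record Γ₀ vid eid name A L s
  folds : Γ₀.FoldsTo (root ∘ vid) A L

section Folding

variable {n : ℕ} {Γ₀ : LGraph (Fin n)} {V : Finset ℕ} {vid : Γ₀.V → ℕ} {eid name : Γ₀.E → ℕ}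
  {root : ℕ → ℕ} {A : Set Γ₀.E} {pend : Set ℕ} {L : List (Γ₀.E × Γ₀.E)} {G W a : ℕ}
  {s s' : Store}

theorem Record.congr (h : Record Γ₀ vid eid name A L s) (hr : s'.reg 0 = s.reg 0)
    (hf : ∀ f ∈ [1, 2, fSrc, fTgt, fLab, fName, fAlive], s'.field f = s.field f) :
    Record Γ₀ vid eid name A L s' := by
  obtain ⟨h₁, h₂, h₃, h₄, h₅, h₆⟩ := h
  have hend (d) : s'.field (fEnd d) = s.field (fEnd d) := by
    cases d <;> exact hf _ (by simp [fEnd])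
  constructor <;> simpa only [hr, hend, hf fLab (by simp), hf fName (by simp),
    hf fAlive (by simp), hf 1 (by simp), hf 2 (by simp)]

theorem Folding.tick (h : Folding Γ₀ V vid eid name root A pend L s) :
    Folding Γ₀ V vid eid name root A pend L s.tick :=
  ⟨h.work.tick, h.record.congr rfl fun _ _ => rfl, h.folds⟩

theorem Record.snoc {e f : Γ₀.E} (h : Record Γ₀ vid eid name A L s)
    (heid : Function.Injective eid)
    (hAlive : s'.field fAlive = Function.update (s.field fAlive) (eid e) 0)
    (hfst : s'.field 1 = Function.update (s.field 1) (s.reg 0) (name e))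
    (hsnd : s'.field 2 = Function.update (s.field 2) (s.reg 0) (name f))
    (hlen : s'.reg 0 = s.reg 0 + 1)
    (hf : ∀ f ∈ [fSrc, fTgt, fLab, fName], s'.field f = s.field f) :
    Record Γ₀ vid eid name (A \ {e}) (L ++ [(e, f)]) s' where
  ends d := by
    rw [show s'.field (fEnd d) = s.field (fEnd d) by cases d <;> exact hf _ (by simp [fEnd])]
    exact h.ends d
  lab := by simpa only [hf fLab (by simp)] using h.lab
  name_eq := by simpa only [hf fName (by simp)] using h.name_eq
  alive g := by
    rw [hAlive, Set.image_sdiff heid, Set.image_singleton]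
    rcases eq_or_ne g (eid e) with rfl | hg
    · simp
    · simp [hg, h.alive]
  length_eq := by simp [hlen, h.length_eq]
  pairs k hk := by
    rw [hfst, hsnd, h.length_eq]
    rcases Nat.lt_succ_iff_lt_or_eq.1 (by simpa using hk) with hlt | rfl
    · simpa [hlt.ne, List.getElem_append_left hlt] using h.pairs k hlt
    · simp

namespace Cmd

/-- Record the pair of the edges `rE` and `rF` and remove the edge `rE`. -/
def record : Cmd :=
  store fAlive rE rZero ;; load rName fName rE ;; store 1 0 rName ;;
  load rName fName rF ;; store 2 0 rName ;; succ 0 0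

/-- Merge the ends `d` of the edges `rE` and `rF`. -/
def mergeEnds (n : ℕ) (d : Bool) : Cmd :=
  load rA (fEnd d) rE ;; load rB (fEnd d) rF ;; merge n

/-- Fold the edge `rE` with the edge `rF`. -/
def fold (n : ℕ) : Cmd :=
  record ;; mergeEnds n true ;; mergeEnds n false

/-- Take the edge `rE` from the queue and find its vertices `rA` and `rB`. -/
def dequeue : Cmd :=
  load rE fQueue rHead ;; succ rHead rHead ;;
  load rA (fEnd true) rE ;; load rB (fEnd false) rE ;; findBoth

/-- Look for an installed edge `rF` with which the edge `rE` can be folded. -/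
def lookup (n : ℕ) : Cmd :=
  load rLab fLab rE ;; loadAt n (fSlot true) rF rLab rA ;;
  ite (.eq rF rZero) (loadAt n (fSlot false) rF rLab rB) skip

/-- Take the edge `rE` from the queue, and look for an edge with which it can be folded. -/
def fetch (n : ℕ) : Cmd :=
  dequeue ;; lookup n

/-- Take an edge from the queue; install it, or fold it with an installed edge. -/
def process (n : ℕ) : Cmd :=
  fetch n ;;
  ite (.eq rF rZero) (storeSlots n rLab (fun d => cond d rA rB) rE) (fold n)

/-- Process edges until the queue is empty. -/
def foldAll (n : ℕ) : Cmd := loopUntil (.eq rHead rTail) (process n)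

theorem wp_record (G W a : ℕ) {B : Set ℕ} {e f : Γ₀.E} (hw : Work n V root B pend s)
    (h : Record Γ₀ vid eid name A L s) (heid : Function.Injective eid) (hE : s.reg rE = eid e)
    (hF : s.reg rF = eid f) :
    record.wp (fun s' => Work n V root B pend s' ∧
      Record Γ₀ vid eid name (A \ {e}) (L ++ [(e, f)]) s' ∧
      charge G W V a s' = charge G W V a s + 6) s := by
  simp only [record, wp_seq, wp_store, wp_load, wp_succ]
  refine ⟨hw.congr ?_ ?_ ?_ fun g h₁ h₂ => ?_, h.snoc heid ?_ ?_ ?_ ?_ fun g hg => ?_, ?_⟩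
  case refine_4 =>
    simp only [Store.field_set]
    rw [Store.field_put_of_ne _ _ _ (by omega), Store.field_set,
      Store.field_put_of_ne _ _ _ (by omega), Store.field_set, Store.field_put_of_ne _ _ _ h₂]
  case refine_9 => fin_cases hg <;> simp [Store.field_put_of_ne]
  case refine_10 => simp [charge_set, charge_put]
  all_goals simp [Store.field_put_of_ne, hE, hF, hw.zero, h.name_eq]

theorem mem_of_writesReg_mergeEnds {d : Bool} {q : ℕ} (h : (mergeEnds n d).WritesReg q) :
    q ∈ [rX, rXp, rXpp, rTmp, rTail, rG, rI, rN, rRankA, rRankB, rA, rB, rSwap] := by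
  rcases h with rfl | rfl | h
  exacts [by simp, by simp, mem_of_writesReg_merge h]

theorem mem_of_writesField_mergeEnds {d : Bool} {f : ℕ} (h : (mergeEnds n d).WritesField f) :
    f ∈ [fPar, fRank, fQueue] ∨ fOut ≤ f := by
  rcases h with h | h | h
  exacts [h.elim, h.elim, mem_of_writesField_merge h]

theorem frame_mergeEnds {d : Bool} (h : Record Γ₀ vid eid name A L s)
    (fr : (mergeEnds n d).Frame s s') :
    Record Γ₀ vid eid name A L s' ∧ s'.reg rE = s.reg rE ∧ s'.reg rF = s.reg rF := by
  refine ⟨h.congr (fr.reg _ fun h => ?_) fun g hg => fr.field _ fun h => ?_,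
    fr.reg _ fun h => ?_, fr.reg _ fun h => ?_⟩
  case refine_2 => fin_cases hg <;> simpa using mem_of_writesField_mergeEnds h
  all_goals simpa using mem_of_writesReg_mergeEnds h

theorem wp_mergeEnds {A : Set ℕ} {d : Bool} (hw : Work n V root A pend s) (hG : V.card ≤ tower G)
    (hW : n * (2 * (6 * G + 9 * n + 14 + a) + 3) + 20 ≤ 6 * W)
    (hE : s.field (fEnd d) (s.reg rE) ∈ V) (hF : s.field (fEnd d) (s.reg rF) ∈ V) :
    (mergeEnds n d).wp (fun s' => (∃ root' pend', Work n V root' A pend' s' ∧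
        Merges root root' (s.field (fEnd d) (s.reg rE)) (s.field (fEnd d) (s.reg rF))) ∧
      charge G W V a s' ≤ charge G W V a s + (12 * G + 42)) s := by
  simp only [mergeEnds, wp_seq, wp_load]
  refine (wp_merge (W := W) (a := a) ((hw.set (by simp) (by simp) (by simp)).set (by simp)
    (by simp) (by simp)) hG hW (by simpa using hE) (by simpa using hF)).mono ?_
  rintro s₁ ⟨⟨root₁, pend₁, hw₁, hm⟩, hc⟩
  refine ⟨⟨root₁, pend₁, hw₁, by simpa using hm⟩, ?_⟩
  simp only [charge_set, ne_eq, Nat.reduceEqDiff, not_false_eq_true] at hc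
  omega

theorem mem_of_writesReg_fold {q : ℕ} (h : (fold n).WritesReg q) :
    q ∈ [0, rName] ∨
      q ∈ [rX, rXp, rXpp, rTmp, rTail, rG, rI, rN, rRankA, rRankB, rA, rB, rSwap] := by
  rcases h with h | h | h
  · simp only [record, WritesReg, false_or] at h
    simp only [List.mem_cons, List.not_mem_nil, or_false]
    omega
  exacts [.inr (mem_of_writesReg_mergeEnds h), .inr (mem_of_writesReg_mergeEnds h)]

theorem wp_fold {e f : Γ₀.E} (hw : Work n V root (eid '' (A \ {e})) pend s)
    (hrec : Record Γ₀ vid eid name A L s) (hfolds : Γ₀.FoldsTo (root ∘ vid) A L)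
    (heid : Function.Injective eid) (hV : ∀ v, vid v ∈ V) (hG : V.card ≤ tower G)
    (hW : n * (2 * (6 * G + 9 * n + 14 + a) + 3) + 20 ≤ 6 * W)
    (hE : s.reg rE = eid e) (hF : s.reg rF = eid f) (hef : e ≠ f) (he : e ∈ A) (hf : f ∈ A)
    (hlab : Γ₀.label e = Γ₀.label f)
    (hinc : root (vid (Γ₀.src e)) = root (vid (Γ₀.src f)) ∨
      root (vid (Γ₀.tgt e)) = root (vid (Γ₀.tgt f))) :
    (fold n).wp (fun s' => (∃ root' pend',
        Folding Γ₀ V vid eid name root' (A \ {e}) pend' (L ++ [(e, f)]) s') ∧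
      charge G W V a s' ≤ charge G W V a s + (24 * G + 90)) s := by
  simp only [fold, wp_seq]
  refine (wp_record G W a hw hrec heid hE hF).call ?_
  rintro s₁ ⟨hw₁, hrec₁, hc₁⟩ fr₁
  have hE₁ : s₁.reg rE = eid e := by rw [fr₁.reg _ (by simp [record]), hE]
  have hF₁ : s₁.reg rF = eid f := by rw [fr₁.reg _ (by simp [record]), hF]
  rw [wp_seq]
  refine (wp_mergeEnds (W := W) (a := a) (d := true) hw₁ hG hW (by rw [hE₁, hrec₁.ends]; exact hV _)
    (by rw [hF₁, hrec₁.ends]; exact hV _)).call ?_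
  rintro s₂ ⟨⟨root₂, pend₂, hw₂, hm₂⟩, hc₂⟩ fr₂
  obtain ⟨hrec₂, hE₂, hF₂⟩ := frame_mergeEnds hrec₁ fr₂
  rw [hE₁, hF₁, hrec₁.ends, hrec₁.ends] at hm₂
  rw [hE₁] at hE₂
  rw [hF₁] at hF₂
  refine (wp_mergeEnds (W := W) (a := a) (d := false) hw₂ hG hW
    (by rw [hE₂, hrec₂.ends]; exact hV _) (by rw [hF₂, hrec₂.ends]; exact hV _)).call ?_
  rintro s₃ ⟨⟨root₃, pend₃, hw₃, hm₃⟩, hc₃⟩ fr₃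
  rw [hE₂, hF₂, hrec₂.ends, hrec₂.ends] at hm₃
  exact ⟨⟨root₃, pend₃, hw₃, (frame_mergeEnds hrec₂ fr₃).1,
    hfolds.fold he hf hef hlab hinc hm₂.comp hm₃.comp⟩, by omega⟩

theorem mem_of_writesReg_lookup {q : ℕ} (h : (lookup n).WritesReg q) : q ∈ [rLab, rTmp, rF] := by
  have := fun b a => @eq_of_writesReg_loadAt n b rF rLab a q
  simp only [lookup, WritesReg] at h
  simp only [List.mem_cons, List.not_mem_nil]
  grind

theorem not_writesField_lookup {f : ℕ} : ¬ (lookup n).WritesField f := by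
  simp [lookup, not_writesField_loadAt]

theorem wp_dequeue {A : Set ℕ} (W a : ℕ) (hw : Work n V root A pend s) (hG : V.card ≤ tower G)
    (hne : s.reg rHead ≠ s.reg rTail) :
    dequeue.wp (fun s' => Work n V root (A \ {s.field fQueue (s.reg rHead)})
        (pend \ {s.field fQueue (s.reg rHead)}) s' ∧
      s'.reg rE = s.field fQueue (s.reg rHead) ∧ s'.reg rHead = s.reg rHead + 1 ∧
      (∀ d, s'.reg (cond d rA rB) = root (s'.field (fEnd d) (s'.reg rE))) ∧
      charge G W V a s' ≤ charge G W V a s + (12 * G + 24)) s := by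
  have hV := (hw.edge _ (hw.pend_subset (hw.queue.head_mem hne))).2.1
  simp only [dequeue, wp_seq, wp_load, wp_succ]
  refine (wp_findBoth W a (hw.pop hne (by simp) (by simp) (by simp) (by simp)) hG
    (by simpa using hV true) (by simpa using hV false)).call ?_
  rintro s₁ ⟨hw₁, hA, hB, hc⟩ fr
  have hE : s₁.reg rE = s.field fQueue (s.reg rHead) := by
    rw [fr.reg _ (by simp [findBoth, find, halve])]
    simp
  have hend (d) : s₁.field (fEnd d) = s.field (fEnd d) := by
    rw [fr.field _ (by cases d <;> simp [fEnd, findBoth, find, halve])]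
    simp
  refine ⟨hw₁, hE, ?_, fun d => ?_, ?_⟩
  · rw [fr.reg _ (by simp [findBoth, find, halve])]
    simp
  · rw [hE, hend]
    cases d
    exacts [by simpa using hB, by simpa using hA]
  · simp only [charge_set, ne_eq, Nat.reduceEqDiff, not_false_eq_true] at hc
    omega

theorem wp_lookup (hlab : s.field fLab (s.reg rE) < n) (hZero : s.reg rZero = 0) :
    (lookup n).wp (fun s' => s'.reg rLab = s.field fLab (s.reg rE) ∧
      (s'.reg rF = 0 → ∀ d, s.field (2 * s.field fLab (s.reg rE) + fSlot d)
        (s.reg (cond d rA rB)) = 0) ∧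
      (s'.reg rF ≠ 0 → ∃ d, s'.reg rF = s.field (2 * s.field fLab (s.reg rE) + fSlot d)
        (s.reg (cond d rA rB))) ∧ s'.clk ≤ s.clk + (6 * n + 3)) s := by
  simp only [lookup, wp_seq, wp_load]
  refine (wp_loadAt (by simpa using hlab) (by simp) (by simp)).call ?_
  rintro s₁ ⟨hF₁, hc₁⟩ fr₁
  have hreg (q) (h : q ≠ rTmp ∧ q ≠ rF ∧ q ≠ rLab) : s₁.reg q = s.reg q := by
    rw [fr₁.reg q fun hq => (eq_of_writesReg_loadAt hq).elim h.1 h.2.1, Store.reg_set, if_neg h.2.2]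
  have hLab : s₁.reg rLab = s.field fLab (s.reg rE) := by
    rw [fr₁.reg _ fun hq => (eq_of_writesReg_loadAt hq).elim (by simp) (by simp)]
    simp
  have hfld : s₁.field = s.field := funext fun f => fr₁.field f not_writesField_loadAt
  simp only [wp_ite, wp_skip, Test.Holds, Store.reg_tick, hreg rZero (by simp), hZero]
  refine ⟨fun h0 => ?_, fun h0 => ⟨hLab, fun h => absurd h h0, fun _ => ⟨true, ?_⟩, ?_⟩⟩
  · refine (wp_loadAt (by simpa [hLab] using hlab) (by simp) (by simp)).call ?_
    rintro s₂ ⟨hF₂, hc₂⟩ fr₂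
    simp only [Store.reg_tick, Store.field_tick, hLab, hfld, hreg rB (by simp)] at hF₂
    refine ⟨?_, fun h => ?_, fun _ => ⟨false, hF₂⟩, ?_⟩
    · rw [fr₂.reg _ fun hq => (eq_of_writesReg_loadAt hq).elim (by simp) (by simp)]
      exact hLab
    · rintro (_ | _)
      exacts [hF₂.symm.trans h, by simpa using hF₁.symm.trans h0]
    · simp only [Store.clk_tick, Store.clk_set] at hc₁ hc₂ ⊢
      omega
  · simpa using hF₁
  · simp only [Store.clk_tick, Store.clk_set] at hc₁ ⊢
    omega

theorem wp_install {A : Set ℕ} {e : ℕ} {p : Bool → ℕ} (G W a : ℕ) (hw : Work n V root A pend s)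
    (hE : s.reg rE = e) (heA : e ∉ A) (he : e ≠ 0) (hend : ∀ d, s.field (fEnd d) e ∈ V)
    (hlab : s.field fLab e < n) (hLab : s.reg rLab = s.field fLab e) (hpt : ∀ d, p d ≠ rTmp)
    (hp : ∀ d, s.reg (p d) = root (s.field (fEnd d) e))
    (hfree : ∀ d, s.field (2 * s.field fLab e + fSlot d) (s.reg (p d)) = 0) :
    (storeSlots n rLab p rE).wp (fun s' => Work n V root (insert e A) pend s' ∧
      charge G W V a s' ≤ charge G W V a s + 6 * n) s := by
  refine (wp_storeSlots (by rwa [hLab]) (by simp) hpt (by simp)).call ?_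
  rintro s₁ ⟨hSlot, hclk⟩ fr
  have hreg (q) (h : q ≠ rTmp) : s₁.reg q = s.reg q :=
    fr.reg q fun hq => h (eq_of_writesReg_storeSlots hq)
  have hfld (f) (h : f < fOut) : s₁.field f = s.field f :=
    fr.field f fun hf => h.not_ge (le_of_writesField_storeSlots hf)
  simp only [hLab, hE, hp] at hSlot hfree
  refine ⟨hw.install heA he hend hlab hfree (hreg _ (by simp)) (hreg _ (by simp))
    (hreg _ (by simp)) hSlot hfld, ?_⟩
  simp only [charge, hfld fPar (by simp), hfld fRank (by simp), hreg rTail (by simp)]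
  omega

/-- The state in which an edge `e`, which has been taken from the queue, is to be installed or
folded: the register `rF` contains an installed edge with which it can be folded, or `0`. -/
structure Fetched (Γ₀ : LGraph (Fin n)) (V : Finset ℕ) (vid : Γ₀.V → ℕ) (eid name : Γ₀.E → ℕ)
    (root : ℕ → ℕ) (A : Set Γ₀.E) (pend : Set ℕ) (L : List (Γ₀.E × Γ₀.E)) (e : Γ₀.E)
    (s : Store) : Prop where
  work : Work n V root (eid '' (A \ {e})) pend s
  record : Record Γ₀ vid eid name A L s
  mem : e ∈ A
  eid_ne_zero : eid e ≠ 0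
  rE_eq : s.reg rE = eid e
  rLab_eq : s.reg rLab = Γ₀.label e
  ends : ∀ d, s.reg (cond d rA rB) = root (vid (cond d (Γ₀.src e) (Γ₀.tgt e)))
  free : s.reg rF = 0 → ∀ d, s.field (2 * Γ₀.label e + fSlot d) (s.reg (cond d rA rB)) = 0
  eq_slot : s.reg rF ≠ 0 →
    ∃ d, s.reg rF = s.field (2 * Γ₀.label e + fSlot d) (s.reg (cond d rA rB))

theorem wp_fetch (W a : ℕ) (h : Folding Γ₀ V vid eid name root A pend L s)
    (heid : Function.Injective eid) (hG : V.card ≤ tower G) (hne : s.reg rHead ≠ s.reg rTail) :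
    (fetch n).wp (fun s' => (∃ e pend',
        Fetched Γ₀ V vid eid name root A pend' L e s') ∧ s'.reg rHead = s.reg rHead + 1 ∧
      charge G W V a s' ≤ charge G W V a s + (12 * G + 6 * n + 27)) s := by
  obtain ⟨e, he, heq⟩ := h.work.pend_subset (h.work.queue.head_mem hne)
  have hedge := h.work.edge _ ⟨e, he, rfl⟩
  simp only [fetch, wp_seq]
  refine (wp_dequeue W a h.work hG hne).call ?_
  rintro s₁ ⟨hw₁, hE₁, hHead₁, hAB₁, hc₁⟩ fr₁
  have hrec₁ : Record Γ₀ vid eid name A L s₁ := h.record.congr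
    (fr₁.reg _ (by simp [dequeue, findBoth, find, halve])) fun f hf => fr₁.field _ (by
      fin_cases hf <;> simp [dequeue, findBoth, find, halve])
  rw [← heq] at hw₁ hE₁
  simp only [hE₁, hrec₁.ends] at hAB₁
  rw [← Set.image_singleton, ← Set.image_sdiff heid] at hw₁
  have hlab₁ : s₁.field fLab (s₁.reg rE) = Γ₀.label e := by rw [hE₁, hrec₁.lab]
  refine (wp_lookup (hlab₁ ▸ (Γ₀.label e).2) hw₁.zero).call ?_
  rintro s₂ ⟨hLab, hfree, hslot, hc₂⟩ fr₂
  have hreg (q) (h : q ∉ [rLab, rTmp, rF]) : s₂.reg q = s₁.reg q :=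
    fr₂.reg q fun hq => h (mem_of_writesReg_lookup hq)
  have hAB (d) : s₂.reg (cond d rA rB) = s₁.reg (cond d rA rB) := by
    cases d <;> exact hreg _ (by simp)
  have hfld : s₂.field = s₁.field := funext fun f => fr₂.field f not_writesField_lookup
  simp only [hlab₁] at hLab hfree hslot
  refine ⟨⟨e, _, hw₁.congr (hreg _ (by simp)) (hreg _ (by simp)) (hreg _ (by simp))
    fun f _ _ => by rw [hfld], hrec₁.congr (hreg _ (by simp)) fun f _ => by rw [hfld], he,
    hedge.1, ?_, hLab, fun d => ?_, fun h => ?_, fun h => ?_⟩, ?_, ?_⟩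
  · rw [hreg _ (by simp), hE₁]
  · rw [hAB, hAB₁]
  · simpa only [hAB, hfld] using hfree h
  · simpa only [hAB, hfld] using hslot h
  · rw [hreg _ (by simp), hHead₁]
  · simp only [charge, hfld, hreg rTail (by simp)] at hc₁ ⊢
    omega

theorem Fetched.exists_edge {e : Γ₀.E} (h : Fetched Γ₀ V vid eid name root A pend L e s)
    (h0 : s.reg rF ≠ 0) : ∃ f ∈ A, s.reg rF = eid f ∧ e ≠ f ∧ Γ₀.label e = Γ₀.label f ∧
      (root (vid (Γ₀.src e)) = root (vid (Γ₀.src f)) ∨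
        root (vid (Γ₀.tgt e)) = root (vid (Γ₀.tgt f))) := by
  obtain ⟨d, hd⟩ := h.eq_slot h0
  obtain ⟨⟨⟨f, ⟨hfA, hfe⟩, hf⟩, -⟩, hlab, hend⟩ :=
    h.work.slots.mem d _ _ (Γ₀.label e).2 (hd ▸ h0)
  rw [← hf] at hd hlab hend
  rw [h.record.lab] at hlab
  rw [h.record.ends, h.ends] at hend
  refine ⟨f, hfA, hd, Ne.symm hfe, Fin.ext hlab.symm, ?_⟩
  cases d
  exacts [.inr hend.symm, .inl hend.symm]

theorem wp_process (h : Folding Γ₀ V vid eid name root A pend L s)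
    (heid : Function.Injective eid) (hV : ∀ v, vid v ∈ V) (hG : V.card ≤ tower G)
    (hW : n * (2 * (6 * G + 9 * n + 14 + a) + 3) + 20 ≤ 6 * W)
    (hne : s.reg rHead ≠ s.reg rTail) :
    (process n).wp (fun s' => (∃ root' A' pend' L',
        Folding Γ₀ V vid eid name root' A' pend' L' s') ∧ s'.reg rHead = s.reg rHead + 1 ∧
      charge G W V a s' ≤ charge G W V a s + (36 * G + 12 * n + 140)) s := by
  simp only [process, wp_seq]
  refine (wp_fetch W a h heid hG hne).mono ?_
  rintro s₂ ⟨⟨e, pend₂, h₂⟩, hHead, hc₂⟩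
  have hend (d) : s₂.field (fEnd d) (eid e) ∈ V := by
    rw [h₂.record.ends]
    exact hV _
  have hlab := h₂.record.lab e
  simp only [wp_ite, Test.Holds, h₂.work.zero]
  refine ⟨fun h0 => ?_, fun h0 => ?_⟩
  · refine (wp_install G W a (p := fun d => cond d rA rB) h₂.work.tick h₂.rE_eq
      (by simp [heid.eq_iff]) h₂.eid_ne_zero hend (hlab ▸ (Γ₀.label e).2)
      (h₂.rLab_eq.trans hlab.symm) (by simp) (fun d => ?_) fun d => ?_).call ?_
    · rw [Store.reg_tick, h₂.ends, Store.field_tick, h₂.record.ends]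
    · rw [Store.reg_tick, Store.field_tick, hlab]
      exact h₂.free h0 d
    · rintro s₃ ⟨hw₃, hc₃⟩ fr₃
      rw [← Set.image_insert_eq, Set.insert_sdiff_singleton, Set.insert_eq_of_mem h₂.mem] at hw₃
      rw [charge_tick] at hc₃
      have hrec₃ : Record Γ₀ vid eid name A L s₃ :=
        h₂.record.congr (fr₃.reg _ fun hq => by simpa using eq_of_writesReg_storeSlots hq)
          fun f hf => fr₃.field _ fun hw => by
            have := le_of_writesField_storeSlots hw
            fin_cases hf <;> simp at this
      refine ⟨⟨root, A, pend₂, L, ⟨hw₃, hrec₃, h.folds⟩⟩, ?_, ?_⟩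
      · rw [fr₃.reg _ fun hq => by simpa using eq_of_writesReg_storeSlots hq]
        exact hHead
      · omega
  · obtain ⟨f, hf, hF, hef, hlab, hinc⟩ := h₂.exists_edge h0
    refine (wp_fold (W := W) (a := a) h₂.work.tick (h₂.record.congr rfl fun _ _ => rfl) h.folds
      heid hV hG hW h₂.rE_eq hF hef h₂.mem hf hlab hinc).call ?_
    rintro s₃ ⟨⟨root₃, pend₃, h₃⟩, hc₃⟩ fr₃
    rw [charge_tick] at hc₃
    refine ⟨⟨root₃, _, pend₃, _, h₃.tick⟩, ?_, ?_⟩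
    · rw [Store.reg_tick, fr₃.reg _ fun hq => by simpa using mem_of_writesReg_fold hq]
      exact hHead
    · rw [charge_tick]
      omega

theorem mem_of_writesReg_foldAll {q : ℕ} (h : (foldAll n).WritesReg q) :
    q ∈ [rHead, rE, rLab, rF, 0, rName] ∨
      q ∈ [rX, rXp, rXpp, rTmp, rTail, rG, rI, rN, rRankA, rRankB, rA, rB, rSwap] := by
  have := @mem_of_writesReg_fold n q
  have := @mem_of_writesReg_lookup n q
  have := @eq_of_writesReg_storeSlots n rLab rE q fun d => cond d rA rB
  simp only [foldAll, process, fetch, dequeue, findBoth, find, halve, WritesReg, List.mem_cons,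
    List.not_mem_nil] at *
  grind

theorem wp_foldAll (h : Folding Γ₀ V vid eid name root A pend L s)
    (heid : Function.Injective eid) (hV : ∀ v, vid v ∈ V) (hG : V.card ≤ tower G)
    (hW : n * (2 * (6 * G + 9 * n + 14 + a) + 3) + 20 ≤ 6 * W)
    (ha : 36 * G + 12 * n + 142 ≤ a) (hHead : s.reg rHead = 0) :
    (foldAll n).wp (fun s' => (∃ root' A' L', Folding Γ₀ V vid eid name root' A' ∅ L' s') ∧
      s'.clk + 6 * potential G W V (s'.field fPar) (s'.field fRank) ≤
        charge G W V a s + 1) s := by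
  refine wp_loopUntil (fun s' => (∃ root' A' pend' L',
    Folding Γ₀ V vid eid name root' A' pend' L' s') ∧
      charge G W V a s' ≤ charge G W V a s + a * s'.reg rHead) (charge G W V a s)
    ⟨⟨root, A, pend, L, h⟩, by simp [hHead]⟩ ?_ ?_ ?_
  · rintro s₁ ⟨⟨root₁, A₁, pend₁, L₁, h₁⟩, hc₁⟩
    have := Nat.mul_le_mul_left a h₁.work.queue.le
    unfold charge at hc₁ ⊢
    omega
  · rintro s₁ ⟨⟨root₁, A₁, pend₁, L₁, h₁⟩, hc₁⟩ heq
    have hpend : pend₁ = ∅ := by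
      have := h₁.work.queue.bijOn.image_eq
      rwa [show s₁.reg rHead = _ from heq, Set.Ico_self, Set.image_empty, eq_comm] at this
    subst hpend
    refine ⟨⟨root₁, A₁, L₁, h₁.tick⟩, ?_⟩
    rw [Test.Holds] at heq
    simp only [charge, heq] at hc₁ ⊢
    simp only [Store.clk_tick, Store.field_tick]
    omega
  · rintro s₁ ⟨⟨root₁, A₁, pend₁, L₁, h₁⟩, hc₁⟩ hne
    refine (wp_process h₁.tick heid hV hG hW hne).mono ?_
    rintro s₂ ⟨⟨root₂, A₂, pend₂, L₂, h₂⟩, hHead₂, hc₂⟩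
    refine ⟨⟨root₂, A₂, pend₂, L₂, h₂.tick⟩, ?_⟩
    rw [charge_tick] at hc₂ ⊢
    rw [Store.reg_tick, hHead₂, Store.reg_tick, Nat.mul_add]
    omega

end Cmd

end Folding

/-! ### Output -/

/-- The elements of `S` below `i` are numbered by `num` with the numbers below `m`. -/
def Numbers (S : Set ℕ) (num : ℕ → ℕ) (i m : ℕ) : Prop :=
  Set.BijOn num (Set.Iio i ∩ S) (Set.Iio m)

namespace Numbers

variable {S : Set ℕ} {num : ℕ → ℕ} {i m : ℕ}

theorem zero (S : Set ℕ) (num : ℕ → ℕ) : Numbers S num 0 0 := by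
  simp [Numbers]

theorem skip (h : Numbers S num i m) (hi : i ∉ S) : Numbers S num (i + 1) m := by
  rwa [Numbers, ← Order.succ_eq_add_one, Order.Iio_succ_eq_insert, Set.insert_inter_of_notMem hi]

theorem snoc (h : Numbers S num i m) (hi : i ∈ S) :
    Numbers S (Function.update num i m) (i + 1) (m + 1) := by
  have heq : Set.EqOn num (Function.update num i m) (Set.Iio i ∩ S) := fun v hv =>
    (Function.update_of_ne (ne_of_lt hv.1) _ _).symm
  rw [Numbers, ← Order.succ_eq_add_one, ← Order.succ_eq_add_one, Order.Iio_succ_eq_insert,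
    Order.Iio_succ_eq_insert, Set.insert_inter_of_mem hi]
  simpa using (h.congr heq).insert (a := i) (by simp)

end Numbers

/-- The edges `e < i` that are marked in the storage `s` have been written to the fields `3`, `4`
and `5` of `s'`, at the places `idx e`; the end with the number `v` is written as
`num (root v)`. -/
structure EdgesWritten (root num : ℕ → ℕ) (s : Store) (i : ℕ) (idx : ℕ → ℕ) (s' : Store) :
    Prop where
  numbers : Numbers {e | s.field fAlive e = 1} idx i (s'.reg 2)
  entries : ∀ e < i, s.field fAlive e = 1 →
    s'.field 3 (idx e) = num (root (s.field fSrc e)) ∧ s'.field 4 (idx e) = s.field fLab e ∧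
      s'.field 5 (idx e) = num (root (s.field fTgt e))

namespace EdgesWritten

variable {root num idx : ℕ → ℕ} {i : ℕ} {s s₁ s₂ : Store}

theorem congr (h : EdgesWritten root num s i idx s₁) (h2 : s₂.reg 2 = s₁.reg 2)
    (hf : ∀ f ∈ [3, 4, 5], s₂.field f = s₁.field f) : EdgesWritten root num s i idx s₂ := by
  obtain ⟨hn, he⟩ := h
  constructor <;> simpa only [h2, hf 3 (by simp), hf 4 (by simp), hf 5 (by simp)]

theorem skip (h : EdgesWritten root num s i idx s₁) (hi : s.field fAlive i ≠ 1) :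
    EdgesWritten root num s (i + 1) idx s₁ :=
  ⟨h.numbers.skip hi, fun e he halive =>
    h.entries e (Nat.lt_of_le_of_ne (Nat.lt_succ_iff.1 he) (by grind)) halive⟩

theorem snoc (h : EdgesWritten root num s i idx s₁) (hi : s.field fAlive i = 1)
    (hcount : s₂.reg 2 = s₁.reg 2 + 1)
    (hsrc : s₂.field 3 = Function.update (s₁.field 3) (s₁.reg 2) (num (root (s.field fSrc i))))
    (hlab : s₂.field 4 = Function.update (s₁.field 4) (s₁.reg 2) (s.field fLab i))
    (htgt : s₂.field 5 = Function.update (s₁.field 5) (s₁.reg 2) (num (root (s.field fTgt i)))) :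
    EdgesWritten root num s (i + 1) (Function.update idx i (s₁.reg 2)) s₂ := by
  refine ⟨hcount ▸ h.numbers.snoc hi, fun e he halive => ?_⟩
  rw [hsrc, hlab, htgt]
  rcases Nat.lt_succ_iff_lt_or_eq.1 he with he | rfl
  · have hlt : idx e < s₁.reg 2 := h.numbers.mapsTo ⟨he, halive⟩
    simpa only [Function.update_of_ne he.ne, Function.update_of_ne hlt.ne] using
      h.entries e he halive
  · simp

end EdgesWritten

namespace Cmd

/-- Number the roots among the vertices up to `rPos`. -/
def numberVertices : Cmd :=
  const 1 0 ;; const rI 0 ;; succ rEnd rPos ;;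
  loopUntil (.eq rI rEnd)
    (load rXp fPar rI ;; ite (.eq rXp rI) (store fNum rI 1 ;; succ 1 1) skip ;; succ rI rI)

theorem wp_numberVertices (s : Store) :
    numberVertices.wp (fun s' =>
      Numbers {v | s.field fPar v = v} (s'.field fNum) (s.reg rPos + 1) (s'.reg 1) ∧
      s'.reg rEnd = s.reg rPos + 1 ∧ s'.clk ≤ s.clk + (8 * (s.reg rPos + 1) + 4)) s := by
  simp only [numberVertices, wp_seq, wp_const, wp_succ]
  refine wp_loopUntil (fun s₁ => s₁.reg rI ≤ s.reg rPos + 1 ∧ s₁.reg rEnd = s.reg rPos + 1 ∧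
    s₁.field fPar = s.field fPar ∧
    Numbers {v | s.field fPar v = v} (s₁.field fNum) (s₁.reg rI) (s₁.reg 1) ∧
    s₁.clk ≤ s.clk + (8 * s₁.reg rI + 3)) (s.clk + (8 * (s.reg rPos + 1) + 3)) ?_ ?_ ?_ ?_
  · simpa using Numbers.zero _ _
  · rintro s₁ ⟨hle, -, -, -, hc⟩
    omega
  · rintro s₁ ⟨-, hend, -, hnum, hc⟩ heq
    rw [Test.Holds, hend] at heq
    rw [heq] at hnum hc
    refine ⟨hnum, hend, ?_⟩
    simp only [Store.clk_tick]
    omega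
  · rintro s₁ ⟨hle, hend, hPar, hnum, hc⟩ hne
    rw [Test.Holds, hend] at hne
    simp only [wp_seq, wp_load, wp_ite, wp_store, wp_succ, wp_skip, Test.Holds]
    refine ⟨fun hroot => ?_, fun hroot => ?_⟩
    · have hroot' : s.field fPar (s₁.reg rI) = s₁.reg rI := by simpa [hPar] using hroot
      refine ⟨?_, by simpa using hend, by simpa using hPar, by simpa using hnum.snoc hroot', ?_⟩
      · simp
        omega
      · simp
        omega
    · have hroot' : s.field fPar (s₁.reg rI) ≠ s₁.reg rI := by simpa [hPar] using hroot
      refine ⟨?_, by simpa using hend, by simpa using hPar, by simpa using hnum.skip hroot', ?_⟩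
      · simp
        omega
      · simp
        omega

/-- Write the number of the end of the edge `rI` in the field `f` to the output field `g`. -/
def writeEnd (f g : ℕ) : Cmd :=
  load rX f rI ;; find ;; load rF fNum rX ;; store g 2 rF

theorem mem_of_writesReg_writeEnd {f g q : ℕ} (h : (writeEnd f g).WritesReg q) :
    q ∈ [rF, rX, rXp, rXpp] := by
  simp only [writeEnd, find, halve, WritesReg] at h
  simp only [List.mem_cons, List.not_mem_nil]
  grind

theorem mem_of_writesField_writeEnd {f g p : ℕ} (h : (writeEnd f g).WritesField p) :
    p ∈ [g, fPar] := by
  simp only [writeEnd, find, halve, WritesField] at h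
  simp only [List.mem_cons, List.not_mem_nil]
  grind

/-- Write the edge `rI` to the output. -/
def writeEdge : Cmd :=
  writeEnd fSrc 3 ;; writeEnd fTgt 5 ;; load rF fLab rI ;; store 4 2 rF ;; succ 2 2

section

variable {V : Finset ℕ} {root : ℕ → ℕ} {G W : ℕ} {s s₀ : Store}

theorem wp_writeEnd {f g : ℕ} (hg : g < fPar)
    (hF : Forest V root (s.field fPar) (s.field fRank)) (hG : V.card ≤ tower G)
    (hend : s.field f (s.reg rI) ∈ V) :
    (writeEnd f g).wp (fun s' => Forest V root (s'.field fPar) (s'.field fRank) ∧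
      s'.field g = Function.update (s.field g) (s.reg 2)
        (s.field fNum (root (s.field f (s.reg rI)))) ∧
      s'.clk + 6 * potential G W V (s'.field fPar) (s'.field fRank) ≤
        s.clk + 6 * potential G W V (s.field fPar) (s.field fRank) + (6 * G + 11)) s := by
  simp only [writeEnd, wp_seq, wp_load]
  refine (wp_find (W := W) (s := s.set rX _) hF hG (by simpa using hend)).call ?_
  rintro s₁ ⟨hX, -, hF₁, hc⟩ fr
  have h2 : s₁.reg 2 = s.reg 2 := by simp [fr.reg 2 (by simp [find, halve])]
  have hNum : s₁.field fNum = s.field fNum := fr.field _ (by simp [find, halve])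
  have hg₁ : s₁.field g = s.field g := fr.field _ (by simp [find, halve, hg.ne])
  have hPar : fPar ≠ g := hg.ne'
  have hRank : fRank ≠ g := (hg.trans (by simp)).ne'
  simp only [Store.reg_set, if_true] at hX
  simp only [wp_seq, wp_load, wp_store]
  refine ⟨by simpa [hPar, hRank] using hF₁, by simp [hX, h2, hNum, hg₁], ?_⟩
  simp only [Store.clk_put, Store.clk_set, Store.field_set, Store.field_put_of_ne _ _ _ hPar,
    Store.field_put_of_ne _ _ _ hRank] at hc ⊢
  omega

theorem wp_writeEdge (hF : Forest V root (s.field fPar) (s.field fRank)) (hG : V.card ≤ tower G)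
    (hsrc : s.field fSrc (s.reg rI) ∈ V) (htgt : s.field fTgt (s.reg rI) ∈ V) :
    writeEdge.wp (fun s' => Forest V root (s'.field fPar) (s'.field fRank) ∧
      s'.reg 2 = s.reg 2 + 1 ∧
      s'.field 3 = Function.update (s.field 3) (s.reg 2)
        (s.field fNum (root (s.field fSrc (s.reg rI)))) ∧
      s'.field 4 = Function.update (s.field 4) (s.reg 2) (s.field fLab (s.reg rI)) ∧
      s'.field 5 = Function.update (s.field 5) (s.reg 2)
        (s.field fNum (root (s.field fTgt (s.reg rI)))) ∧
      s'.clk + 6 * potential G W V (s'.field fPar) (s'.field fRank) ≤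
        s.clk + 6 * potential G W V (s.field fPar) (s.field fRank) + (12 * G + 25)) s := by
  simp only [writeEdge, wp_seq]
  refine (wp_writeEnd (W := W) (by simp) hF hG hsrc).call ?_
  rintro s₁ ⟨hF₁, h3₁, hc₁⟩ fr₁
  simp only [wp_seq]
  have hr₁ (q) (h : q ∉ [rF, rX, rXp, rXpp]) : s₁.reg q = s.reg q :=
    fr₁.reg q (mt mem_of_writesReg_writeEnd h)
  have hf₁ (f) (h : f ∉ [3, fPar]) : s₁.field f = s.field f :=
    fr₁.field f (mt mem_of_writesField_writeEnd h)
  have hI₁ : s₁.reg rI = s.reg rI := hr₁ _ (by simp)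
  have h2₁ : s₁.reg 2 = s.reg 2 := hr₁ _ (by simp)
  refine (wp_writeEnd (W := W) (by simp) hF₁ hG
    (by rwa [hf₁ _ (by simp), hI₁])).call ?_
  rintro s₂ ⟨hF₂, h5₂, hc₂⟩ fr₂
  simp only [wp_seq, wp_load, wp_store, wp_succ]
  have hr₂ (q) (h : q ∉ [rF, rX, rXp, rXpp]) : s₂.reg q = s₁.reg q :=
    fr₂.reg q (mt mem_of_writesReg_writeEnd h)
  have hf₂ (f) (h : f ∉ [5, fPar]) : s₂.field f = s₁.field f :=
    fr₂.field f (mt mem_of_writesField_writeEnd h)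
  have hI₂ : s₂.reg rI = s.reg rI := (hr₂ _ (by simp)).trans hI₁
  have h2₂ : s₂.reg 2 = s.reg 2 := (hr₂ _ (by simp)).trans h2₁
  rw [hI₁, h2₁, hf₁ fNum (by simp), hf₁ fTgt (by simp), hf₁ 5 (by simp)] at h5₂
  refine ⟨by simpa using hF₂, by simp [h2₂], ?_, ?_, by simpa using h5₂, ?_⟩
  · simpa [hf₂] using h3₁
  · simp [h2₂, hI₂, hf₂, hf₁]
  · simp only [Store.clk_set, Store.clk_put, Store.field_set, ne_eq, Nat.reduceEqDiff,
      not_false_eq_true, Store.field_put_of_ne] at hc₁ hc₂ ⊢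
    omega

theorem mem_of_writesReg_writeEdge {q : ℕ} (h : writeEdge.WritesReg q) :
    q ∈ [2, rF, rX, rXp, rXpp] := by
  have := @mem_of_writesReg_writeEnd fSrc 3 q
  have := @mem_of_writesReg_writeEnd fTgt 5 q
  simp only [writeEdge, WritesReg, List.mem_cons, List.not_mem_nil] at *
  grind

/-- Write the marked edges with numbers below `rEnd` to the output. -/
def numberEdges : Cmd :=
  const 2 0 ;; const rI 0 ;;
  loopUntil (.eq rI rEnd) (load rF fAlive rI ;; ite (.eq rF rOne) writeEdge skip ;; succ rI rI)

theorem mem_of_writesReg_numberEdges {q : ℕ} (h : numberEdges.WritesReg q) :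
    q ∈ [2, rF, rI, rX, rXp, rXpp] := by
  have := @mem_of_writesReg_writeEdge q
  simp only [numberEdges, WritesReg, List.mem_cons, List.not_mem_nil] at *
  grind

/-- The invariant of the loop in `numberEdges`, which has been started in the storage `s₀`; before
the bound `B` is reached, there remain `rEnd - rI` passages. -/
structure WritingEdges (V : Finset ℕ) (root : ℕ → ℕ) (G W B : ℕ) (s₀ s : Store) : Prop where
  forest : Forest V root (s.field fPar) (s.field fRank)
  one : s.reg rOne = 1
  end_eq : s.reg rEnd = s₀.reg rEnd
  le : s.reg rI ≤ s₀.reg rEnd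
  field_eq : ∀ f ∈ [fSrc, fTgt, fLab, fAlive, fNum], s.field f = s₀.field f
  written : ∃ idx, EdgesWritten root (s₀.field fNum) s₀ (s.reg rI) idx s
  clk_le : s.clk + 6 * potential G W V (s.field fPar) (s.field fRank) ≤
    B + s.reg rI * (12 * G + 32)

theorem wp_numberEdge {B : ℕ} (h : WritingEdges V root G W B s₀ s) (hG : V.card ≤ tower G)
    (hV : ∀ e, s₀.field fAlive e = 1 → s₀.field fSrc e ∈ V ∧ s₀.field fTgt e ∈ V)
    (hne : s.reg rI ≠ s.reg rEnd) :
    (load rF fAlive rI ;; ite (.eq rF rOne) writeEdge skip ;; succ rI rI).wp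
      (fun s' => WritingEdges V root G W B s₀ s'.tick) s.tick := by
  obtain ⟨hF, hone, hend, hle, hfld, ⟨idx, hidx⟩, hc⟩ := h
  have hlt : s.reg rI + 1 ≤ s₀.reg rEnd := by omega
  have hSrc := hfld fSrc (by simp)
  have hTgt := hfld fTgt (by simp)
  have hAlive := hfld fAlive (by simp)
  simp only [wp_seq, wp_load, wp_ite, wp_succ, wp_skip, Test.Holds]
  refine ⟨fun halive => ?_, fun halive => ?_⟩
  · have halive' : s₀.field fAlive (s.reg rI) = 1 := by simpa [hAlive, hone] using halive
    obtain ⟨hsrc, htgt⟩ := hV _ halive'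
    refine (wp_writeEdge (W := W) (by simpa using hF) hG (by simpa [hSrc] using hsrc)
      (by simpa [hTgt] using htgt)).call ?_
    rintro s₁ ⟨hF₁, h2, h3, h4, h5, hc₁⟩ fr
    simp only [wp_succ]
    have hr (q) (h : q ∉ [2, rF, rX, rXp, rXpp]) : s₁.reg q = s.reg q := by
      rw [fr.reg q (mt mem_of_writesReg_writeEdge h)]
      simp only [List.mem_cons, not_or] at h
      simp [h]
    have hI : s₁.reg rI = s.reg rI := hr _ (by simp)
    simp only [Store.field_tick, Store.field_set, Store.reg_tick, Store.reg_set, Nat.reduceEqDiff,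
      if_false, hSrc, hTgt, hfld fNum (by simp), hfld fLab (by simp)] at h2 h3 h4 h5
    refine ⟨by simpa using hF₁, by simpa [hr] using hone, by simpa [hr] using hend,
      by simpa [hI] using hlt, fun f hf => ?_, ⟨Function.update idx (s.reg rI) (s.reg 2), ?_⟩, ?_⟩
    · exact (fr.field f (by fin_cases hf <;> simp [writeEdge, writeEnd, find, halve])).trans
        (hfld f hf)
    · refine EdgesWritten.congr (s₁ := s₁) ?_ (by simp) fun _ _ => rfl
      simpa [hI] using hidx.snoc halive' h2 h3 h4 h5
    · simp only [Store.clk_tick, Store.clk_set, Store.field_tick, Store.field_set, Store.reg_tick,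
        Store.reg_set, if_true, hI, Nat.add_mul] at hc₁ ⊢
      omega
  · have halive' : s₀.field fAlive (s.reg rI) ≠ 1 := by simpa [hAlive, hone] using halive
    refine ⟨by simpa using hF, by simpa using hone, by simpa using hend, by simpa using hlt,
      hfld, ⟨idx, ?_⟩, ?_⟩
    · refine EdgesWritten.congr (s₁ := s) ?_ (by simp) fun _ _ => rfl
      simpa using hidx.skip halive'
    · simp only [Store.clk_tick, Store.clk_set, Store.field_tick, Store.field_set, Store.reg_tick,
        Store.reg_set, if_true, if_false, Nat.reduceEqDiff, Nat.add_mul]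
      omega

theorem wp_numberEdges (hF : Forest V root (s.field fPar) (s.field fRank))
    (hG : V.card ≤ tower G) (hone : s.reg rOne = 1)
    (hV : ∀ e, s.field fAlive e = 1 → s.field fSrc e ∈ V ∧ s.field fTgt e ∈ V) :
    numberEdges.wp (fun s' =>
      (∃ idx, EdgesWritten root (s.field fNum) s (s.reg rEnd) idx s') ∧
      s'.clk ≤ s.clk + 6 * potential G W V (s.field fPar) (s.field fRank) +
        (s.reg rEnd * (12 * G + 32) + 3)) s := by
  simp only [numberEdges, wp_seq, wp_const]
  have hbound {B : ℕ} {s' : Store} (h : WritingEdges V root G W B s s') :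
      s'.clk ≤ B + s.reg rEnd * (12 * G + 32) :=
    (Nat.le_add_right _ _).trans <| h.clk_le.trans <|
      Nat.add_le_add_left (Nat.mul_le_mul_right _ h.le) _
  refine wp_loopUntil (WritingEdges V root G W
    (s.clk + 6 * potential G W V (s.field fPar) (s.field fRank) + 2) s) _ ?_
    (fun s' h => hbound h) (fun s' h heq => ?_)
    (fun s' h hne => wp_numberEdge h hG hV hne)
  · refine ⟨hF, by simpa, by simp, by simp, fun _ _ => rfl,
      ⟨id, by simpa using Numbers.zero _ _, by simp⟩, ?_⟩
    simp only [Store.clk_set, Store.field_set]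
    omega
  · obtain ⟨idx, hidx⟩ := h.written
    rw [show s'.reg rI = s.reg rEnd from Eq.trans heq h.end_eq] at hidx
    refine ⟨⟨idx, hidx.congr rfl fun _ _ => rfl⟩, ?_⟩
    have := hbound h
    simp only [Store.clk_tick]
    omega

/-- Write the number of the vertex `0`, which is the base vertex, to the output. -/
def writeBase : Cmd := const rX 0 ;; find ;; load 3 fNum rX

theorem wp_writeBase (hF : Forest V root (s.field fPar) (s.field fRank)) (hG : V.card ≤ tower G)
    (h0 : 0 ∈ V) :
    writeBase.wp (fun s' => s'.reg 3 = s.field fNum (root 0) ∧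
      Forest V root (s'.field fPar) (s'.field fRank) ∧
      s'.clk + 6 * potential G W V (s'.field fPar) (s'.field fRank) ≤
        s.clk + 6 * potential G W V (s.field fPar) (s.field fRank) + (6 * G + 10)) s := by
  simp only [writeBase, wp_seq, wp_const]
  refine (wp_find (W := W) (s := s.set rX 0) hF hG (by simpa using h0)).call ?_
  rintro s₁ ⟨hX, -, hF₁, hc⟩ fr
  have hNum : s₁.field fNum = s.field fNum := fr.field _ (by simp [find, halve])
  simp only [Store.reg_set, if_true] at hX
  simp only [wp_load]
  refine ⟨by simp [hX, hNum], by simpa using hF₁, ?_⟩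
  simp only [Store.clk_set, Store.field_set] at hc ⊢
  omega

/-- Write the folded graph to the output. -/
def output : Cmd := numberVertices ;; writeBase ;; numberEdges

theorem mem_of_writesReg_output {q : ℕ} (h : output.WritesReg q) :
    q ∈ [1, 2, 3, rEnd, rF, rI, rX, rXp, rXpp] := by
  have := @mem_of_writesReg_numberEdges q
  simp only [output, numberVertices, writeBase, find, halve, WritesReg, List.mem_cons,
    List.not_mem_nil] at *
  grind

theorem mem_of_writesField_output {f : ℕ} (h : output.WritesField f) :
    f ∈ [3, 4, 5, fPar, fNum] := by
  have := @mem_of_writesField_writeEnd fSrc 3 f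
  have := @mem_of_writesField_writeEnd fTgt 5 f
  simp only [output, numberVertices, writeBase, numberEdges, writeEdge, find, halve,
    WritesField, List.mem_cons, List.not_mem_nil] at *
  grind

theorem wp_output (hF : Forest V root (s.field fPar) (s.field fRank)) (hG : V.card ≤ tower G)
    (hone : s.reg rOne = 1) (h0 : 0 ∈ V)
    (hV : ∀ e, s.field fAlive e = 1 → s.field fSrc e ∈ V ∧ s.field fTgt e ∈ V) :
    output.wp (fun s' => (∃ num idx,
        Numbers {v | s.field fPar v = v} num (s.reg rPos + 1) (s'.reg 1) ∧
        s'.reg 3 = num (root 0) ∧ EdgesWritten root num s (s.reg rPos + 1) idx s') ∧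
      s'.clk ≤ s.clk + 6 * potential G W V (s.field fPar) (s.field fRank) +
        (s.reg rPos + 1) * (18 * G + 60)) s := by
  simp only [output, wp_seq]
  refine (wp_numberVertices s).call ?_
  rintro s₁ ⟨hnum, hEnd, hc₁⟩ fr₁
  rw [wp_seq]
  have hf₁ (f) (h : f ≠ fNum) : s₁.field f = s.field f :=
    fr₁.field f (by simpa [numberVertices] using h)
  rw [← hf₁ fPar (by simp), ← hf₁ fRank (by simp)] at hF
  refine (wp_writeBase (W := W) hF hG h0).call ?_
  rintro s₂ ⟨hbase, hF₂, hc₂⟩ fr₂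
  have hr₂ (q) (h : q ∉ [3, rX, rXp, rXpp]) : s₂.reg q = s₁.reg q :=
    fr₂.reg q (by simp only [List.mem_cons, not_or] at h; simp [writeBase, find, halve, h])
  have hf₂ (f) (h : f ≠ fPar) : s₂.field f = s₁.field f :=
    fr₂.field f (by simpa [writeBase, find, halve] using h)
  have hone₂ : s₂.reg rOne = 1 := by
    rw [hr₂ _ (by simp), fr₁.reg _ (by simp [numberVertices]), hone]
  have hEnd₂ : s₂.reg rEnd = s.reg rPos + 1 := (hr₂ _ (by simp)).trans hEnd
  have hfld (f) (h : f ∈ [fSrc, fTgt, fLab, fAlive]) : s₂.field f = s.field f :=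
    (hf₂ f (by fin_cases h <;> simp)).trans (hf₁ f (by fin_cases h <;> simp))
  refine (wp_numberEdges (W := W) hF₂ hG hone₂ (by simpa [hfld] using hV)).call ?_
  rintro s₃ ⟨⟨idx, hidx, hst⟩, hc₃⟩ fr₃
  have hr₃ (q) (h : q ∉ [2, rF, rI, rX, rXp, rXpp]) : s₃.reg q = s₂.reg q :=
    fr₃.reg q (mt mem_of_writesReg_numberEdges h)
  simp only [hEnd₂, hfld fAlive (by simp), hfld fSrc (by simp), hfld fTgt (by simp),
    hfld fLab (by simp), hf₂ fNum (by simp)] at hidx hst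
  refine ⟨⟨s₁.field fNum, idx, ?_, ?_, hidx, hst⟩, ?_⟩
  · rwa [hr₃ _ (by simp), hr₂ _ (by simp)]
  · rw [hr₃ _ (by simp), hbase]
  · have : (s.reg rPos + 1) * (18 * G + 60) = (s.reg rPos + 1) * (12 * G + 32) +
      8 * (s.reg rPos + 1) + (s.reg rPos * (6 * G + 20) + (6 * G + 20)) := by ring
    rw [hf₁ fPar (by simp), hf₁ fRank (by simp)] at hc₂
    rw [hEnd₂] at hc₃
    omega

end

end Cmd

/-! ### Reading the input -/

theorem two_le_letterCode {n : ℕ} (a : Fin n × Bool) : 2 ≤ letterCode a := by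
  unfold letterCode
  split_ifs <;> omega

theorem letterCode_injective (n : ℕ) : Function.Injective (letterCode (n := n)) := by
  rintro ⟨⟨x, hx⟩, b⟩ ⟨⟨y, hy⟩, b'⟩ h
  cases b <;> cases b' <;> simp [letterCode] at h ⊢ <;> omega

/-- The vertex reached after the letter at the place `p` of the string `S`; it has the number `0`
if the word ends there. -/
def nextVertex (S : ℕ → ℕ) (p : ℕ) : ℕ := if 2 ≤ S p ∧ S (p + 1) ≠ 1 then p + 1 else 0

/-- The vertex in which the letter at the place `p` of the string `S` is read. -/
def curVertex (S : ℕ → ℕ) : ℕ → ℕ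
  | 0 => 0
  | p + 1 => nextVertex S p

/-- The vertices visited while the first `p` letters of the string `S` are read. -/
def visited (S : ℕ → ℕ) (p : ℕ) : Set ℕ := insert 0 (nextVertex S '' Set.Iio p)

/-- The numbers of the edges for the first `p` places of the string `S`; end marks give no edge. -/
def edgesRead (S : ℕ → ℕ) (p : ℕ) : Set ℕ := Nat.succ '' {i | i < p ∧ 2 ≤ S i}

section Read

variable {n : ℕ} {S : ℕ → ℕ} {p k : ℕ}

theorem visited_succ (S : ℕ → ℕ) (p : ℕ) :
    visited S (p + 1) = insert (nextVertex S p) (visited S p) := by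
  rw [visited, visited, ← Order.succ_eq_add_one, Order.Iio_succ_eq_insert, Set.image_insert_eq,
    Set.insert_comm]

theorem visited_succ_of_eq_zero (h : nextVertex S p = 0) : visited S (p + 1) = visited S p := by
  rw [visited_succ, h]
  exact Set.insert_eq_of_mem (Set.mem_insert _ _)

theorem edgesRead_succ (h : 2 ≤ S p) : edgesRead S (p + 1) = insert (p + 1) (edgesRead S p) := by
  rw [edgesRead, edgesRead, ← Nat.succ_eq_add_one, ← Set.image_insert_eq]
  congr 1
  grind

theorem edgesRead_succ_of_lt (h : S p < 2) : edgesRead S (p + 1) = edgesRead S p := by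
  rw [edgesRead, edgesRead]
  congr 1
  grind

theorem succ_notMem_edgesRead : p + 1 ∉ edgesRead S p := by
  simp [edgesRead]

/-- The fields `φ` after the first `p` letters of the string `S` have been read, which gave `k`
edges: all edges are in the queue, and each vertex is a root. -/
structure HasRead (n : ℕ) (S : ℕ → ℕ) (p : ℕ) (φ : ℕ → ℕ → ℕ) (k : ℕ) : Prop where
  input : φ 0 = S
  par : ∀ v, φ fPar v = v ↔ v ∈ visited S p
  alive : ∀ e, φ fAlive e = 1 ↔ e ∈ edgesRead S p
  edge : ∀ i < p, ∀ a : Fin n × Bool, S i = letterCode a →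
    φ fName (i + 1) = i ∧ φ fLab (i + 1) = a.1 ∧
    φ fSrc (i + 1) = (if a.2 then curVertex S i else nextVertex S i) ∧
    φ fTgt (i + 1) = (if a.2 then nextVertex S i else curVertex S i)
  queue : Queue (φ fQueue) 0 k (edgesRead S p)
  count_le : k ≤ p
  rank : ∀ v, φ fRank v = 0
  slot : ∀ f v, fOut ≤ f → φ f v = 0

namespace HasRead

variable {φ φ' : ℕ → ℕ → ℕ}

theorem mark (h : HasRead n S p φ k) (hS : S p = 1) : HasRead n S (p + 1) φ k where
  input := h.input
  par := by rw [visited_succ_of_eq_zero (by simp [nextVertex, hS])]; exact h.par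
  alive := by rw [edgesRead_succ_of_lt (by omega)]; exact h.alive
  edge i hi a ha := by
    refine h.edge i (Nat.lt_of_le_of_ne (Nat.lt_succ_iff.1 hi) ?_) a ha
    rintro rfl
    have := two_le_letterCode a
    omega
  queue := by rw [edgesRead_succ_of_lt (by omega)]; exact h.queue
  count_le := h.count_le.trans p.le_succ
  rank := h.rank
  slot := h.slot

theorem letter (h : HasRead n S p φ k) {a : Fin n × Bool} (ha : S p = letterCode a)
    (hin : φ' 0 = φ 0) (hpar : ∀ v, φ' fPar v = v ↔ v ∈ visited S (p + 1))
    (hsrc : φ' fSrc = Function.update (φ fSrc) (p + 1)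
      (if a.2 then curVertex S p else nextVertex S p))
    (htgt : φ' fTgt = Function.update (φ fTgt) (p + 1)
      (if a.2 then nextVertex S p else curVertex S p))
    (hlab : φ' fLab = Function.update (φ fLab) (p + 1) a.1)
    (hname : φ' fName = Function.update (φ fName) (p + 1) p)
    (halive : φ' fAlive = Function.update (φ fAlive) (p + 1) 1)
    (hqueue : φ' fQueue = Function.update (φ fQueue) k (p + 1))
    (hrank : φ' fRank = φ fRank) (hslot : ∀ f, fOut ≤ f → φ' f = φ f) :
    HasRead n S (p + 1) φ' (k + 1) where
  input := hin.trans h.input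
  par := hpar
  alive e := by
    rw [edgesRead_succ (ha ▸ two_le_letterCode a), halive, Set.mem_insert_iff, ← h.alive]
    by_cases he : e = p + 1 <;> simp [he]
  edge i hi b hb := by
    rw [hname, hlab, hsrc, htgt]
    rcases Nat.lt_succ_iff_lt_or_eq.1 hi with hi | rfl
    · simpa [hi.ne] using h.edge i hi b hb
    · obtain rfl := letterCode_injective n (hb.symm.trans ha)
      simp
  queue := by
    rw [edgesRead_succ (ha ▸ two_le_letterCode a), hqueue]
    exact h.queue.push succ_notMem_edgesRead
  count_le := Nat.succ_le_succ h.count_le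
  rank := by rw [hrank]; exact h.rank
  slot f v hf := by rw [hslot f hf]; exact h.slot f v hf

end HasRead

namespace Cmd

variable {s : Store}

/-- Decode the letter `rCode` into a label and an edge between `rCur` and `rNext`. -/
def decode : ℕ → Cmd
  | 0 => skip
  | k + 1 =>
      const rTmp (2 * k + 2) ;;
      ite (.eq rCode rTmp) (const rLab k ;; copy rSrc rCur ;; copy rTgt rNext)
        (const rTmp (2 * k + 3) ;;
          ite (.eq rCode rTmp) (const rLab k ;; copy rSrc rNext ;; copy rTgt rCur) (decode k))

theorem mem_of_writesReg_decode {q : ℕ} (h : (decode k).WritesReg q) :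
    q ∈ [rTmp, rLab, rSrc, rTgt] := by
  induction k with
  | zero => exact h.elim
  | succ k ih =>
    simp only [decode, WritesReg, List.mem_cons, List.not_mem_nil] at *
    grind

theorem not_writesField_decode {f : ℕ} : ¬ (decode k).WritesField f := by
  induction k with
  | zero => exact id
  | succ k ih => simpa [decode] using ih

theorem wp_decode {a : Fin n × Bool} (ha : a.1 < k) (hcode : s.reg rCode = letterCode a) :
    (decode k).wp (fun s' => s'.reg rLab = a.1 ∧
      s'.reg rSrc = (if a.2 then s.reg rCur else s.reg rNext) ∧
      s'.reg rTgt = (if a.2 then s.reg rNext else s.reg rCur) ∧ s'.clk ≤ s.clk + 8 * k) s := by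
  obtain ⟨⟨x, hx⟩, b⟩ := a
  induction k generalizing s with
  | zero => exact absurd ha (Nat.not_lt_zero _)
  | succ k ih =>
    have hcode' : s.reg rCode = 2 * x + if b then 2 else 3 := hcode
    simp only [decode, wp_seq, wp_const, wp_ite, wp_copy, Test.Holds]
    refine ⟨fun h₁ => ?_, fun h₁ => ⟨fun h₂ => ?_, fun h₂ => ?_⟩⟩
    · simp only [Store.reg_set, Nat.reduceEqDiff, if_true, if_false, hcode'] at h₁
      obtain rfl : b = true := by cases b <;> simp at h₁ ⊢; omega
      simp at h₁ ⊢
      omega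
    · simp only [Store.reg_set, Store.reg_tick, Nat.reduceEqDiff, if_true, if_false, hcode'] at h₂
      obtain rfl : b = false := by cases b <;> simp at h₂ ⊢; omega
      simp at h₂ ⊢
      omega
    · simp only [Store.reg_set, Store.reg_tick, Nat.reduceEqDiff, if_true, if_false,
        hcode'] at h₁ h₂
      have hlt : x < k := by
        refine Nat.lt_of_le_of_ne (Nat.lt_succ_iff.1 ha) ?_
        rintro rfl
        cases b <;> simp at h₁ h₂
      refine (ih (s := (((s.set rTmp _).tick.set rTmp _)).tick) hlt (by simpa using hcode)).mono ?_
      rintro s' ⟨hL, hS, hT, hc⟩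
      refine ⟨hL, by simpa using hS, by simpa using hT, ?_⟩
      simp only [Store.clk_tick, Store.clk_set] at hc ⊢
      omega

/-- Find the vertex after the present letter, which is new unless the word ends here. -/
def enterVertex : Cmd :=
  load rAhead 0 rId ;;
  ite (.eq rAhead rOne) (const rNext 0) (copy rNext rId ;; store fPar rNext rNext)

theorem wp_enterVertex (h : HasRead n S p s.field k) (hp : 2 ≤ S p) (hone : s.reg rOne = 1)
    (hid : s.reg rId = p + 1) :
    enterVertex.wp (fun s' => s'.reg rNext = nextVertex S p ∧
      (∀ v, s'.field fPar v = v ↔ v ∈ visited S (p + 1)) ∧ s'.clk ≤ s.clk + 5) s := by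
  simp only [enterVertex, wp_seq, wp_load, wp_ite, wp_const, wp_copy, wp_store, Test.Holds]
  refine ⟨fun hend => ?_, fun hend => ?_⟩
  · have hnext : nextVertex S p = 0 := by
      rw [nextVertex, if_neg]
      simpa [hid, hone, h.input] using fun _ => hend
    rw [visited_succ_of_eq_zero hnext, hnext]
    exact ⟨by simp, by simpa using h.par, by simp⟩
  · have hnext : nextVertex S p = p + 1 := by
      rw [nextVertex, if_pos]
      simpa [hid, hone, h.input, hp] using hend
    rw [visited_succ, hnext]
    refine ⟨by simpa using hid, fun v => ?_, by simp⟩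
    rw [Set.mem_insert_iff, ← h.par]
    by_cases hv : v = p + 1 <;> simp [hid, hv]

/-- Create the edge `rId` from `rSrc` to `rTgt` with the label `rLab`, and continue in `rNext`. -/
def enterEdge : Cmd :=
  store fSrc rId rSrc ;; store fTgt rId rTgt ;; store fLab rId rLab ;; store fName rId rPos ;;
  store fAlive rId rOne ;; store fQueue rTail rId ;; succ rTail rTail ;; copy rCur rNext

/-- Read a letter and create the corresponding edge. -/
def readLetter (n : ℕ) : Cmd :=
  enterVertex ;; decode n ;; enterEdge

/-- The state between two passages of the loop in `read`: the program is about to read the letter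
at the place `p`. -/
structure Reading (n : ℕ) (S : ℕ → ℕ) (p : ℕ) (s : Store) : Prop where
  hasRead : HasRead n S p s.field (s.reg rTail)
  pos : s.reg rPos = p
  code : s.reg rCode = S p
  cur : s.reg rCur = curVertex S p
  zero : s.reg rZero = 0
  one : s.reg rOne = 1

theorem mem_of_writesReg_readLetter {q : ℕ} (h : (readLetter n).WritesReg q) :
    q ∈ [rCur, rAhead, rNext, rTmp, rLab, rSrc, rTgt, rTail] := by
  have := @mem_of_writesReg_decode n q
  simp only [readLetter, enterVertex, enterEdge, WritesReg, List.mem_cons,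
    List.not_mem_nil] at *
  grind

theorem wp_readLetter {a : Fin n × Bool} (h : HasRead n S p s.field (s.reg rTail))
    (ha : S p = letterCode a) (hcode : s.reg rCode = S p) (hcur : s.reg rCur = curVertex S p)
    (hone : s.reg rOne = 1) (hpos : s.reg rPos = p) (hid : s.reg rId = p + 1) :
    (readLetter n).wp (fun s' => HasRead n S (p + 1) s'.field (s'.reg rTail) ∧
      s'.reg rCur = nextVertex S p ∧ s'.clk ≤ s.clk + (8 * n + 13)) s := by
  simp only [readLetter, wp_seq]
  refine (wp_enterVertex h (ha ▸ two_le_letterCode a) hone hid).call ?_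
  rintro s₁ ⟨hnext, hpar, hc₁⟩ fr₁
  have hr₁ (q) (hq : q ∉ [rAhead, rNext]) : s₁.reg q = s.reg q :=
    fr₁.reg q (by simpa [enterVertex] using hq)
  have hf₁ (f) (hf : f ≠ fPar) : s₁.field f = s.field f :=
    fr₁.field f (by simpa [enterVertex] using hf)
  simp only [wp_seq]
  refine (wp_decode (s := s₁) a.1.2 (by rw [hr₁ _ (by simp), hcode, ha])).call ?_
  rintro s₂ ⟨hL, hS, hT, hc₂⟩ fr₂
  have hr₂ (q) (hq : q ∉ [rTmp, rLab, rSrc, rTgt]) : s₂.reg q = s₁.reg q :=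
    fr₂.reg q fun hw => hq (mem_of_writesReg_decode hw)
  have hf₂ : s₂.field = s₁.field := funext fun f => fr₂.field f not_writesField_decode
  have hreg (q) (hq : q ∉ [rAhead, rNext, rTmp, rLab, rSrc, rTgt]) : s₂.reg q = s.reg q := by
    simp only [List.mem_cons, not_or] at hq
    rw [hr₂ q (by simp [hq]), hr₁ q (by simp [hq])]
  rw [hr₁ rCur (by simp), hcur, hnext] at hS hT
  simp only [enterEdge, wp_seq, wp_store, wp_succ, wp_copy]
  refine ⟨?_, by simp [hr₂, hnext], ?_⟩
  · have hTail := hreg rTail (by simp)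
    have hId := (hreg rId (by simp)).trans hid
    have hPos := (hreg rPos (by simp)).trans hpos
    have hOne := (hreg rOne (by simp)).trans hone
    simp only [Store.reg_set, Store.reg_put, Store.field_set, Nat.reduceEqDiff, if_true, if_false,
      hTail]
    refine h.letter ha ?_ (fun v => ?_) ?_ ?_ ?_ ?_ ?_ ?_ ?_ fun f hf => ?_
    case refine_2 => simpa [hf₂] using hpar v
    all_goals
      funext v
      simp only [Store.field_put_apply, Function.update_apply, hf₂, hL, hS, hT, hId, hPos, hOne]
      grind
  · simp only [Store.clk_set, Store.clk_put]
    omega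

/-- Read the letter or the end mark at the place `rPos`, and fetch the next one. -/
def readNext (n : ℕ) : Cmd :=
  succ rId rPos ;; ite (.eq rCode rOne) (const rCur 0) (readLetter n) ;; copy rPos rId ;;
    load rCode 0 rPos

theorem mem_of_writesReg_readNext {q : ℕ} (h : (readNext n).WritesReg q) :
    q ∈ [rId, rCur, rAhead, rNext, rTmp, rLab, rSrc, rTgt, rTail, rPos, rCode] := by
  have := @mem_of_writesReg_readLetter n q
  simp only [readNext, WritesReg, List.mem_cons, List.not_mem_nil] at *
  grind

theorem wp_readNext (h : Reading n S p s)
    (hS : S p = 1 ∨ ∃ a : Fin n × Bool, S p = letterCode a) :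
    (readNext n).wp (fun s' => Reading n S (p + 1) s' ∧ s'.clk ≤ s.clk + (8 * n + 20)) s := by
  refine wp.call (Q := fun s' => HasRead n S (p + 1) s'.field (s'.reg rTail) ∧ s'.reg rPos = p + 1 ∧
    s'.reg rCode = S (p + 1) ∧ s'.reg rCur = nextVertex S p ∧ s'.clk ≤ s.clk + (8 * n + 20)) ?_ ?_
  · have hread := h.hasRead
    have hpos := h.pos
    simp only [readNext, wp_seq, wp_succ, wp_ite, wp_const, wp_copy, wp_load, Test.Holds]
    refine ⟨fun hmark => ?_, fun hmark => ?_⟩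
    · replace hmark : S p = 1 := by simpa [h.code, h.one] using hmark
      have hread' := hread.mark hmark
      exact ⟨by simpa using hread', by simp [hpos], by simp [hpos, hread.input],
        by simp [nextVertex, hmark], by simp; omega⟩
    · obtain ⟨a, ha⟩ := hS.resolve_left (by simpa [h.code, h.one] using hmark)
      refine (wp_readLetter (p := p) (by simpa using hread) ha (by simpa using h.code)
        (by simpa using h.cur) (by simpa using h.one) (by simpa using hpos)
        (by simp [hpos])).call ?_
      rintro s' ⟨hread', hcur, hclk⟩ fr
      have hid : s'.reg rId = p + 1 := by
        rw [fr.reg rId fun hw => by simpa using mem_of_writesReg_readLetter hw]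
        simp [hpos]
      exact ⟨by simpa using hread', by simp [hid], by simp [hid, hread'.input],
        by simpa using hcur, by simp at hclk ⊢; omega⟩
  · rintro s' ⟨hread, hpos, hcode, hcur, hclk⟩ fr
    have hreg (q) (hq : q = rZero ∨ q = rOne) : s'.reg q = s.reg q :=
      fr.reg q fun hw => by have := mem_of_writesReg_readNext hw; simp at this; omega
    exact ⟨⟨hread, hpos, hcode, hcur, (hreg _ (.inl rfl)).trans h.zero,
      (hreg _ (.inr rfl)).trans h.one⟩, hclk⟩

/-- Read the input. -/
def read (n : ℕ) : Cmd :=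
  const rOne 1 ;; load rCode 0 rPos ;; loopUntil (.eq rCode rZero) (readNext n)

theorem mem_of_writesReg_read {q : ℕ} (h : (read n).WritesReg q) :
    q ∈ [rOne, rId, rCur, rAhead, rNext, rTmp, rLab, rSrc, rTgt, rTail, rPos, rCode] := by
  have := @mem_of_writesReg_readNext n q
  simp only [read, WritesReg, List.mem_cons, List.not_mem_nil] at *
  grind

theorem wp_read {T : ℕ} (h : HasRead n S 0 s.field (s.reg rTail)) (hpos : s.reg rPos = 0)
    (hcur : s.reg rCur = 0) (hzero : s.reg rZero = 0) (hT : S T = 0)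
    (hS : ∀ p < T, S p = 1 ∨ ∃ a : Fin n × Bool, S p = letterCode a) :
    (read n).wp (fun s' => HasRead n S T s'.field (s'.reg rTail) ∧ s'.reg rPos = T ∧
      s'.reg rOne = 1 ∧ s'.clk ≤ s.clk + (T * (8 * n + 30) + 3)) s := by
  have hS₀ (p) (hp : p < T) : S p ≠ 0 := by
    rcases hS p hp with h | ⟨a, h⟩
    · omega
    · have := two_le_letterCode a
      omega
  simp only [read, wp_seq, wp_const, wp_load]
  refine wp_loopUntil
    (I := fun s₁ => ∃ p ≤ T, Reading n S p s₁ ∧ s₁.clk ≤ s.clk + (p * (8 * n + 30) + 2))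
    (B := s.clk + (T * (8 * n + 30) + 2)) ?_ ?_ ?_ ?_
  · exact ⟨0, T.zero_le, ⟨by simpa using h, by simpa using hpos, by simp [hpos, h.input],
      by simpa [curVertex] using hcur, by simpa using hzero, by simp⟩, by simp⟩
  · rintro s₁ ⟨p, hp, -, hc⟩
    have := Nat.mul_le_mul_right (8 * n + 30) hp
    omega
  · rintro s₁ ⟨p, hp, hr, hc⟩ (hend : s₁.reg rCode = s₁.reg rZero)
    obtain rfl : p = T := by
      by_contra hne
      exact hS₀ p (by omega) (by rw [← hr.code, hend, hr.zero])
    refine ⟨hr.hasRead, hr.pos, hr.one, ?_⟩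
    rw [Store.clk_tick]
    omega
  · rintro s₁ ⟨p, hp, hr, hc⟩ (hend : s₁.reg rCode ≠ s₁.reg rZero)
    have hp' : p < T := by
      refine Nat.lt_of_le_of_ne hp ?_
      rintro rfl
      exact hend (by rw [hr.code, hr.zero, hT])
    refine (wp_readNext (s := s₁.tick) ⟨hr.hasRead, hr.pos, hr.code, hr.cur, hr.zero, hr.one⟩
      (hS p hp')).mono ?_
    rintro s₂ ⟨hr₂, hc₂⟩
    refine ⟨p + 1, hp', ⟨hr₂.hasRead, hr₂.pos, hr₂.code, hr₂.cur, hr₂.zero, hr₂.one⟩, ?_⟩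
    rw [Store.clk_tick] at hc₂ ⊢
    rw [Nat.succ_mul]
    omega

end Cmd

end Read

/-! ### The input string and the bouquet -/

section Input

variable {n : ℕ} {J : List (Word n)}

/-- The input string as a function; it is `0` from the end of the string on. -/
def inputFun (J : List (Word n)) (p : ℕ) : ℕ := (inputString J).getD p 0

/-- The place where the `i`-th word starts. -/
def wordStart (J : List (Word n)) (i : ℕ) : ℕ := (inputString (J.take i)).length

theorem inputString_append (J K : List (Word n)) :
    inputString (J ++ K) = inputString J ++ inputString K := by
  simp [inputString]

theorem inputString_take_succ (i : Fin J.length) :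
    inputString (J.take (i + 1)) =
      inputString (J.take i) ++ ((J.get i).map letterCode ++ [1]) := by
  rw [List.take_add_one, List.getElem?_eq_getElem i.2, inputString_append]
  simp [inputString]

theorem wordStart_succ (i : Fin J.length) :
    wordStart J (i + 1) = wordStart J i + (J.get i).length + 1 := by
  rw [wordStart, inputString_take_succ]
  simp [wordStart, add_assoc]

theorem wordStart_length (J : List (Word n)) : wordStart J J.length = (inputString J).length := by
  rw [wordStart, List.take_length]

theorem wordStart_mono (J : List (Word n)) : Monotone (wordStart J) := by
  refine monotone_nat_of_le_succ fun i => ?_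
  by_cases hi : i < J.length
  · have h : wordStart J (i + 1) = _ := wordStart_succ ⟨i, hi⟩
    exact (Nat.le_add_right _ _).trans ((Nat.le_add_right _ _).trans h.ge)
  · rw [wordStart, wordStart, List.take_of_length_le (by omega), List.take_of_length_le (by omega)]

theorem inputFun_add (i : Fin J.length) {k : ℕ} (hk : k ≤ (J.get i).length) :
    inputFun J (wordStart J i + k) = ((J.get i).map letterCode ++ [1]).getD k 0 := by
  have hsplit : inputString J = inputString (J.take i) ++
      (((J.get i).map letterCode ++ [1]) ++ inputString (J.drop (i + 1))) := by
    rw [← List.append_assoc, ← inputString_take_succ, ← inputString_append, List.take_append_drop]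
  rw [inputFun, hsplit, wordStart, List.getD_append_right _ _ _ _ (Nat.le_add_right _ _),
    Nat.add_sub_cancel_left, List.getD_append _ _ _ _ (by simpa using Nat.lt_succ_of_le hk)]

theorem inputFun_mark (i : Fin J.length) : inputFun J (wordStart J i + (J.get i).length) = 1 := by
  rw [inputFun_add i le_rfl, List.getD_append_right _ _ _ _ (by simp)]
  simp

theorem inputFun_edgeName (e : BouquetEdge J) :
    inputFun J (edgeName J e) = letterCode ((J.get e.1).get e.2) := by
  refine (inputFun_add e.1 e.2.2.le).trans ?_
  rw [List.getD_append _ _ _ _ (by simp)]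
  simp

theorem inputFun_length (J : List (Word n)) : inputFun J (inputString J).length = 0 := by
  simp [inputFun]

theorem exists_edge_or_mark {p : ℕ} (hp : p < (inputString J).length) :
    (∃ e, edgeName J e = p) ∨ inputFun J p = 1 := by
  have key (m) (hm : m ≤ J.length) (hp : p < wordStart J m) :
      (∃ e, edgeName J e = p) ∨ inputFun J p = 1 := by
    induction m with
    | zero => simp [wordStart, inputString] at hp
    | succ m ih =>
      by_cases h : p < wordStart J m
      · exact ih (by omega) h
      have hsucc : wordStart J (m + 1) = wordStart J m + _ + 1 := wordStart_succ ⟨m, hm⟩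
      obtain ⟨k, rfl⟩ := Nat.exists_eq_add_of_le (not_lt.1 h)
      rcases Nat.lt_succ_iff_lt_or_eq.1 (show k < (J.get ⟨m, hm⟩).length + 1 by omega) with hk | rfl
      · exact .inl ⟨⟨⟨m, hm⟩, ⟨k, hk⟩⟩, rfl⟩
      · exact .inr (inputFun_mark ⟨m, hm⟩)
  exact key J.length le_rfl (hp.trans_eq (wordStart_length J).symm)

theorem two_le_inputFun_edgeName (e : BouquetEdge J) : 2 ≤ inputFun J (edgeName J e) :=
  (two_le_letterCode _).trans_eq (inputFun_edgeName e).symm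

theorem edgeName_lt (e : BouquetEdge J) : edgeName J e < (inputString J).length := by
  have h₁ := wordStart_mono J (show (e.1 : ℕ) + 1 ≤ J.length from e.1.2)
  have h₂ := e.2.2
  rw [wordStart_succ, wordStart_length] at h₁
  change wordStart J e.1 + e.2 < _
  omega

theorem wordStart_add_inj {i j : Fin J.length} {k l : ℕ} (hk : k ≤ (J.get i).length)
    (hl : l ≤ (J.get j).length) (h : wordStart J i + k = wordStart J j + l) : i = j ∧ k = l := by
  have not_lt_of_eq {i j : Fin J.length} {k l : ℕ} (hk : k ≤ (J.get i).length)
      (h : wordStart J i + k = wordStart J j + l) : ¬ i < j := fun hij => by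
    have h₁ := wordStart_mono J (show (i : ℕ) + 1 ≤ j from hij)
    rw [wordStart_succ] at h₁
    omega
  obtain rfl := le_antisymm (not_lt.1 (not_lt_of_eq hl h.symm)) (not_lt.1 (not_lt_of_eq hk h))
  exact ⟨rfl, by omega⟩

theorem edgeName_injective (J : List (Word n)) : Function.Injective (edgeName J) := by
  rintro ⟨i, k⟩ ⟨j, l⟩ h
  obtain ⟨rfl, hkl⟩ := wordStart_add_inj (J := J) k.2.le l.2.le h
  rw [Fin.ext hkl]

/-- The number of a vertex of the bouquet. An inner vertex of a loop has the number of the edge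
that is read before it. -/
def vertexId (J : List (Word n)) : BouquetVertex J → ℕ
  | none => 0
  | some v => wordStart J v.1 + v.2 + 1

/-- The number of an edge of the bouquet; the number `0` is not used. -/
def edgeId (J : List (Word n)) (e : BouquetEdge J) : ℕ := edgeName J e + 1

theorem edgeId_injective (J : List (Word n)) : Function.Injective (edgeId J) := fun _ _ h =>
  edgeName_injective J (Nat.succ_injective h)

theorem vertexId_injective (J : List (Word n)) : Function.Injective (vertexId J) := by
  rintro (_ | ⟨i, k⟩) (_ | ⟨j, l⟩) h
  · rfl
  · simp [vertexId] at h
  · simp [vertexId] at h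
  · obtain ⟨rfl, hkl⟩ := wordStart_add_inj (J := J) (i := i) (j := j) (k := k) (l := l) (by omega)
      (by omega) (Nat.succ_injective h)
    rw [Fin.ext hkl]

theorem nextVertex_edgeName (e : BouquetEdge J) :
    nextVertex (inputFun J) (edgeName J e) = vertexId J (loopVertex J e.1 (e.2 + 1)) := by
  obtain ⟨i, k, hk⟩ := e
  have hletter := two_le_inputFun_edgeName (J := J) ⟨i, k, hk⟩
  rw [nextVertex, loopVertex]
  by_cases hk' : k + 1 < (J.get i).length
  · have hnext : 2 ≤ inputFun J (edgeName J ⟨i, k, hk⟩ + 1) :=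
      two_le_inputFun_edgeName ⟨i, k + 1, hk'⟩
    rw [if_pos ⟨hletter, by omega⟩, dif_pos ⟨k.succ_pos, hk'⟩]
    rfl
  · have hnext : inputFun J (edgeName J ⟨i, k, hk⟩ + 1) = 1 := by
      have hlast : k + 1 = (J.get i).length := by omega
      exact (congrArg (fun l => inputFun J (wordStart J i + l)) hlast).trans (inputFun_mark i)
    rw [if_neg fun h => h.2 hnext, dif_neg fun h => hk' h.2]
    rfl

theorem nextVertex_mark {p : ℕ} (h : inputFun J p = 1) : nextVertex (inputFun J) p = 0 := by
  simp [nextVertex, h]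

theorem curVertex_wordStart (i : Fin J.length) : curVertex (inputFun J) (wordStart J i) = 0 := by
  obtain ⟨_ | i, hi⟩ := i
  · simp [wordStart, inputString, curVertex]
  · rw [wordStart_succ ⟨i, by omega⟩]
    exact nextVertex_mark (inputFun_mark ⟨i, by omega⟩)

theorem curVertex_edgeName (e : BouquetEdge J) :
    curVertex (inputFun J) (edgeName J e) = vertexId J (loopVertex J e.1 e.2) := by
  obtain ⟨i, k, hk⟩ := e
  cases k with
  | zero => exact (curVertex_wordStart i).trans (by simp [loopVertex, vertexId])
  | succ k => exact nextVertex_edgeName ⟨i, k, by omega⟩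

theorem visited_inputFun (J : List (Word n)) :
    visited (inputFun J) (inputString J).length = Set.range (vertexId J) := by
  refine Set.Subset.antisymm ?_ ?_
  · rintro _ (rfl | ⟨p, hp, rfl⟩)
    · exact ⟨none, rfl⟩
    rcases exists_edge_or_mark hp with ⟨e, rfl⟩ | h
    · exact ⟨_, (nextVertex_edgeName e).symm⟩
    · exact ⟨none, (nextVertex_mark h).symm⟩
  · rintro _ ⟨_ | ⟨i, k, hk⟩, rfl⟩
    · exact Set.mem_insert _ _
    have hk' : k + 1 < (J.get i).length := by omega
    refine .inr ⟨edgeName J ⟨i, k, by omega⟩, edgeName_lt _, ?_⟩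
    rw [nextVertex_edgeName, loopVertex, dif_pos ⟨k.succ_pos, hk'⟩]
    rfl

theorem edgesRead_inputFun (J : List (Word n)) :
    edgesRead (inputFun J) (inputString J).length = Set.range (edgeId J) := by
  have hrange : {p | p < (inputString J).length ∧ 2 ≤ inputFun J p} = Set.range (edgeName J) := by
    refine Set.Subset.antisymm ?_ ?_
    · rintro p ⟨hp, h⟩
      exact (exists_edge_or_mark hp).resolve_right (by omega)
    · rintro _ ⟨e, rfl⟩
      exact ⟨edgeName_lt e, two_le_inputFun_edgeName e⟩
  rw [edgesRead, hrange, ← Set.range_comp]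
  rfl

theorem le_of_mem_visited {S : ℕ → ℕ} {p v : ℕ} (h : v ∈ visited S p) : v ≤ p := by
  rcases h with rfl | ⟨i, hi, rfl⟩
  · exact p.zero_le
  · rw [nextVertex]
    split_ifs
    exacts [hi, p.zero_le]

/-- The numbers of the vertices of the bouquet. -/
def vertexIds (J : List (Word n)) : Finset ℕ := Finset.univ.image (vertexId J)

theorem mem_vertexIds {v : ℕ} :
    v ∈ vertexIds J ↔ v ∈ visited (inputFun J) (inputString J).length := by
  simp [vertexIds, visited_inputFun]

theorem vertexId_mem (u : BouquetVertex J) : vertexId J u ∈ vertexIds J :=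
  Finset.mem_image_of_mem _ (Finset.mem_univ u)

theorem totalLength_eq_sum (J : List (Word n)) :
    totalLength J = ∑ i : Fin J.length, (J.get i).length := by
  rw [totalLength, ← Fin.sum_univ_fun_getElem]
  rfl

theorem length_inputString (J : List (Word n)) :
    (inputString J).length = totalLength J + J.length := by
  induction J with
  | nil => rfl
  | cons w J ih =>
    rw [← List.singleton_append, inputString_append, List.length_append, ih]
    simp [inputString, totalLength]
    omega

theorem length_inputString_le (h : ∀ w ∈ J, w ≠ []) :
    (inputString J).length ≤ 2 * totalLength J := by
  have hlen : J.length ≤ totalLength J := by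
    simpa [totalLength] using List.length_le_sum_of_one_le (J.map List.length)
      (by simpa [Nat.one_le_iff_ne_zero] using h)
  rw [length_inputString]
  omega

theorem card_vertexIds_le (h : ∀ w ∈ J, w ≠ []) (hN : totalLength J ≠ 0) :
    (vertexIds J).card ≤ totalLength J := by
  have hJ : J ≠ [] := by
    rintro rfl
    exact hN rfl
  rw [vertexIds, Finset.card_image_of_injective _ (vertexId_injective J), Finset.card_univ,
    Fintype.card_option, Fintype.card_sigma, totalLength_eq_sum]
  refine Nat.succ_le_of_lt (Finset.sum_lt_sum (fun i _ => by simp)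
    ⟨⟨0, List.length_pos_iff.2 hJ⟩, Finset.mem_univ _, ?_⟩)
  have := List.length_pos_iff.2 (h _ (List.get_mem J ⟨0, List.length_pos_iff.2 hJ⟩))
  rw [Fintype.card_fin]
  omega

end Input

section Correctness

variable {n : ℕ} {J : List (Word n)} {s s' : Store}

theorem hasRead_zero (J : List (Word n)) :
    HasRead n (inputFun J) 0 (initialConfig J).field 0 where
  input := rfl
  par v := by simp [initialConfig, visited, eq_comm]
  alive e := by simp [initialConfig, edgesRead]
  edge i hi := absurd hi i.not_lt_zero
  queue := ⟨le_rfl, by simp [edgesRead]⟩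
  count_le := le_rfl
  rank v := by simp [initialConfig]
  slot f v hf := if_neg (ne_of_gt (lt_of_lt_of_le (by simp) hf))

theorem HasRead.record (h : HasRead n (inputFun J) (inputString J).length s.field (s.reg rTail))
    (hLen : s.reg 0 = 0) :
    Record (bouquet J) (vertexId J) (edgeId J) (edgeName J) Set.univ [] s where
  ends d e := by
    obtain ⟨-, -, hsrc, htgt⟩ := h.edge _ (edgeName_lt e) _ (inputFun_edgeName e)
    rw [nextVertex_edgeName (J := J) e, curVertex_edgeName (J := J) e] at hsrc htgt
    cases d
    · exact htgt.trans (apply_ite (vertexId J) _ _ _).symm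
    · exact hsrc.trans (apply_ite (vertexId J) _ _ _).symm
  lab e := (h.edge _ (edgeName_lt e) _ (inputFun_edgeName e)).2.1
  name_eq e := (h.edge _ (edgeName_lt e) _ (inputFun_edgeName e)).1
  alive e := by
    rw [h.alive, edgesRead_inputFun]
    exact (Set.ext_iff.1 Set.image_univ e).symm
  length_eq := hLen
  pairs k hk := absurd hk k.not_lt_zero

theorem HasRead.forest {k : ℕ}
    (h : HasRead n (inputFun J) (inputString J).length s.field k) :
    Forest (vertexIds J) id (s.field fPar) (s.field fRank) :=
  .of_par_eq_self (fun v hv => (h.par v).2 (mem_vertexIds.1 hv)) fun v _ => h.rank v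

theorem HasRead.folding (h : HasRead n (inputFun J) (inputString J).length s.field (s.reg rTail))
    (hHead : s.reg rHead = 0) (hZero : s.reg rZero = 0) (hLen : s.reg 0 = 0) :
    Folding (bouquet J) (vertexIds J) (vertexId J) (edgeId J) (edgeName J) id Set.univ
      (edgeId J '' Set.univ) [] s where
  work :=
    { forest := h.forest
      slots :=
        { mem := fun d x v _ hne =>
            absurd (h.slot _ v ((fOut_le_fSlot d).trans (Nat.le_add_left _ _))) hne
          eq_of_mem := fun e he => absurd he.1 he.2 }
      edge := by
        rintro _ ⟨e, -, rfl⟩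
        refine ⟨Nat.succ_ne_zero _, fun d => ?_, ?_⟩
        · rw [(h.record hLen).ends]
          exact vertexId_mem _
        · rw [(h.record hLen).lab]
          exact ((bouquet J).label e).2
      pend_subset := subset_rfl
      queue := by
        rw [hHead, Set.image_univ, ← edgesRead_inputFun]
        exact h.queue
      outside := fun v hv hpar => hv (mem_vertexIds.2 ((h.par v).1 hpar))
      zero := hZero }
  record := h.record hLen
  folds := LGraph.foldsTo_nil (vertexId_injective J)

theorem Work.image_root {V : Finset ℕ} {root : ℕ → ℕ} {A pend : Set ℕ}
    (h : Work n V root A pend s) : root '' V = {v | s.field fPar v = v} := by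
  refine Set.Subset.antisymm ?_ fun v hv => ?_
  · rintro _ ⟨v, hv, rfl⟩
    exact h.forest.par_root v hv
  · have hvV : v ∈ V := by_contra fun hvV => h.outside v hvV hv
    exact ⟨v, hvV, h.forest.root_eq_self v hvV hv⟩

variable {root num idx : ℕ → ℕ} {A : Set (bouquet J).E}
  {L : List ((bouquet J).E × (bouquet J).E)}

theorem Folding.range_root {pend : Set ℕ} (h : Folding (bouquet J) (vertexIds J) (vertexId J)
      (edgeId J) (edgeName J) root A pend L s) :
    Set.range (root ∘ vertexId J) =
      Set.Iio ((inputString J).length + 1) ∩ {v | s.field fPar v = v} := by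
  have hrange : Set.range (vertexId J) = vertexIds J := by simp [vertexIds]
  rw [Set.range_comp, hrange, eq_comm, ← h.work.image_root, Set.inter_eq_right]
  rintro _ ⟨v, hv, rfl⟩
  exact Nat.lt_succ_of_le (le_of_mem_visited (mem_vertexIds.1 (h.work.forest.root_mem v hv)))

theorem Record.bijOn_idx
    (h : Record (bouquet J) (vertexId J) (edgeId J) (edgeName J) A L s)
    (hE : EdgesWritten root num s ((inputString J).length + 1) idx s') :
    Set.BijOn (idx ∘ edgeId J) A (Set.Iio (s'.reg 2)) := by
  have halive : Set.Iio ((inputString J).length + 1) ∩ {e | s.field fAlive e = 1} =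
      edgeId J '' A := by
    ext e
    refine (and_congr_right fun _ => h.alive e).trans (and_iff_right_of_imp ?_)
    rintro ⟨e, -, rfl⟩
    exact Nat.succ_lt_succ (edgeName_lt e)
  have hidx := hE.numbers
  rw [Numbers, halive] at hidx
  exact hidx.comp (edgeId_injective J).injOn.bijOn_image

theorem Folding.stores (h : Folding (bouquet J) (vertexIds J) (vertexId J) (edgeId J)
      (edgeName J) root A ∅ L s)
    (hnum : Numbers {v | s.field fPar v = v} num ((inputString J).length + 1) (s'.reg 1))
    (hbase : s'.reg 3 = num (root 0))
    (hE : EdgesWritten root num s ((inputString J).length + 1) idx s')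
    (hreg : s'.reg 0 = s.reg 0) (hfst : s'.field 1 = s.field 1) (hsnd : s'.field 2 = s.field 2)
    (pc : ℕ) : StoresFoldingProcess J (s'.cfg pc) := by
  obtain ⟨Γ, π, hfold, hπ⟩ := h.folds
  have hpairs : StoresFoldings J (s'.cfg pc) L :=
    ⟨hreg.trans h.record.length_eq, fun k =>
      (h.record.pairs k k.2).imp (congrFun hfst k).trans (congrFun hsnd k).trans⟩
  refine ⟨Γ, π, L, hfold, hπ.folded fun e he e' he' hlab hinc => ?_, hpairs,
    storesGraph_of_isEncodedBy hπ (h.range_root ▸ hnum) hbase (h.record.bijOn_idx hE)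
      fun e he => ?_⟩
  · obtain ⟨d, hd⟩ : ∃ d, root (s.field (fEnd d) (edgeId J e)) =
        root (s.field (fEnd d) (edgeId J e')) := by
      rcases hinc with hinc | hinc
      · exact ⟨true, by simpa only [h.record.ends] using! hinc⟩
      · exact ⟨false, by simpa only [h.record.ends] using! hinc⟩
    have hslot := h.work.slots.eq_of_mem (edgeId J e) ⟨⟨e, he, rfl⟩, id⟩ d
    have hslot' := h.work.slots.eq_of_mem (edgeId J e') ⟨⟨e', he', rfl⟩, id⟩ d
    refine edgeId_injective J (hslot.symm.trans ?_)
    rwa [h.record.lab, hlab, ← h.record.lab, hd]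
  · obtain ⟨hsrc, hlab, htgt⟩ := hE.entries (edgeId J e) (Nat.succ_lt_succ (edgeName_lt e))
      ((h.record.alive _).2 ⟨e, he, rfl⟩)
    exact ⟨hsrc.trans (congrArg (num ∘ root) (h.record.ends true e)),
      hlab.trans (h.record.lab e), htgt.trans (congrArg (num ∘ root) (h.record.ends false e))⟩

end Correctness

/-! ### The running time -/

/-- The credit of an edge in the queue; `G` bounds the grades of the ranks. -/
def edgeCost (n G : ℕ) : ℕ := 36 * G + 12 * n + 142

/-- The weight of a root in the potential. It pays for the transfer of the slots of the root when
the root is linked to another one. -/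
def rootWeight (n G : ℕ) : ℕ := n * (2 * (6 * G + 9 * n + 14 + edgeCost n G) + 3) + 20

/-- A bound for the running time on an input string of length `T` that gives `V` vertices. -/
def runningTime (n G V T : ℕ) : ℕ :=
  T * (8 * n + 30) + 4 + 6 * (V * (rootWeight n G + G + 1)) + edgeCost n G * T +
    (T + 1) * (18 * G + 60)

theorem edgeCost_le {n G g : ℕ} (hG : G ≤ g) (hg : 1 ≤ g) : edgeCost n G ≤ edgeCost n 1 * g := by
  have hn : n ≤ n * g := Nat.le_mul_of_pos_right n hg
  have : edgeCost n 1 * g = 36 * g + 12 * (n * g) + 142 * g := by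
    rw [edgeCost]
    ring
  rw [this, edgeCost]
  omega

theorem rootWeight_le {n G g : ℕ} (hG : G ≤ g) (hg : 1 ≤ g) :
    rootWeight n G ≤ rootWeight n 1 * g := by
  have hn : n ≤ n * g := Nat.le_mul_of_pos_right n hg
  have ha : edgeCost n G ≤ edgeCost n 1 * g := edgeCost_le hG hg
  calc rootWeight n G
      ≤ n * (2 * (6 * g + 9 * (n * g) + 14 * g + edgeCost n 1 * g) + 3 * g) + 20 * g := by
        unfold rootWeight
        gcongr <;> omega
    _ = rootWeight n 1 * g := by
        rw [rootWeight]
        ring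

theorem exists_runningTime_le (n : ℕ) : ∃ C, ∀ N T V G g, 2 ≤ N → T ≤ 2 * N → V ≤ N → G ≤ g →
    1 ≤ g → runningTime n G V T ≤ C * (N * g) := by
  refine ⟨2 * (8 * n + 30) + 4 + 6 * (rootWeight n 1 + 2) + 2 * edgeCost n 1 + 234,
    fun N T V G g hN hT hV hG hg => ?_⟩
  have hNg : N ≤ N * g := Nat.le_mul_of_pos_right N hg
  have hW := rootWeight_le (n := n) hG hg
  have hread : T * (8 * n + 30) ≤ 2 * (N * g) * (8 * n + 30) := Nat.mul_le_mul_right _ (by omega)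
  have hroots : V * (rootWeight n G + G + 1) ≤ N * (rootWeight n 1 * g + 2 * g) :=
    Nat.mul_le_mul hV (by omega)
  have hedges : edgeCost n G * T ≤ edgeCost n 1 * g * (2 * N) :=
    Nat.mul_le_mul (edgeCost_le hG hg) hT
  have hwrite : (T + 1) * (18 * G + 60) ≤ 3 * N * (78 * g) :=
    Nat.mul_le_mul (by omega) (by omega)
  calc runningTime n G V T
      ≤ 2 * (N * g) * (8 * n + 30) + 4 * (N * g) + 6 * (N * (rootWeight n 1 * g + 2 * g)) +
        edgeCost n 1 * g * (2 * N) + 3 * N * (78 * g) := by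
        unfold runningTime
        omega
    _ = _ := by ring

namespace Cmd

variable {n : ℕ} {J : List (Word n)}

/-- Read the input, fold, and write the folded graph. -/
def foldingProgram (n : ℕ) : Cmd := read n ;; foldAll n ;; output

theorem wp_foldingProgram {G : ℕ} (hG : (vertexIds J).card ≤ tower G) :
    (foldingProgram n).wp (fun s' => (∀ pc, StoresFoldingProcess J (s'.cfg pc)) ∧
      s'.clk ≤ runningTime n G (vertexIds J).card (inputString J).length)
      ⟨(initialConfig J).reg, (initialConfig J).field, 0⟩ := by
  have hletter (p) (hp : p < (inputString J).length) :
      inputFun J p = 1 ∨ ∃ a : Fin n × Bool, inputFun J p = letterCode a := by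
    rcases exists_edge_or_mark hp with ⟨e, rfl⟩ | h
    exacts [.inr ⟨_, inputFun_edgeName e⟩, .inl h]
  rw [foldingProgram, wp_seq]
  refine (wp_read (hasRead_zero J) rfl rfl rfl (inputFun_length J) hletter).call ?_
  rintro s₁ ⟨hread, hpos, hone, hclk₁⟩ fr₁
  rw [wp_seq]
  have hfold := hread.folding (fr₁.reg _ fun hw => by simpa using mem_of_writesReg_read hw)
    (fr₁.reg _ fun hw => by simpa using mem_of_writesReg_read hw)
    (fr₁.reg _ fun hw => by simpa using mem_of_writesReg_read hw)
  have hpot := potential_of_par_eq_self (G := G) (W := rootWeight n G)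
    (fun v hv => (hread.par v).2 (mem_vertexIds.1 hv)) fun v (_ : v ∈ vertexIds J) => hread.rank v
  refine (wp_foldAll (G := G) (W := rootWeight n G) (a := edgeCost n G) hfold (edgeId_injective J)
    vertexId_mem hG (by unfold rootWeight; omega) le_rfl
    (fr₁.reg _ fun hw => by simpa using mem_of_writesReg_read hw)).call ?_
  rintro s₂ ⟨⟨root, A, L, h⟩, hclk₂⟩ fr₂
  rw [← fr₂.reg rOne fun hw => by simpa using mem_of_writesReg_foldAll hw] at hone
  rw [← fr₂.reg rPos fun hw => by simpa using mem_of_writesReg_foldAll hw] at hpos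
  refine (wp_output (W := rootWeight n G) h.work.forest hG hone (vertexId_mem (J := J) none)
    fun e he => ?_).call ?_
  · have hends := (h.work.edge e ((h.record.alive e).1 he)).2.1
    exact ⟨hends true, hends false⟩
  rintro s₃ ⟨⟨num, idx, hnum, hbase, hE⟩, hclk₃⟩ fr₃
  rw [hpos] at hnum hE hclk₃
  have htail := Nat.mul_le_mul_left (edgeCost n G) hread.count_le
  simp only [charge, hpot, zero_add] at hclk₁ hclk₂
  refine ⟨h.stores hnum hbase hE (fr₃.reg _ fun hw => by simpa using mem_of_writesReg_output hw)
    (fr₃.field _ fun hw => by simpa using mem_of_writesField_output hw)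
    (fr₃.field _ fun hw => by simpa using mem_of_writesField_output hw), ?_⟩
  unfold runningTime
  omega

end Cmd

end Stallings

theorem theorem1 (n : ℕ) :
    ∃ (P : Stallings.Program) (C : ℕ), ∀ J : List (Stallings.Word n),
      ∃ (t : ℕ) (c : Stallings.Config),
        P.HaltsWithin (Stallings.initialConfig J) t c ∧
        Stallings.StoresFoldingProcess J c ∧
        ((∀ w ∈ J, w ≠ []) → 2 ≤ Stallings.totalLength J →
          t ≤ C * (Stallings.totalLength J * Stallings.logStar (Stallings.totalLength J))) := by
  obtain ⟨C, hC⟩ := Stallings.exists_runningTime_le n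
  refine ⟨(Stallings.Cmd.foldingProgram n).code 0, C, fun J => ?_⟩
  obtain ⟨s, hs, hst, hclk⟩ :=
    Stallings.Cmd.wp_foldingProgram (J := J) (Stallings.le_tower_grade _)
  refine ⟨s.clk, _, hs.haltsWithin rfl, hst _, fun hJ hN => hclk.trans ?_⟩
  have hV := Stallings.card_vertexIds_le hJ (by omega)
  exact hC _ _ _ _ _ hN (Stallings.length_inputString_le hJ) hV
    (Stallings.grade_le_iff.2 (hV.trans (Stallings.le_tower_logStar _)))
    (Stallings.logStar_pos hN)
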